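/- **Conventions.** A geodesic bicombing on a metric space $X$ is a map $\gamma\colon X\times X\times[0,1]\to X$ with $\gamma(x,y,0)=x$, $\gamma(x,y,1)=y$ and $d(\gamma(x,y,t),\gamma(x,y,s))=|t-s|\,d(x,y)$. For $E\ge 1$, $C\ge 0$ it is $(E,C)$-geodesic coarsely convex (gcc) if for all $x_1,x_2,y_1,y_2\in X$ and $a,b,c\in[0,1]$ $$d(\gamma(x_1,y_1,ca),\gamma(x_2,y_2,cb))\le (1-c)E\,d(x_1,x_2)+cE\,d(\gamma(x_1,y_1,a),\gamma(x_2,y_2,b))+C .$$ *Ideal boundary.* Let $\gamma$ be an $(E,C)$-gcc bicombing on $X$ and $e\in X$ a base point. Let $\bar\gamma(x,y,t)=\gamma(x,y,t/d(x,y))$ for $t\le d(x,y)$ and $\bar\gamma(x,y,t)=y$ for $t>d(x,y)$. With $D_1=2(2(1+E)+C)+2$ put $$(x\mid y)_e=\min\{d(e,x),\,d(e,y),\,\sup\{t\ge 0: d(\bar\gamma(e,x,t),\bar\gamma(e,y,t))\le D_1\}\}.$$ The ideal boundary $\partial X$ is the set of sequences $(x_i)$ in $X$ with $(x_i\mid x_j)_e\to\infty$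 as $i,j\to\infty$, modulo $(x_i)\sim(y_i)$ iff $(x_i\mid y_i)_e\to\infty$. On $\overline X=X\sqcup\partial X$ the product is extended by $(x\mid y)=\sup\liminf_i(x_i\mid y_i)_e$, over the sequences $(x_i)$, $(y_i)$ that represent $x$, $y$ (only the constant sequence represents a point of $X$). $\overline X$ has the topology of the uniformity with base $V_n=\{(x,y):(x\mid y)>n\}\cup\{(x,y)\in X\times X:d(x,y)<1/n\}$, $n\ge1$, and $\partial X$ has the subspace topology. *Trees of spaces.* Let $T$ be (the geometric realization of) a bipartite tree with vertex set $K\sqcup L$, $K\neq\emptyset$. Let $Z$ be a proper geodesic metric space and $\xi\colon Z\to T$ a continuous map such that $\xi^{-1}(l)$ is a single point for every $l\in L$, and $X_k:=\xi^{-1}(\mathrm{star}(k))$, with $\mathrm{star}(k)$ the closed star, is a geodesic space for every $k\in K$. Suppose that $Z$ is a tree of geodesic coarsely convex spaces: for some constants $E',C'$ every $X_k$ admits an $(E',C')$-gcc bicombing. Let $L^\circ\subset L$ be the set of those $l$ that are adjacent to at least two vertices in $K$. *Augmented space.* For each $k\in K$ let $X_k^{(0)}\subset X_k$ be a subset in which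 distinct points have distance at least $1$, and such that every point of $X_k$ has distance at most $2$ from it. The augmented space $\mathrm{aug}(Z)$, with its quotient (gluing) metric, is obtained from $Z$ by gluing to it, for every $k\in K$, the combinatorial horoball on $X_k^{(0)}$: the graph with vertex set $X_k^{(0)}\times\mathbb Z_{\ge0}$ and edges of length one, with a vertical edge from $(x,l)$ to $(x,l+1)$ for all $x$ and $l\ge0$, and a horizontal edge between $(x,l)$ and $(y,l)$ whenever $l\ge1$ and $0<d(x,y)\le2^l$; the vertex $(x,0)$ is glued to $x\in X_k\subset Z$. The union of $X_k$ and the combinatorial horoball on $X_k^{(0)}$ is the metric horoball $\mathcal H(X_k)\subset\mathrm{aug}(Z)$. **Theorem.** The space $\mathrm{aug}(Z)$ admits a geodesic coarsely convex bicombing. For all $E\geq 1$, $C\ge 0$, every $(E,C)$-gcc bicombing on $\mathrm{aug}(Z)$ and every base point, the ideal boundary $\partial\,\mathrm{aug}(Z)$ has the following properties. For every $k\in K$ the set $\overline{\mathcal H(X_k)}\setminus\mathcal H(X_k)$ (closure in $\overline{\mathrm{aug}(Z)}$) consists of a single point $c_k\in\partial\,\mathrm{aug}(Z)$, the center of the horoball,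 and: 1. the set of isolated points of $\partial\,\mathrm{aug}(Z)$ is $\{c_k : k\in K,\ X_k\cap\xi^{-1}(L^\circ)\text{ is bounded}\}$; 2. if $\partial\,\mathrm{aug}(Z)$ has no isolated point, then it is homeomorphic to the Cantor space. -/

import Mathlib

open Set Filter Topology
open scoped NNReal ENNReal

noncomputable section

universe u v w

/-! ### Geodesic bicombings -/

/-- A metric space in which any two points are joined by a geodesic (parametrised on `[0,1]`
proportionally to arc length). -/
def IsGeodesicSpace (X : Type u) [MetricSpace X] : Prop :=
  ∀ x y : X, ∃ g : ℝ → X, g 0 = x ∧ g 1 = y ∧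
    ∀ s ∈ Icc (0 : ℝ) 1, ∀ t ∈ Icc (0 : ℝ) 1, dist (g s) (g t) = |s - t| * dist x y

/-- Geodesic bicombings `γ : X × X × [0,1] → X`; values of `γ x y` outside `[0,1]` are
irrelevant. -/
structure IsGeodesicBicombing {X : Type u} [MetricSpace X] (γ : X → X → ℝ → X) : Prop where
  start : ∀ x y, γ x y 0 = x
  finish : ∀ x y, γ x y 1 = y
  geodesic : ∀ x y, ∀ t ∈ Icc (0 : ℝ) 1, ∀ s ∈ Icc (0 : ℝ) 1,
    dist (γ x y t) (γ x y s) = |t - s| * dist x y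

/-- `(E, C)`-geodesic coarsely convex bicombings. -/
structure IsGCCBicombing {X : Type u} [MetricSpace X] (E C : ℝ) (γ : X → X → ℝ → X) : Prop
    extends IsGeodesicBicombing γ where
  one_le : 1 ≤ E
  nonneg : 0 ≤ C
  convex : ∀ x₁ x₂ y₁ y₂ : X, ∀ a ∈ Icc (0 : ℝ) 1, ∀ b ∈ Icc (0 : ℝ) 1, ∀ c ∈ Icc (0 : ℝ) 1,
    dist (γ x₁ y₁ (c * a)) (γ x₂ y₂ (c * b)) ≤
      (1 - c) * E * dist x₁ x₂ + c * E * dist (γ x₁ y₁ a) (γ x₂ y₂ b) + C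

/-! ### The ideal boundary of a space with a geodesic coarsely convex bicombing -/

section IdealBoundary

variable {X : Type u} [MetricSpace X]

/-- The reparametrised bicombing, by arc length and then constant. -/
def reparam (γ : X → X → ℝ → X) (x y : X) (t : ℝ) : X :=
  open Classical in if t ≤ dist x y then γ x y (t / dist x y) else y

/-- The constant `D₁ = 2 D + 2` with `D = 2 (1 + E) k₁ + C` and `k₁ = 1` (the value of `λ + k`
for a geodesic bicombing, which is `(1, 0)`-quasi-geodesic). -/
def gromovConst (E C : ℝ) : ℝ := 2 * (2 * (1 + E) + C) + 2

/-- The product `(x | y)_e`. It is finite; it takes values in `[0,∞]` because the supremum in it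
may be infinite. -/
def gprod (E C : ℝ) (γ : X → X → ℝ → X) (e x y : X) : ℝ≥0∞ :=
  min (edist e x) (min (edist e y)
    (sSup {r | ∃ t : ℝ≥0, r = (t : ℝ≥0∞) ∧
      dist (reparam γ e x t) (reparam γ e y t) ≤ gromovConst E C}))

/-- Sequences with `(x_i | x_j) → ∞` as `i, j → ∞`. -/
def SInfty (E C : ℝ) (γ : X → X → ℝ → X) (e : X) : Type u :=
  {s : ℕ → X // Tendsto (fun p : ℕ × ℕ => gprod E C γ e (s p.1) (s p.2)) atTop (𝓝 ⊤)}

/-- Two such sequences are equivalent if `(x_i | y_i) → ∞`. -/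
def SInftyRel (E C : ℝ) (γ : X → X → ℝ → X) (e : X) (s s' : SInfty E C γ e) : Prop :=
  Tendsto (fun i => gprod E C γ e (s.1 i) (s'.1 i)) atTop (𝓝 ⊤)

/-- The ideal boundary `∂X`, as a set. For an `(E, C)`-geodesic coarsely convex bicombing
the relation is an equivalence relation, so that this is the set of its classes. -/
def IdealBoundary (E C : ℝ) (γ : X → X → ℝ → X) (e : X) : Type u :=
  Quot (SInftyRel E C γ e)

/-- The union `X ∪ ∂X`. -/
inductive Bordification (E C : ℝ) (γ : X → X → ℝ → X) (e : X) : Type u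
  | pt (x : X) : Bordification E C γ e
  | bd (ζ : IdealBoundary E C γ e) : Bordification E C γ e

variable {E C : ℝ} {γ : X → X → ℝ → X} {e : X}

/-- The sequences that belong to a point of `X ∪ ∂X`: the constant one for a point of `X`, the
representatives for a point of `∂X`. -/
def Bordification.Represents (s : ℕ → X) : Bordification E C γ e → Prop
  | pt x => s = fun _ => x
  | bd ζ => ∃ s' : SInfty E C γ e, s'.1 = s ∧ (Quot.mk _ s' : IdealBoundary E C γ e) = ζ

/-- The extension of the product to `X ∪ ∂X`. -/
def Bordification.gprod (p q : Bordification E C γ e) : ℝ≥0∞ :=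
  sSup {r | ∃ s s' : ℕ → X, p.Represents s ∧ q.Represents s' ∧
    r = liminf (fun i => _root_.gprod E C γ e (s i) (s' i)) atTop}

/-- The set `V_n[p]`, for `n ≥ 1`. -/
def Bordification.nbhd (n : ℕ) (p : Bordification E C γ e) : Set (Bordification E C γ e) :=
  {q | (n : ℝ≥0∞) < p.gprod q ∨
    ∃ x y : X, p = Bordification.pt x ∧ q = Bordification.pt y ∧ dist x y < 1 / (n : ℝ)}

theorem Bordification.nbhd_anti {m n : ℕ} (hm : 1 ≤ m) (h : m ≤ n) (p : Bordification E C γ e) :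
    p.nbhd n ⊆ p.nbhd m := by
  rintro q (hq | ⟨x, y, rfl, rfl, hxy⟩)
  · exact Or.inl (lt_of_le_of_lt (by exact_mod_cast h) hq)
  · refine Or.inr ⟨x, y, rfl, rfl, hxy.trans_le ?_⟩
    have : (0 : ℝ) < m := by exact_mod_cast hm
    exact one_div_le_one_div_of_le this (by exact_mod_cast h)

/-- The topology of `X ∪ ∂X` given by the uniformity with base `V_n = {(p, q) | q ∈ V_n[p]}`,
`n ≥ 1`: a set is open if it contains some `V_n[p]` for each of its points `p`. -/
instance : TopologicalSpace (Bordification E C γ e) where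
  IsOpen U := ∀ p ∈ U, ∃ n : ℕ, 1 ≤ n ∧ p.nbhd n ⊆ U
  isOpen_univ := fun _ _ => ⟨1, le_rfl, subset_univ _⟩
  isOpen_inter := by
    rintro U V hU hV p ⟨hpU, hpV⟩
    obtain ⟨m, hm, hmU⟩ := hU p hpU
    obtain ⟨n, hn, hnV⟩ := hV p hpV
    exact ⟨max m n, le_max_of_le_left hm, subset_inter
      ((Bordification.nbhd_anti hm (le_max_left _ _) p).trans hmU)
      ((Bordification.nbhd_anti hn (le_max_right _ _) p).trans hnV)⟩
  isOpen_sUnion := by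
    rintro S hS p ⟨U, hUS, hpU⟩
    obtain ⟨n, hn, hnU⟩ := hS U hUS p hpU
    exact ⟨n, hn, hnU.trans (subset_sUnion_of_mem hUS)⟩

/-- The ideal boundary is a subspace of `X ∪ ∂X`. -/
instance : TopologicalSpace (IdealBoundary E C γ e) :=
  TopologicalSpace.induced Bordification.bd inferInstance

end IdealBoundary

/-! ### Trees of spaces -/

section Trees

variable {V : Type u}

/-- Barycentric coordinates of the point that divides the segment from `u` to `v` in the ratio
`t : 1 - t`. -/
def edgePoint (u v : V) (t : ℝ) : V → ℝ :=
  (1 - t) • Set.indicator {u} 1 + t • Set.indicator {v} 1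

/-- The geometric realization of a graph, in barycentric coordinates. The topology is that of
pointwise convergence of the coordinates; on these points it is the topology of the path metric
in which all edges have length one. -/
def GraphRealization (G : SimpleGraph V) : Type u :=
  {f : V → ℝ // ∃ u v : V, (u = v ∨ G.Adj u v) ∧ ∃ t ∈ Icc (0 : ℝ) 1, f = edgePoint u v t}

instance (G : SimpleGraph V) : TopologicalSpace (GraphRealization G) :=
  instTopologicalSpaceSubtype

/-- A vertex as a point of the realization. -/
def GraphRealization.vertex (G : SimpleGraph V) (v : V) : GraphRealization G :=
  ⟨edgePoint v v 0, v, v, Or.inl rfl, 0, ⟨le_rfl, zero_le_one⟩, rfl⟩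

/-- The closed star of a vertex: the vertex with all closed edges at it. -/
def GraphRealization.star (G : SimpleGraph V) (v : V) : Set (GraphRealization G) :=
  {p | ∃ w : V, (v = w ∨ G.Adj v w) ∧ ∃ t ∈ Icc (0 : ℝ) 1, p.1 = edgePoint v w t}

end Trees

section TreeOfSpaces

variable {Z : Type u} {K : Type v} {L : Type w} {G : SimpleGraph (K ⊕ L)}

/-- The component `X_k`, the preimage of the closed star of `k`. -/
def component (ξ : Z → GraphRealization G) (k : K) : Set Z :=
  ξ ⁻¹' GraphRealization.star G (Sum.inl k)

/-- The set `L°` of the `l ∈ L` that are adjacent to at least two elements of `K`. -/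
def branchSet (G : SimpleGraph (K ⊕ L)) : Set L :=
  {l | ∃ k k' : K, k ≠ k' ∧ G.Adj (Sum.inl k) (Sum.inr l) ∧ G.Adj (Sum.inl k') (Sum.inr l)}

/-- The preimage of `L°` in `Z`. -/
def branchPoints (ξ : Z → GraphRealization G) : Set Z :=
  {z | ∃ l ∈ branchSet G, ξ z = GraphRealization.vertex G (Sum.inr l)}

/-- `Z` is a tree of spaces associated with `ξ : Z → T`, where `T` is a tree, bipartite with
parts `K` and `L`. -/
structure IsTreeOfSpaces [MetricSpace Z] (ξ : Z → GraphRealization G) : Prop where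
  tree : G.IsTree
  bipartite_left : ∀ k k' : K, ¬ G.Adj (Sum.inl k) (Sum.inl k')
  bipartite_right : ∀ l l' : L, ¬ G.Adj (Sum.inr l) (Sum.inr l')
  geodesic : IsGeodesicSpace Z
  continuous : Continuous ξ
  fiber : ∀ l : L, ∃ z : Z, ξ ⁻¹' {GraphRealization.vertex G (Sum.inr l)} = {z}
  component_geodesic : ∀ k : K, IsGeodesicSpace (component ξ k)

/-- `Z` is a tree of geodesic coarsely convex spaces: the components have geodesic coarsely
convex bicombings with common constants. -/
def IsTreeOfGCCSpaces [MetricSpace Z] (ξ : Z → GraphRealization G) : Prop :=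
  IsTreeOfSpaces ξ ∧ ∃ E C : ℝ, ∀ k : K,
    ∃ γ : component ξ k → component ξ k → ℝ → component ξ k, IsGCCBicombing E C γ

end TreeOfSpaces

/-! ### The augmented space -/

/-- `N` is a lattice of the subspace `A`: a subset that is `1`-discrete and `2`-dense. -/
structure IsLatticeOf {Z : Type u} [MetricSpace Z] (A N : Set Z) : Prop where
  subset : N ⊆ A
  discrete : ∀ x ∈ N, ∀ y ∈ N, x ≠ y → 1 ≤ dist x y
  dense : ∀ x ∈ A, ∃ y ∈ N, dist x y ≤ 2

section Augmented

variable {Z : Type u} [MetricSpace Z] {K : Type v}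

/-- The pieces from which the augmented space is glued: `Z`; for each `k` and `x ∈ N k` the ray
`[0,∞)` which is the union of the vertical edges joining `(x,l)` and `(x,l+1)`, so that `(x,l)` is
its point `l`; for each `l ≥ 1` and `x, y ∈ N k` with `0 < d(x,y) ≤ 2 ^ l` the horizontal edge
from `(x,l)` to `(y,l)`. -/
inductive PreAug (N : K → Set Z) : Type (max u v)
  | base (z : Z) : PreAug N
  | ray (k : K) (x : N k) (h : ℝ≥0) : PreAug N
  | edge (k : K) (l : ℕ) (x y : N k) (hl : 1 ≤ l) (hpos : 0 < dist (x : Z) y)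
      (hle : dist (x : Z) y ≤ 2 ^ l) (t : unitInterval) : PreAug N

/-- `ChainJoined p q r`: there is a chain from `p` to `q` of total length `r`, made of segments in the
pieces and of jumps (of length `0`) between points that are glued together. The foot of the ray
over `x` is glued to `x ∈ Z`, the start of a horizontal edge from `(x,l)` to the
vertex `(x,l)`, and the two orientations of a horizontal edge are identified. -/
inductive ChainJoined (N : K → Set Z) : PreAug N → PreAug N → ℝ → Prop
  | base (z z' : Z) : ChainJoined N (.base z) (.base z') (dist z z')
  | ray (k : K) (x : N k) (h h' : ℝ≥0) : ChainJoined N (.ray k x h) (.ray k x h') (dist h h')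
  | edge (k : K) (l : ℕ) (x y : N k) (hl : 1 ≤ l) (hpos : 0 < dist (x : Z) y)
      (hle : dist (x : Z) y ≤ 2 ^ l) (t t' : unitInterval) :
      ChainJoined N (.edge k l x y hl hpos hle t) (.edge k l x y hl hpos hle t') (dist t t')
  | foot (k : K) (x : N k) : ChainJoined N (.ray k x 0) (.base x) 0
  | corner (k : K) (l : ℕ) (x y : N k) (hl : 1 ≤ l) (hpos : 0 < dist (x : Z) y)
      (hle : dist (x : Z) y ≤ 2 ^ l) :
      ChainJoined N (.edge k l x y hl hpos hle 0) (.ray k x l) 0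
  | flip (k : K) (l : ℕ) (x y : N k) (hl : 1 ≤ l) (hpos : 0 < dist (x : Z) y)
      (hle : dist (x : Z) y ≤ 2 ^ l) (hpos' : 0 < dist (y : Z) x)
      (hle' : dist (y : Z) x ≤ 2 ^ l) (t : unitInterval) :
      ChainJoined N (.edge k l x y hl hpos hle t) (.edge k l y x hl hpos' hle' (unitInterval.symm t)) 0
  | symm {p q : PreAug N} {r : ℝ} : ChainJoined N p q r → ChainJoined N q p r
  | trans {p q m : PreAug N} {r s : ℝ} : ChainJoined N p q r → ChainJoined N q m s → ChainJoined N p m (r + s)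

variable {N : K → Set Z}

theorem ChainJoined.nonneg {p q : PreAug N} {r : ℝ} (h : ChainJoined N p q r) : 0 ≤ r := by
  induction h with
  | base => exact dist_nonneg
  | ray => exact dist_nonneg
  | edge => exact dist_nonneg
  | foot => exact le_rfl
  | corner => exact le_rfl
  | flip => exact le_rfl
  | symm _ ih => exact ih
  | trans _ _ ih ih' => exact add_nonneg ih ih'

theorem ChainJoined.self (p : PreAug N) : ChainJoined N p p 0 := by
  cases p with
  | base z => simpa using ChainJoined.base (N := N) z z
  | ray k x h => simpa using ChainJoined.ray (N := N) k x h h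
  | edge k l x y hl hpos hle t => simpa using ChainJoined.edge (N := N) k l x y hl hpos hle t t

theorem ChainJoined.exists_base (p : PreAug N) : ∃ z r, ChainJoined N p (.base z) r := by
  cases p with
  | base z => exact ⟨z, 0, ChainJoined.self _⟩
  | ray k x h => exact ⟨x, _, (ChainJoined.ray k x h 0).trans (ChainJoined.foot k x)⟩
  | edge k l x y hl hpos hle t =>
    exact ⟨x, _, ((ChainJoined.edge k l x y hl hpos hle t 0).trans (ChainJoined.corner k l x y hl hpos hle)).trans
      ((ChainJoined.ray k x l 0).trans (ChainJoined.foot k x))⟩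

theorem ChainJoined.exists (p q : PreAug N) : ∃ r, ChainJoined N p q r := by
  obtain ⟨z, r, h⟩ := ChainJoined.exists_base p
  obtain ⟨z', r', h'⟩ := ChainJoined.exists_base q
  exact ⟨_, (h.trans (ChainJoined.base z z')).trans h'.symm⟩

theorem ChainJoined.bddBelow (p q : PreAug N) : BddBelow {r | ChainJoined N p q r} :=
  ⟨0, fun _ h => ChainJoined.nonneg h⟩

/-- The gluing pseudometric: the infimum of the lengths of chains. -/
instance : PseudoMetricSpace (PreAug N) where
  dist p q := sInf {r | ChainJoined N p q r}
  dist_self p := le_antisymm (csInf_le (ChainJoined.bddBelow p p) (ChainJoined.self p))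
    (le_csInf (ChainJoined.exists p p) fun _ h => ChainJoined.nonneg h)
  dist_comm p q := congrArg sInf (Set.ext fun _ => ⟨ChainJoined.symm, ChainJoined.symm⟩)
  dist_triangle p q m := by
    refine le_of_forall_pos_le_add fun ε hε => ?_
    obtain ⟨r, hr, hr'⟩ := exists_lt_of_csInf_lt (ChainJoined.exists p q)
      (lt_add_of_pos_right (sInf {r | ChainJoined N p q r}) (half_pos hε))
    obtain ⟨s, hs, hs'⟩ := exists_lt_of_csInf_lt (ChainJoined.exists q m)
      (lt_add_of_pos_right (sInf {r | ChainJoined N q m r}) (half_pos hε))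
    have := csInf_le (ChainJoined.bddBelow p m) (ChainJoined.trans hr hs)
    linarith

/-- The augmented space: `Z` with a combinatorial horoball glued along `N k` for each `k`, with
the gluing metric (points at distance `0` are identified). -/
def AugSpace (N : K → Set Z) : Type (max u v) := SeparationQuotient (PreAug N)

instance : MetricSpace (AugSpace N) := inferInstanceAs (MetricSpace (SeparationQuotient (PreAug N)))

/-- The pieces that make up the metric horoball over `A ⊆ Z` with lattice `N k`. -/
def PreAug.InHoroball (A : Set Z) (k : K) : PreAug N → Prop
  | base z => z ∈ A
  | ray j _ _ => j = k
  | edge j _ _ _ _ _ _ _ => j = k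

/-- The metric horoball over `A ⊆ Z` with lattice `N k`, as a subset of the augmented space. -/
def horoball (N : K → Set Z) (A : Set Z) (k : K) : Set (AugSpace N) :=
  (SeparationQuotient.mk : PreAug N → SeparationQuotient (PreAug N)) ''
    {p | PreAug.InHoroball A k p}

end Augmented

end

/-!
A combinatorial horoball has a simple coarse distance formula: going up, across and down, points at
heights `a` and `b` over feet at distance `D` are at distance
`2 * logb 2 (D + 4 * 2 ^ a + 4 * 2 ^ b) - a - b` up to an additive constant
(`PreAug.le_dist_ray_ray`, `PreAug.dist_ray_ray_le`). The lower bound holds for the gluing metric of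
the whole augmented space, because the right-hand side, as a function of one of the points, extends
to a `1`-Lipschitz function on the gluing. The expression inside the logarithm satisfies the
triangle inequality, and the logarithm of a metric satisfies the four-point condition
(`PreAug.four_point_horoball`): metric horoballs are hyperbolic, whatever the geometry of the
components. The points of `Z` over the vertices in `L` remain cut points of the augmented space
(`IsTreeOfSpaces.dist_eq_of_inHoroball`), so the augmented space is a tree of horoballs and is
hyperbolic as well (`IsTreeOfSpaces.fourPoint_augSpace`). It is also geodesic
(`IsTreeOfSpaces.isGeodesicSpace_augSpace`): it need not be proper, since infinitely many rays may
start near one point, but a path of almost minimal length avoids the rays over one-point lattices,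
and what remains is proper because only finitely many components of definite size meet a bounded set
(`IsTreeOfSpaces.finite_components`). In a hyperbolic space every geodesic bicombing is coarsely
convex (`IsGeodesicBicombing.isGCC`), which gives the existence part.

Conversely, for an arbitrary coarsely convex bicombing on a hyperbolic space, the product that
defines the ideal boundary lies between a fixed positive multiple of the Gromov product and the
Gromov product plus a constant (`exists_mul_gromovProd_le_gprod`, `gprod_le_gromovProd`). Hence the
ideal boundary and its topology can be described by the Gromov product alone
(`IdealBoundary.isOpen_iff`), and the choice of the bicombing no longer matters.

Every point `x` of a horoball has Gromov product about `d(e, x) / 2` with the points far up in that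
horoball (`IsTreeOfSpaces.exists_le_gromovProd_ray`). So all sequences in the horoball converge to
one boundary point, its center; and since every point of the augmented space lies in a horoball, the
centers are dense in the boundary. An isolated point is therefore a center. A geodesic from the
center of a horoball to another boundary point leaves the horoball through a branch point; if the
branch points of the component are bounded, then the center is isolated, and if they are unbounded,
then the centers of the horoballs attached at branch points far out converge to it.

If no point is isolated, then all components are unbounded, the augmented space is proper, and the
boundary is compact (`IdealBoundary.compactSpace`). The two sides of the countably many cut points
define clopen sets that separate the points of the boundary
(`IsTreeOfSpaces.exists_boundarySide_separating`), and a nonempty compact space without isolated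
points that has such a sequence of clopen sets is a Cantor space
(`CantorScheme.nonempty_homeomorph`).
-/

/-! ### Gromov hyperbolicity and geodesic bicombings -/

/-- The four-point condition: of the three sums of distances of opposite pairs, the two largest
differ by at most `δ`. -/
def FourPoint (X : Type*) [PseudoMetricSpace X] (δ : ℝ) : Prop :=
  ∀ a b c d : X, dist a b + dist c d ≤ max (dist a c + dist b d) (dist a d + dist b c) + δ

/-- The Gromov product of `x` and `y` at `e`. -/
noncomputable def gromovProd {X : Type*} [PseudoMetricSpace X] (e x y : X) : ℝ :=
  (dist e x + dist e y - dist x y) / 2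

section Gromov

variable {X : Type*} [PseudoMetricSpace X] {δ : ℝ}

theorem FourPoint.nonneg (h : FourPoint X δ) (x : X) : 0 ≤ δ := by
  simpa using h x x x x

theorem gromovProd_comm (e x y : X) : gromovProd e x y = gromovProd e y x := by
  simp only [gromovProd, dist_comm x y]; ring

theorem gromovProd_nonneg (e x y : X) : 0 ≤ gromovProd e x y := by
  have := dist_triangle_left x y e
  unfold gromovProd; linarith

theorem gromovProd_le_left (e x y : X) : gromovProd e x y ≤ dist e x := by
  have := dist_triangle e x y
  unfold gromovProd; linarith

theorem gromovProd_le_right (e x y : X) : gromovProd e x y ≤ dist e y := by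
  rw [gromovProd_comm]; exact gromovProd_le_left e y x

theorem FourPoint.min_gromovProd_le (h : FourPoint X δ) (e x y z : X) :
    min (gromovProd e x y) (gromovProd e y z) ≤ gromovProd e x z + δ / 2 := by
  have := h x z e y
  unfold gromovProd
  rcases max_cases (dist x e + dist z y) (dist x y + dist z e) with ⟨h1, h2⟩ | ⟨h1, h2⟩ <;>
    rw [h1] at this <;>
    simp only [dist_comm x e, dist_comm z e, dist_comm z y] at * <;>
    [apply min_le_of_right_le; apply min_le_of_left_le] <;> linarith

theorem le_gromovProd (h : FourPoint X δ) {e x y z : X} {r s : ℝ} (h1 : r ≤ gromovProd e x y)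
    (h2 : r ≤ gromovProd e y z) (hs : s = r - δ / 2) : s ≤ gromovProd e x z := by
  have := h.min_gromovProd_le e x y z
  have := le_min h1 h2
  linarith

/-- Change of the base point. -/
theorem abs_gromovProd_sub_le (e o x y : X) :
    |gromovProd e x y - gromovProd o x y| ≤ dist e o := by
  have h1 := abs_le.1 (abs_dist_sub_le e o x)
  have h2 := abs_le.1 (abs_dist_sub_le e o y)
  unfold gromovProd
  rw [abs_le]; constructor <;> linarith

/-- A point that separates `x` from `y` bounds their Gromov product. -/
theorem gromovProd_le_of_cut {e x y z : X} (h : dist x y = dist x z + dist z y) :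
    gromovProd e x y ≤ dist e z := by
  have h1 := dist_triangle e z x
  have h2 := dist_triangle e z y
  have := dist_comm x z
  unfold gromovProd; linarith

/-- Points on the sides `[x, y]` and `[x, y']` of a triangle are as far apart as in the
comparison tripod, up to `2 δ`. -/
theorem FourPoint.dist_sides_le (h : FourPoint X δ) {x y y' u v : X}
    (hu : dist x u + dist u y = dist x y) (hv : dist x v + dist v y' = dist x y') :
    dist u v ≤
      max (dist y y' - dist u y - dist v y') |dist x u - dist x v| + 2 * δ := by
  have h1 := h u v x y
  have h2 := h v y x y'
  have hδ := h.nonneg x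
  have e1 := le_abs_self (dist x u - dist x v)
  have e2 := neg_abs_le (dist x u - dist x v)
  have m1 := le_max_left (dist y y' - dist u y - dist v y') |dist x u - dist x v|
  have m2 := le_max_right (dist y y' - dist u y - dist v y') |dist x u - dist x v|
  simp only [dist_comm u x, dist_comm v x, dist_comm v y, dist_comm y x] at *
  rcases max_cases (dist x u + dist y v) (dist u y + dist x v) with ⟨h3, _⟩ | ⟨h3, _⟩ <;>
  rcases max_cases (dist x v + dist y y') (dist v y' + dist x y) with ⟨h4, _⟩ | ⟨h4, _⟩ <;>
    rw [h3] at h1 <;> rw [h4] at h2 <;> linarith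

/-- Geodesics with a common starting point diverge at most linearly, up to `2 δ`. -/
theorem FourPoint.dist_cone_le (h : FourPoint X δ) {x y y' u v : X} {c : ℝ} (hc : c ∈ Icc (0 : ℝ) 1)
    (hu : dist x u = c * dist x y) (hu' : dist u y = (1 - c) * dist x y)
    (hv : dist x v = c * dist x y') (hv' : dist v y' = (1 - c) * dist x y') :
    dist u v ≤ c * dist y y' + 2 * δ := by
  have h1 := h.dist_sides_le (x := x) (y := y) (y' := y') (u := u) (v := v)
    (by rw [hu, hu']; ring) (by rw [hv, hv']; ring)
  refine h1.trans (add_le_add_left (max_le ?_ ?_) _)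
  · have := mul_le_mul_of_nonneg_left (dist_triangle_left y y' x) (sub_nonneg.2 hc.2)
    rw [hu', hv']; linarith
  · rw [hu, hv, ← mul_sub, abs_mul, abs_of_nonneg hc.1]
    refine mul_le_mul_of_nonneg_left ?_ hc.1
    rw [dist_comm x y, dist_comm x y']
    exact abs_dist_sub_le y y' x

end Gromov

section Bicombing

variable {X : Type*} [MetricSpace X] {δ : ℝ} {γ : X → X → ℝ → X}

theorem IsGeodesicBicombing.dist_start (hγ : IsGeodesicBicombing γ) (x y : X) {t : ℝ}
    (ht : t ∈ Icc (0 : ℝ) 1) : dist x (γ x y t) = t * dist x y := by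
  have := hγ.geodesic x y 0 (by simp) t ht
  rwa [hγ.start, zero_sub, abs_neg, abs_of_nonneg ht.1] at this

theorem IsGeodesicBicombing.dist_finish (hγ : IsGeodesicBicombing γ) (x y : X) {t : ℝ}
    (ht : t ∈ Icc (0 : ℝ) 1) : dist (γ x y t) y = (1 - t) * dist x y := by
  have := hγ.geodesic x y t ht 1 (by simp)
  rwa [hγ.finish, abs_sub_comm, abs_of_nonneg (by linarith [ht.2])] at this

/-- In a hyperbolic space every geodesic bicombing is coarsely convex: the diagonal from `x₁` to the
end of the second geodesic reduces convexity to geodesics with a common end point. -/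
theorem IsGeodesicBicombing.isGCC (hγ : IsGeodesicBicombing γ) (h : FourPoint X δ) (hδ : 0 ≤ δ) :
    IsGCCBicombing 1 (4 * δ) γ where
  toIsGeodesicBicombing := hγ
  one_le := le_rfl
  nonneg := by positivity
  convex x₁ x₂ y₁ y₂ a ha b hb c hc := by
    have hca : c * a ∈ Icc (0 : ℝ) 1 := ⟨mul_nonneg hc.1 ha.1, mul_le_one₀ hc.2 ha.1 ha.2⟩
    have hcb : c * b ∈ Icc (0 : ℝ) 1 := ⟨mul_nonneg hc.1 hb.1, mul_le_one₀ hc.2 hb.1 hb.2⟩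
    have sub : ∀ {x y : X} {a : ℝ}, a ∈ Icc (0 : ℝ) 1 → c * a ∈ Icc (0 : ℝ) 1 →
        dist (γ x y (c * a)) (γ x y a) = (1 - c) * dist x (γ x y a) := by
      intro x y a ha hca
      rw [hγ.geodesic x y _ hca _ ha, hγ.dist_start x y ha, ← abs_neg,
        show -(c * a - a) = (1 - c) * a by ring,
        abs_of_nonneg (mul_nonneg (by linarith [hc.2]) ha.1)]
      ring
    have st : ∀ {x y : X} {a : ℝ}, a ∈ Icc (0 : ℝ) 1 → c * a ∈ Icc (0 : ℝ) 1 →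
        dist x (γ x y (c * a)) = c * dist x (γ x y a) := by
      intro x y a ha hca
      rw [hγ.dist_start x y hca, hγ.dist_start x y ha]; ring
    set w := γ x₁ (γ x₂ y₂ b) c
    have hw := hγ.dist_start x₁ (γ x₂ y₂ b) hc
    have hw' := hγ.dist_finish x₁ (γ x₂ y₂ b) hc
    have h1 := h.dist_cone_le hc (st (y := y₁) ha hca) (sub ha hca) hw hw'
    have hc' : 1 - c ∈ Icc (0 : ℝ) 1 := ⟨by linarith [hc.2], by linarith [hc.1]⟩
    have h2 := h.dist_cone_le (x := γ x₂ y₂ b) (y := x₁) (y' := x₂) (u := w)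
      (v := γ x₂ y₂ (c * b)) hc'
      (by rw [dist_comm, hw', dist_comm x₁]) (by rw [dist_comm, hw, dist_comm x₁]; ring)
      (by rw [dist_comm, sub hb hcb, dist_comm x₂]) (by rw [dist_comm, st hb hcb, dist_comm x₂]; ring)
    have := dist_triangle (γ x₁ y₁ (c * a)) w (γ x₂ y₂ (c * b))
    linarith

theorem dist_reparam_start (hγ : IsGeodesicBicombing γ) (e x : X) {t : ℝ} (ht : 0 ≤ t) :
    dist e (reparam γ e x t) = min t (dist e x) := by
  unfold reparam
  split_ifs with h
  · rw [min_eq_left h]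
    rcases eq_or_ne (dist e x) 0 with h0 | h0
    · rw [h0, div_zero, hγ.start, dist_self]; linarith
    · rw [hγ.dist_start e x ⟨by positivity, div_le_one_of_le₀ h dist_nonneg⟩, div_mul_cancel₀ _ h0]
  · rw [min_eq_right (le_of_not_ge h)]

theorem dist_reparam_finish (hγ : IsGeodesicBicombing γ) (e x : X) {t : ℝ} (ht : 0 ≤ t) :
    dist (reparam γ e x t) x = dist e x - min t (dist e x) := by
  unfold reparam
  split_ifs with h
  · rw [min_eq_left h]
    rcases eq_or_ne (dist e x) 0 with h0 | h0
    · rw [h0, div_zero, hγ.start, h0]; linarith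
    · rw [hγ.dist_finish e x ⟨by positivity, div_le_one_of_le₀ h dist_nonneg⟩]
      field_simp
  · rw [min_eq_right (le_of_not_ge h), dist_self, sub_self]

/-- The product defined by a bicombing exceeds the Gromov product by a bounded amount at most. -/
theorem gprod_le_gromovProd (hγ : IsGeodesicBicombing γ) {E C : ℝ} (hD : 0 ≤ gromovConst E C)
    (e x y : X) :
    gprod E C γ e x y ≤ ENNReal.ofReal (gromovProd e x y + gromovConst E C) := by
  by_contra! hlt
  unfold gprod at hlt
  rw [lt_min_iff, lt_min_iff, lt_sSup_iff] at hlt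
  obtain ⟨hx, hy, _, ⟨t, rfl, ht⟩, hlt⟩ := hlt
  have hR : 0 ≤ gromovProd e x y + gromovConst E C := add_nonneg (gromovProd_nonneg _ _ _) hD
  rw [edist_dist, ENNReal.ofReal_lt_ofReal_iff_of_nonneg hR] at hx hy
  rw [ENNReal.ofReal, ENNReal.coe_lt_coe, Real.toNNReal_lt_iff_lt_coe hR] at hlt
  have h1 := dist_reparam_finish hγ e x (NNReal.coe_nonneg t)
  have h2 := dist_reparam_finish hγ e y (NNReal.coe_nonneg t)
  have h3 := dist_triangle4 x (reparam γ e x t) (reparam γ e y t) y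
  rw [dist_comm x (reparam γ e x t), h1, h2] at h3
  unfold gromovProd at *
  rcases min_cases (t : ℝ) (dist e x) with ⟨h4, _⟩ | ⟨h4, _⟩ <;>
  rcases min_cases (t : ℝ) (dist e y) with ⟨h5, _⟩ | ⟨h5, _⟩ <;>
    rw [h4, h5] at h3 <;> linarith

/-- In a hyperbolic space the product defined by a bicombing is bounded below by a multiple of the
Gromov product: the bicombing lines stay `2 δ`-close up to the Gromov product, and coarse convexity
shrinks `2 δ` to the constant of the definition on a definite initial part. -/
theorem exists_mul_gromovProd_le_gprod (h : FourPoint X δ) {E C : ℝ} (hγ : IsGCCBicombing E C γ)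
    (e : X) : ∃ c : ℝ, 0 < c ∧ ∀ x y : X,
      ENNReal.ofReal (c * gromovProd e x y) ≤ gprod E C γ e x y := by
  have hδ := h.nonneg e
  have hE := hγ.one_le
  have hC := hγ.nonneg
  -- With this factor `c * E * (2 * δ) ≤ 1`, which the additive constant of `gromovConst` absorbs.
  set c : ℝ := 1 / (1 + 2 * δ * E)
  have hpos : 0 < 1 + 2 * δ * E := by positivity
  have hc : c ∈ Icc (0 : ℝ) 1 :=
    ⟨by positivity, div_le_one_of_le₀ (by nlinarith [mul_nonneg hδ (zero_le_one.trans hE)]) hpos.le⟩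
  have hc0 : 0 < c := by positivity
  refine ⟨c, hc0, fun x y => ?_⟩
  set r := gromovProd e x y with hr
  have hr0 : 0 ≤ r := gromovProd_nonneg e x y
  have hcr : c * r ≤ r := mul_le_of_le_one_left hr0 hc.2
  have hrx := gromovProd_le_left e x y
  have hry := gromovProd_le_right e x y
  refine le_min ?_ (le_min ?_ (le_sSup ⟨⟨c * r, by positivity⟩, ?_, ?_⟩))
  · rw [edist_dist]; exact ENNReal.ofReal_le_ofReal (by linarith)
  · rw [edist_dist]; exact ENNReal.ofReal_le_ofReal (by linarith)
  · rw [ENNReal.ofReal, Real.toNNReal_of_nonneg (by positivity)]; rfl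
  · have key : ∀ z : X, r ≤ dist e z →
        r / dist e z ∈ Icc (0 : ℝ) 1 ∧ reparam γ e z (c * r) = γ e z (c * (r / dist e z)) ∧
        dist e (γ e z (r / dist e z)) = r ∧ dist (γ e z (r / dist e z)) z = dist e z - r := by
      intro z hz
      have hI : r / dist e z ∈ Icc (0 : ℝ) 1 :=
        ⟨by positivity, div_le_one_of_le₀ hz dist_nonneg⟩
      have hmul : r / dist e z * dist e z = r := by
        rcases eq_or_ne (dist e z) 0 with h0 | h0
        · rw [h0, mul_zero]; linarith
        · rw [div_mul_cancel₀ _ h0]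
      refine ⟨hI, ?_, ?_, ?_⟩
      · unfold reparam
        rw [if_pos (by linarith), mul_div_assoc]
      · rw [hγ.dist_start e z hI, hmul]
      · rw [hγ.dist_finish e z hI]; linarith
    obtain ⟨ix, ex, sx, fx⟩ := key x hrx
    obtain ⟨iy, ey, sy, fy⟩ := key y hry
    change dist (reparam γ e x (c * r)) (reparam γ e y (c * r)) ≤ _
    rw [ex, ey]
    have h1 := hγ.convex e e x y _ ix _ iy c hc
    have h2 := h.dist_sides_le (x := e) (y := x) (y' := y) (u := γ e x (r / dist e x))
      (v := γ e y (r / dist e y)) (by linarith) (by linarith)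
    rw [sx, sy, sub_self, abs_zero, fx, fy, max_eq_right
      (by rw [hr]; unfold gromovProd; linarith), zero_add] at h2
    rw [dist_self, mul_zero, zero_add] at h1
    have h3 : c * E * dist (γ e x (r / dist e x)) (γ e y (r / dist e y)) ≤ c * E * (2 * δ) :=
      mul_le_mul_of_nonneg_left h2 (by positivity)
    have h4 : c * E * (2 * δ) ≤ 1 := by
      have : c * (1 + 2 * δ * E) = 1 := by simp only [c]; field_simp
      nlinarith
    unfold gromovConst
    linarith

end Bicombing

/-! ### The ideal boundary in terms of the Gromov product -/

namespace IdealBoundary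

variable {X : Type*} [MetricSpace X] {δ E C : ℝ} {γ : X → X → ℝ → X} {e : X}

theorem gromovConst_nonneg (hγ : IsGCCBicombing E C γ) : 0 ≤ gromovConst E C := by
  have := hγ.one_le
  have := hγ.nonneg
  unfold gromovConst; linarith

theorem tendsto_gprod_iff (h : FourPoint X δ) (hγ : IsGCCBicombing E C γ) {ι : Type*}
    {l : Filter ι} {f g : ι → X} :
    Tendsto (fun i => gprod E C γ e (f i) (g i)) l (𝓝 ⊤) ↔
      Tendsto (fun i => gromovProd e (f i) (g i)) l atTop := by
  constructor
  · intro H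
    have h1 : Tendsto (fun i => ENNReal.ofReal (gromovProd e (f i) (g i) + gromovConst E C)) l
        (𝓝 ⊤) := tendsto_nhds_top_mono' H fun i =>
          gprod_le_gromovProd hγ.toIsGeodesicBicombing (gromovConst_nonneg hγ) e _ _
    rw [ENNReal.tendsto_ofReal_nhds_top] at h1
    simpa using tendsto_atTop_add_const_right _ (-gromovConst E C) h1
  · intro H
    obtain ⟨c, hc, hc'⟩ := exists_mul_gromovProd_le_gprod h hγ e
    exact tendsto_nhds_top_mono' (ENNReal.tendsto_ofReal_nhds_top.2 (H.const_mul_atTop hc))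
      fun i => hc' _ _

/-- `s` and `s'` run to the same point at infinity. -/
def Asymptotic (e : X) (s s' : ℕ → X) : Prop :=
  Tendsto (fun p : ℕ × ℕ => gromovProd e (s p.1) (s' p.2)) atTop atTop

theorem asymptotic_iff {s s' : ℕ → X} :
    Asymptotic e s s' ↔ ∀ R : ℝ, ∃ n, ∀ i ≥ n, ∀ j ≥ n, R ≤ gromovProd e (s i) (s' j) := by
  unfold Asymptotic
  rw [tendsto_atTop]
  refine forall_congr' fun R => ?_
  rw [eventually_atTop_prod_self']

theorem Asymptotic.symm {s s' : ℕ → X} (H : Asymptotic e s s') : Asymptotic e s' s := by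
  rw [asymptotic_iff] at *
  intro R
  obtain ⟨n, hn⟩ := H R
  exact ⟨n, fun i hi j hj => gromovProd_comm e (s j) (s' i) ▸ hn j hj i hi⟩

theorem Asymptotic.trans (h : FourPoint X δ) {s s' s'' : ℕ → X} (H : Asymptotic e s s')
    (H' : Asymptotic e s' s'') : Asymptotic e s s'' := by
  rw [asymptotic_iff] at *
  intro R
  obtain ⟨n, hn⟩ := H (R + δ / 2)
  obtain ⟨m, hm⟩ := H' (R + δ / 2)
  exact ⟨max n m, fun i hi j hj => le_gromovProd h
    (hn i (le_of_max_le_left hi) (max n m) (le_max_left _ _))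
    (hm (max n m) (le_max_right _ _) j (le_of_max_le_right hj)) (by ring)⟩

theorem asymptotic_self_iff (h : FourPoint X δ) (hγ : IsGCCBicombing E C γ) {s : ℕ → X} :
    Asymptotic e s s ↔
      Tendsto (fun p : ℕ × ℕ => gprod E C γ e (s p.1) (s p.2)) atTop (𝓝 ⊤) :=
  (tendsto_gprod_iff h hγ).symm

theorem sInftyRel_iff (h : FourPoint X δ) (hγ : IsGCCBicombing E C γ) {s s' : SInfty E C γ e} :
    SInftyRel E C γ e s s' ↔ Asymptotic e s.1 s'.1 := by
  unfold SInftyRel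
  rw [tendsto_gprod_iff h hγ]
  constructor
  · intro H
    have h1 := asymptotic_iff.1 ((asymptotic_self_iff h hγ).2 s.2)
    have h2 := asymptotic_iff.1 ((asymptotic_self_iff h hγ).2 s'.2)
    rw [asymptotic_iff]
    intro R
    obtain ⟨n, hn⟩ := h1 (R + δ)
    obtain ⟨m, hm⟩ := h2 (R + δ)
    obtain ⟨k, hk⟩ := eventually_atTop.1 (tendsto_atTop.1 H (R + δ))
    have hδ := h.nonneg e
    set N := max n (max m k)
    have hnN : n ≤ N := le_max_left _ _
    have hmN : m ≤ N := (le_max_left _ _).trans (le_max_right _ _)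
    have hkN : k ≤ N := (le_max_right _ _).trans (le_max_right _ _)
    refine ⟨N, fun i hi j hj => ?_⟩
    have h3 := le_gromovProd h (s := R + δ / 2) (hn i (hnN.trans hi) N hnN) (hk N hkN) (by ring)
    have h4 := hm N hmN j (hmN.trans hj)
    exact le_gromovProd h h3 (by linarith) (by ring)
  · intro H
    exact H.comp tendsto_atTop_diagonal

/-- The sequence `s` represents the boundary point `ζ`. -/
def Rep (s : ℕ → X) (ζ : IdealBoundary E C γ e) : Prop :=
  ∃ s' : SInfty E C γ e, s'.1 = s ∧ (Quot.mk _ s' : IdealBoundary E C γ e) = ζ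

theorem exists_rep (ζ : IdealBoundary E C γ e) : ∃ s, Rep s ζ := by
  obtain ⟨s, rfl⟩ := Quot.exists_rep ζ
  exact ⟨s.1, s, rfl, rfl⟩

theorem Rep.exists_of_asymptotic (h : FourPoint X δ) (hγ : IsGCCBicombing E C γ) {s : ℕ → X}
    (hs : Asymptotic e s s) : ∃ ζ : IdealBoundary E C γ e, Rep s ζ :=
  ⟨Quot.mk _ ⟨s, (asymptotic_self_iff h hγ).1 hs⟩, _, rfl, rfl⟩

theorem Rep.self (h : FourPoint X δ) (hγ : IsGCCBicombing E C γ) {s : ℕ → X}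
    {ζ : IdealBoundary E C γ e} (hs : Rep s ζ) : Asymptotic e s s := by
  obtain ⟨s', rfl, -⟩ := hs
  exact (asymptotic_self_iff h hγ).2 s'.2

theorem Rep.eq_iff (h : FourPoint X δ) (hγ : IsGCCBicombing E C γ) {s s' : ℕ → X}
    {ζ η : IdealBoundary E C γ e} (hs : Rep s ζ) (hs' : Rep s' η) :
    ζ = η ↔ Asymptotic e s s' := by
  obtain ⟨s, rfl, rfl⟩ := hs
  obtain ⟨s', rfl, rfl⟩ := hs'
  have equiv : Equivalence (SInftyRel E C γ e) :=
    ⟨fun s => (sInftyRel_iff h hγ).2 ((asymptotic_self_iff h hγ).2 s.2),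
      fun H => (sInftyRel_iff h hγ).2 ((sInftyRel_iff h hγ).1 H).symm,
      fun H H' => (sInftyRel_iff h hγ).2
        (((sInftyRel_iff h hγ).1 H).trans h ((sInftyRel_iff h hγ).1 H'))⟩
  rw [← sInftyRel_iff h hγ]
  exact ⟨fun H => equiv.eqvGen_iff.1 (Quot.eqvGen_exact H), fun H => Quot.sound H⟩

/-- The boundary points `ζ` and `η` have representatives whose Gromov products are eventually at
least `R`. -/
def Near (R : ℝ) (ζ η : IdealBoundary E C γ e) : Prop :=
  ∃ s s', Rep s ζ ∧ Rep s' η ∧ ∃ n, ∀ i ≥ n, ∀ j ≥ n, R ≤ gromovProd e (s i) (s' j)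

/-- The boundary point `ζ` has a representative whose Gromov products with `x` are eventually at
least `R`. -/
def NearPoint (R : ℝ) (ζ : IdealBoundary E C γ e) (x : X) : Prop :=
  ∃ s, Rep s ζ ∧ ∃ n, ∀ i ≥ n, R ≤ gromovProd e (s i) x

theorem Near.symm {R : ℝ} {ζ η : IdealBoundary E C γ e} (H : Near R ζ η) : Near R η ζ := by
  obtain ⟨s, s', hs, hs', n, hn⟩ := H
  exact ⟨s', s, hs', hs, n, fun i hi j hj => gromovProd_comm e (s j) (s' i) ▸ hn j hj i hi⟩

/-- Frequent lower bounds on the Gromov product pass to all pairs of representatives. -/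
theorem Rep.eventually_le (h : FourPoint X δ) (hγ : IsGCCBicombing E C γ) {s s' t t' : ℕ → X}
    {ζ η : IdealBoundary E C γ e} (hs : Rep s ζ) (hs' : Rep s' η) (ht : Rep t ζ) (ht' : Rep t' η)
    {R : ℝ} (H : ∀ n, ∃ i ≥ n, ∃ j ≥ n, R ≤ gromovProd e (s i) (s' j)) :
    ∃ n, ∀ i ≥ n, ∀ j ≥ n, R - δ ≤ gromovProd e (t i) (t' j) := by
  obtain ⟨n, hn⟩ := asymptotic_iff.1 ((Rep.eq_iff h hγ ht hs).1 rfl) R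
  obtain ⟨m, hm⟩ := asymptotic_iff.1 ((Rep.eq_iff h hγ hs' ht').1 rfl) R
  have hδ := h.nonneg e
  obtain ⟨i₀, hi₀, j₀, hj₀, h0⟩ := H (max n m)
  refine ⟨max n m, fun i hi j hj => ?_⟩
  have h1 := le_gromovProd h (hn i (le_of_max_le_left hi) i₀ (le_of_max_le_left hi₀)) h0 rfl
  exact le_gromovProd h h1 ((by linarith : R - δ / 2 ≤ R).trans
    (hm j₀ (le_of_max_le_right hj₀) j (le_of_max_le_right hj))) (by ring)

theorem Near.eventually_le (h : FourPoint X δ) (hγ : IsGCCBicombing E C γ) {t t' : ℕ → X} {R : ℝ}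
    {ζ η : IdealBoundary E C γ e} (H : Near R ζ η) (ht : Rep t ζ) (ht' : Rep t' η) :
    ∃ n, ∀ i ≥ n, ∀ j ≥ n, R - δ ≤ gromovProd e (t i) (t' j) := by
  obtain ⟨s, s', hs, hs', n, hn⟩ := H
  exact hs.eventually_le h hγ hs' ht ht' fun m =>
    ⟨max n m, le_max_right _ _, max n m, le_max_right _ _,
      hn _ (le_max_left _ _) _ (le_max_left _ _)⟩

theorem NearPoint.eventually_le (h : FourPoint X δ) (hγ : IsGCCBicombing E C γ) {t : ℕ → X} {R : ℝ}
    {ζ : IdealBoundary E C γ e} {x : X} (H : NearPoint R ζ x) (ht : Rep t ζ) :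
    ∃ n, ∀ i ≥ n, R - δ / 2 ≤ gromovProd e (t i) x := by
  obtain ⟨s, hs, n, hn⟩ := H
  obtain ⟨m, hm⟩ := asymptotic_iff.1 ((Rep.eq_iff h hγ ht hs).1 rfl) R
  exact ⟨m, fun i hi => le_gromovProd h (hm i hi (max m n) (le_max_left _ _))
    (hn _ (le_max_right _ _)) rfl⟩

theorem eq_of_forall_near (h : FourPoint X δ) (hγ : IsGCCBicombing E C γ)
    {ζ η : IdealBoundary E C γ e} (H : ∀ R, Near R ζ η) : ζ = η := by
  obtain ⟨s, hs⟩ := exists_rep ζ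
  obtain ⟨s', hs'⟩ := exists_rep η
  refine (Rep.eq_iff h hγ hs hs').2 (asymptotic_iff.2 fun R => ?_)
  simpa using (H (R + δ)).eventually_le h hγ hs hs'

theorem le_of_lt_gprod (hγ : IsGCCBicombing E C γ) {R : ℝ} {x y : X}
    (H : ENNReal.ofReal R < gprod E C γ e x y) : R - gromovConst E C ≤ gromovProd e x y := by
  have h1 := H.trans_le
    (gprod_le_gromovProd hγ.toIsGeodesicBicombing (gromovConst_nonneg hγ) e x y)
  have h2 := (ENNReal.ofReal_lt_ofReal_iff'.1 h1).1
  linarith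

theorem near_of_lt_gprod (h : FourPoint X δ) (hγ : IsGCCBicombing E C γ) {R : ℝ}
    {ζ η : IdealBoundary E C γ e}
    (H : ENNReal.ofReal R < (Bordification.bd ζ).gprod (Bordification.bd η)) :
    Near (R - gromovConst E C - δ) ζ η := by
  unfold Bordification.gprod at H
  obtain ⟨_, ⟨s, s', hs, hs', rfl⟩, hlt⟩ := lt_sSup_iff.1 H
  obtain ⟨n, hn⟩ := eventually_atTop.1 (eventually_lt_of_lt_liminf hlt)
  refine ⟨s, s', hs, hs', Rep.eventually_le h hγ hs hs' hs hs' fun m => ?_⟩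
  exact ⟨max n m, le_max_right _ _, max n m, le_max_right _ _,
    le_of_lt_gprod hγ (hn _ (le_max_left _ _))⟩

theorem nearPoint_of_lt_gprod (hγ : IsGCCBicombing E C γ) {R : ℝ}
    {ζ : IdealBoundary E C γ e} {x : X}
    (H : ENNReal.ofReal R < (Bordification.bd ζ).gprod (Bordification.pt x)) :
    NearPoint (R - gromovConst E C) ζ x := by
  unfold Bordification.gprod at H
  obtain ⟨_, ⟨s, s', hs, hs', rfl⟩, hlt⟩ := lt_sSup_iff.1 H
  obtain ⟨n, hn⟩ := eventually_atTop.1 (eventually_lt_of_lt_liminf hlt)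
  refine ⟨s, hs, n, fun i hi => ?_⟩
  have := le_of_lt_gprod hγ (hn i hi)
  have h' : s' = fun _ => x := hs'
  rwa [h'] at this

/-- Each basic entourage of the bordification contains the pairs of a boundary point and another point
whose Gromov product is large. -/
theorem exists_near_imp_lt_gprod (h : FourPoint X δ) (hγ : IsGCCBicombing E C γ) (e : X) (n : ℕ) :
    ∃ R : ℝ, (∀ ζ η : IdealBoundary E C γ e, Near R ζ η →
        (n : ℝ≥0∞) < (Bordification.bd ζ).gprod (Bordification.bd η)) ∧
      ∀ (ζ : IdealBoundary E C γ e) (x : X), NearPoint R ζ x →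
        (n : ℝ≥0∞) < (Bordification.bd ζ).gprod (Bordification.pt x) := by
  obtain ⟨c, hc, hc'⟩ := exists_mul_gromovProd_le_gprod h hγ e
  have key : ∀ x y : X, (n + 1) / c ≤ gromovProd e x y →
      ((n + 1 : ℕ) : ℝ≥0∞) ≤ gprod E C γ e x y := by
    intro x y hxy
    refine le_trans ?_ (hc' x y)
    rw [← ENNReal.ofReal_natCast]
    apply ENNReal.ofReal_le_ofReal
    rw [div_le_iff₀ hc] at hxy
    push_cast; linarith
  have hlt : (n : ℝ≥0∞) < ((n + 1 : ℕ) : ℝ≥0∞) := by exact_mod_cast n.lt_succ_self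
  refine ⟨(n + 1) / c, ?_, ?_⟩
  · rintro ζ η ⟨s, s', hs, hs', m, hm⟩
    refine hlt.trans_le (le_trans ?_ (le_sSup ⟨s, s', hs, hs', rfl⟩))
    exact le_liminf_of_le (by isBoundedDefault)
      (eventually_atTop.2 ⟨m, fun i hi => key _ _ (hm i hi i hi)⟩)
  · rintro ζ x ⟨s, hs, m, hm⟩
    refine hlt.trans_le (le_trans ?_ (le_sSup ⟨s, fun _ => x, hs, rfl, rfl⟩))
    exact le_liminf_of_le (by isBoundedDefault)
      (eventually_atTop.2 ⟨m, fun i hi => key _ _ (hm i hi)⟩)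

theorem gprod_pt_le (x : X) (q : Bordification E C γ e) :
    (Bordification.pt x).gprod q ≤ ENNReal.ofReal (dist e x) := by
  refine sSup_le ?_
  rintro _ ⟨s, s', hs, -, rfl⟩
  have hs : s = fun _ => x := hs
  rw [← edist_dist]
  refine (liminf_le_liminf (v := fun _ => edist e x) (Eventually.of_forall fun i => ?_)).trans
    (liminf_const _).le
  simp only [hs]
  exact min_le_left _ _

/-- Small neighbourhoods of a point of `X` lie in `X` and are metric balls. -/
theorem nbhd_pt_subset (x : X) {n : ℕ} (hn : dist e x ≤ n) :
    (Bordification.pt x : Bordification E C γ e).nbhd n ⊆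
      Bordification.pt '' {y | dist x y < 1 / (n : ℝ)} := by
  rintro q (hq | ⟨x', y, hx, rfl, hxy⟩)
  · refine absurd hq (not_lt.2 ((gprod_pt_le x q).trans ?_))
    rw [← ENNReal.ofReal_natCast]
    exact ENNReal.ofReal_le_ofReal hn
  · cases hx
    exact ⟨y, hxy, rfl⟩

theorem isOpen_bordification_iff {U : Set (Bordification E C γ e)} :
    IsOpen U ↔ ∀ p ∈ U, ∃ n : ℕ, 1 ≤ n ∧ p.nbhd n ⊆ U := Iff.rfl

/-- The topology of the ideal boundary in terms of the Gromov product. -/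
theorem isOpen_iff (h : FourPoint X δ) (hγ : IsGCCBicombing E C γ)
    {S : Set (IdealBoundary E C γ e)} :
    IsOpen S ↔ ∀ ζ ∈ S, ∃ R : ℝ, ∀ η, Near R ζ η → η ∈ S := by
  constructor
  · intro H ζ hζ
    obtain ⟨U, hU, rfl⟩ := isOpen_induced_iff.1 H
    obtain ⟨n, -, hnU⟩ := isOpen_bordification_iff.1 hU _ hζ
    obtain ⟨R, hR, -⟩ := exists_near_imp_lt_gprod h hγ e n
    exact ⟨R, fun η hη => hnU (Or.inl (hR ζ η hη))⟩
  · intro H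
    -- All of `X` may be added to `S`.
    refine isOpen_induced_iff.2 ⟨Bordification.bd '' S ∪ range Bordification.pt, ?_, ?_⟩
    · refine isOpen_bordification_iff.2 ?_
      rintro _ (⟨ζ, hζ, rfl⟩ | ⟨x, rfl⟩)
      · obtain ⟨R, hR⟩ := H ζ hζ
        obtain ⟨n, hn⟩ := exists_nat_ge (max 1 (R + gromovConst E C + δ))
        refine ⟨n, by exact_mod_cast (le_max_left _ _).trans hn, ?_⟩
        rintro q (hq | ⟨x, y, hx, -⟩)
        · cases q with
          | pt x => exact Or.inr ⟨x, rfl⟩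
          | bd η =>
            refine Or.inl ⟨η, hR η ?_, rfl⟩
            rw [← ENNReal.ofReal_natCast] at hq
            obtain ⟨s, s', hs, hs', m, hm⟩ := near_of_lt_gprod h hγ hq
            refine ⟨s, s', hs, hs', m, fun i hi j hj => le_trans ?_ (hm i hi j hj)⟩
            linarith [(le_max_right _ _).trans hn]
        · cases hx
      · obtain ⟨n, hn⟩ := exists_nat_ge (max 1 (dist e x))
        refine ⟨n, by exact_mod_cast (le_max_left _ _).trans hn, ?_⟩
        refine (nbhd_pt_subset x ((le_max_right _ _).trans hn)).trans ?_
        rintro _ ⟨y, -, rfl⟩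
        exact Or.inr ⟨y, rfl⟩
    · ext ζ
      simp

theorem isOpen_singleton_iff (h : FourPoint X δ) (hγ : IsGCCBicombing E C γ)
    {ζ : IdealBoundary E C γ e} : IsOpen {ζ} ↔ ∃ R : ℝ, ∀ η, Near R ζ η → η = ζ := by
  rw [isOpen_iff h hγ]
  simp

/-- A closed subset `A` of `X` that accumulates at infinity at the boundary point `c` only. -/
theorem closure_diff_eq_singleton (h : FourPoint X δ) (hγ : IsGCCBicombing E C γ) {A : Set X}
    (hA : IsClosed A) (c : IdealBoundary E C γ e) (hc : ∀ R, ∃ x ∈ A, NearPoint R c x)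
    (hother : ∀ ζ : IdealBoundary E C γ e, ζ ≠ c → ∃ R, ∀ x ∈ A, ¬ NearPoint R ζ x) :
    closure ((Bordification.pt : X → Bordification E C γ e) '' A) \ (Bordification.pt '' A) =
      {Bordification.bd c} := by
  apply Subset.antisymm
  · have hopen : IsOpen ((Bordification.pt : X → Bordification E C γ e) '' Aᶜ ∪
        Bordification.bd '' {c}ᶜ) := by
      refine isOpen_bordification_iff.2 ?_
      rintro _ (⟨x, hx, rfl⟩ | ⟨ζ, hζ, rfl⟩)
      · obtain ⟨ε, hε, hball⟩ := Metric.isOpen_iff.1 hA.isOpen_compl x hx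
        obtain ⟨n, hn⟩ := exists_nat_ge (max (max 1 (dist e x)) (1 / ε))
        have hn1 : (1 : ℝ) ≤ n := (le_max_left _ _).trans ((le_max_left _ _).trans hn)
        refine ⟨n, by exact_mod_cast hn1, ?_⟩
        refine (nbhd_pt_subset x ((le_max_right _ _).trans ((le_max_left _ _).trans hn))).trans ?_
        rintro _ ⟨y, hy, rfl⟩
        refine Or.inl ⟨y, hball ?_, rfl⟩
        rw [Metric.mem_ball, dist_comm]
        exact lt_of_lt_of_le hy (by
          rw [one_div_le (by linarith) hε]; exact (le_max_right _ _).trans hn)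
      · obtain ⟨R, hR⟩ := hother ζ hζ
        obtain ⟨R', hR'⟩ := not_forall.1 fun H => hζ (eq_of_forall_near h hγ H)
        obtain ⟨n, hn⟩ := exists_nat_ge
          (max (max 1 (R' + gromovConst E C + δ)) (R + gromovConst E C))
        have hn1 : (1 : ℝ) ≤ n := (le_max_left _ _).trans ((le_max_left _ _).trans hn)
        refine ⟨n, by exact_mod_cast hn1, ?_⟩
        rintro q (hq | ⟨x, y, hx, -⟩)
        · rw [← ENNReal.ofReal_natCast] at hq
          cases q with
          | pt x =>
            refine Or.inl ⟨x, fun hx => hR x hx ?_, rfl⟩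
            obtain ⟨s, hs, m, hm⟩ := nearPoint_of_lt_gprod hγ hq
            refine ⟨s, hs, m, fun i hi => le_trans ?_ (hm i hi)⟩
            linarith [(le_max_right _ _).trans hn]
          | bd η =>
            refine Or.inr ⟨η, ?_, rfl⟩
            rintro rfl
            obtain ⟨s, s', hs, hs', m, hm⟩ := near_of_lt_gprod h hγ hq
            refine hR' ⟨s, s', hs, hs', m, fun i hi j hj => le_trans ?_ (hm i hi j hj)⟩
            linarith [(le_max_right _ _).trans ((le_max_left _ _).trans hn)]
        · cases hx
    rintro p ⟨hp, hpA⟩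
    by_contra hpc
    have hpU : p ∈ (Bordification.pt : X → Bordification E C γ e) '' Aᶜ ∪
        Bordification.bd '' {c}ᶜ := by
      cases p with
      | pt x => exact Or.inl ⟨x, fun hx => hpA ⟨x, hx, rfl⟩, rfl⟩
      | bd ζ => exact Or.inr ⟨ζ, fun hζ => hpc (by rw [hζ]; rfl), rfl⟩
    obtain ⟨_, h1, ⟨x, hx, rfl⟩⟩ := mem_closure_iff.1 hp _ hopen hpU
    rcases h1 with ⟨y, hy, hxy⟩ | ⟨ζ, -, hζ⟩
    · cases hxy; exact hy hx
    · cases hζ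
  · rintro _ rfl
    refine ⟨mem_closure_iff.2 fun U hU hcU => ?_, ?_⟩
    · obtain ⟨n, -, hnU⟩ := isOpen_bordification_iff.1 hU _ hcU
      obtain ⟨R, -, hR⟩ := exists_near_imp_lt_gprod h hγ e n
      obtain ⟨x, hxA, hx⟩ := hc R
      exact ⟨_, hnU (Or.inl (hR c x hx)), x, hxA, rfl⟩
    · rintro ⟨x, -, hx⟩
      cases hx

/-- If the balls about the base point have finite nets, then the ideal boundary is compact: an
ultrafilter selects, at each distance `r`, one net point near the geodesics to almost all of its
members, and these net points run to the limit. -/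
theorem compactSpace (h : FourPoint X δ) (hγ : IsGCCBicombing E C γ)
    (hnet : ∀ r : ℝ, ∃ F : Set X, F.Finite ∧ ∀ x, dist e x ≤ r → ∃ f ∈ F, dist x f ≤ 1) :
    CompactSpace (IdealBoundary E C γ e) := by
  have hδ := h.nonneg e
  -- Each boundary point is near one of finitely many points of a ball of radius about `r`.
  have step : ∀ r : ℝ, ∃ F : Set X, F.Finite ∧
      ∀ ζ : IdealBoundary E C γ e, ∃ f ∈ F, NearPoint r ζ f := by
    intro r
    set r' := max 0 r + δ / 2 + 1 with hr'
    obtain ⟨F, hF, hFd⟩ := hnet r'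
    refine ⟨F, hF, fun ζ => ?_⟩
    obtain ⟨s, hs⟩ := exists_rep ζ
    obtain ⟨n, hn⟩ := asymptotic_iff.1 (hs.self h hγ) r'
    have hr0 : 0 ≤ r' := by positivity
    have hd : r' ≤ dist e (s n) := (hn n le_rfl n le_rfl).trans (gromovProd_le_left _ _ _)
    have h1 := dist_reparam_start hγ.toIsGeodesicBicombing e (s n) hr0
    have h2 := dist_reparam_finish hγ.toIsGeodesicBicombing e (s n) hr0
    rw [min_eq_left hd] at h1 h2
    set y := reparam γ e (s n) r'
    have hy : r' ≤ gromovProd e (s n) y := by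
      rw [gromovProd_comm]; unfold gromovProd; linarith
    obtain ⟨f, hf, hyf⟩ := hFd y h1.le
    refine ⟨f, hf, s, hs, n, fun i hi => ?_⟩
    have h3 := le_gromovProd h (hn i hi n le_rfl) hy rfl
    have h4 : gromovProd e (s i) y ≤ gromovProd e (s i) f + 1 := by
      have := dist_triangle e f y
      have := dist_triangle_right (s i) f y
      unfold gromovProd
      rw [dist_comm f y] at *
      linarith
    have := le_max_right 0 r
    linarith
  refine ⟨isCompact_iff_ultrafilter_le_nhds.2 fun 𝒰 _ => ?_⟩
  have pick : ∀ r : ℕ, ∃ f : X, {ζ | NearPoint r ζ f} ∈ 𝒰 := by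
    intro r
    obtain ⟨F, hF, hFζ⟩ := step r
    have : (⋃ f ∈ F, {ζ : IdealBoundary E C γ e | NearPoint r ζ f}) ∈ 𝒰 := by
      refine mem_of_superset univ_mem fun ζ _ => ?_
      obtain ⟨f, hf, hζ⟩ := hFζ ζ
      exact mem_biUnion hf hζ
    obtain ⟨f, -, hf⟩ := (Ultrafilter.finite_biUnion_mem_iff hF).1 this
    exact ⟨f, hf⟩
  choose f hf using pick
  have hff : ∀ i j : ℕ, ∀ r : ℝ, r ≤ i → r ≤ j → r - δ ≤ gromovProd e (f i) (f j) := by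
    intro i j r hi hj
    obtain ⟨ζ, h1, h2⟩ := 𝒰.nonempty_of_mem (inter_mem (hf i) (hf j))
    obtain ⟨s, hs⟩ := exists_rep ζ
    obtain ⟨n, hn⟩ := h1.eventually_le h hγ hs
    obtain ⟨m, hm⟩ := h2.eventually_le h hγ hs
    have h3 := hn _ (le_max_left n m)
    have h4 := hm _ (le_max_right n m)
    rw [gromovProd_comm] at h3
    exact le_gromovProd h (r := r - δ / 2) (y := s (max n m)) (by linarith) (by linarith) (by ring)
  have hconv : Asymptotic e f f := by
    refine asymptotic_iff.2 fun R => ?_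
    obtain ⟨n, hn⟩ := exists_nat_ge (R + δ)
    refine ⟨n, fun i hi j hj => ?_⟩
    have := hff i j (R + δ) (hn.trans (by exact_mod_cast hi)) (hn.trans (by exact_mod_cast hj))
    linarith
  obtain ⟨η, hη⟩ := Rep.exists_of_asymptotic h hγ hconv
  refine ⟨η, mem_univ _, le_nhds_iff.2 fun S hηS hS => ?_⟩
  obtain ⟨R, hR⟩ := (isOpen_iff h hγ).1 hS η hηS
  obtain ⟨r, hr⟩ := exists_nat_ge (R + 2 * δ)
  filter_upwards [hf r] with ζ hζ
  refine hR ζ ?_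
  obtain ⟨s, hs⟩ := exists_rep ζ
  obtain ⟨n, hn⟩ := hζ.eventually_le h hγ hs
  refine ⟨f, s, hη, hs, max n r, fun i hi j hj => ?_⟩
  have h1 := hff i r (R + 2 * δ) (hr.trans (by exact_mod_cast (le_of_max_le_right hi))) hr
  have h2 := hn j (le_of_max_le_left hj)
  rw [gromovProd_comm] at h2
  exact le_gromovProd h (r := R + δ / 2) (y := f r) (by linarith) (by linarith) (by ring)

end IdealBoundary

/-! ### A characterization of the Cantor space -/

namespace CantorScheme

variable {X : Type*} (U : ℕ → Set X)

/-- The least index of a set `U i` that cuts `D` into two nonempty parts. -/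
noncomputable def splitIndex (D : Set X) : ℕ :=
  sInf {i | (D ∩ U i).Nonempty ∧ (D \ U i).Nonempty}

/-- The two halves of `D`. -/
noncomputable def half (D : Set X) (b : Bool) : Set X :=
  if b then D ∩ U (splitIndex U D) else D \ U (splitIndex U D)

/-- The set reached from the whole space by `n` successive halvings directed by `b`. -/
noncomputable def cyl (b : ℕ → Bool) : ℕ → Set X
  | 0 => univ
  | n + 1 => half U (cyl b n) (b n)

open Classical in
/-- The set containing `x` after `n` successive halvings. -/
noncomputable def cell (x : X) : ℕ → Set X
  | 0 => univ
  | n + 1 => half U (cell x n) (decide (x ∈ U (splitIndex U (cell x n))))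

open Classical in
/-- The sequence of halves chosen by `x`. -/
noncomputable def itinerary (x : X) (n : ℕ) : Bool := decide (x ∈ U (splitIndex U (cell U x n)))

theorem cell_eq_cyl (x : X) (n : ℕ) : cell U x n = cyl U (itinerary U x) n := by
  induction n with
  | zero => rfl
  | succ n ih => rw [cyl, ← ih]; rfl

theorem half_subset (D : Set X) (b : Bool) : half U D b ⊆ D := by
  unfold half
  split_ifs
  exacts [inter_subset_left, sdiff_subset]

theorem cyl_succ_subset (b : ℕ → Bool) (n : ℕ) : cyl U b (n + 1) ⊆ cyl U b n := half_subset U _ _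

theorem mem_half_iff {D : Set X} {b : Bool} {x : X} :
    x ∈ half U D b ↔ x ∈ D ∧ (x ∈ U (splitIndex U D) ↔ b = true) := by
  unfold half
  cases b <;> simp

theorem mem_cyl_iff {b : ℕ → Bool} {n : ℕ} {x : X} :
    x ∈ cyl U b n ↔ ∀ m < n, itinerary U x m = b m := by
  induction n with
  | zero => simp [cyl]
  | succ n ih =>
    rw [cyl, mem_half_iff, ih]
    have key : (∀ m < n, itinerary U x m = b m) →
        cyl U b n = cyl U (itinerary U x) n := by
      intro h
      clear ih
      induction n with
      | zero => rfl
      | succ n ihn => rw [cyl, cyl, ihn fun m hm => h m (hm.trans n.lt_succ_self), h n n.lt_succ_self]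
    have hit : (x ∈ U (splitIndex U (cyl U (itinerary U x) n)) ↔ itinerary U x n = true) := by
      rw [← cell_eq_cyl]; simp [itinerary]
    constructor
    · rintro ⟨h, h'⟩ m hm
      rcases Nat.lt_succ_iff_lt_or_eq.1 hm with hm | rfl
      · exact h m hm
      · rw [key h, hit] at h'
        exact Bool.eq_iff_iff.2 h'
    · intro h
      have h0 : ∀ m < n, itinerary U x m = b m := fun m hm => h m (hm.trans n.lt_succ_self)
      refine ⟨h0, ?_⟩
      rw [key h0, hit, h n n.lt_succ_self]

/-- The clopen sets separate points, so a nonempty open set, which has at least two points, is cut by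
one of them. -/
theorem exists_split [TopologicalSpace X]
    (sep : ∀ x y, x ≠ y → ∃ i, x ∈ U i ∧ y ∉ U i ∨ y ∈ U i ∧ x ∉ U i)
    (perf : ∀ x : X, ¬ IsOpen {x}) {D : Set X} (hD : IsOpen D) (hne : D.Nonempty) :
    (D ∩ U (splitIndex U D)).Nonempty ∧ (D \ U (splitIndex U D)).Nonempty := by
  have : {i | (D ∩ U i).Nonempty ∧ (D \ U i).Nonempty}.Nonempty := by
    obtain ⟨x, hx⟩ := hne
    have : ∃ y ∈ D, x ≠ y := by
      by_contra! h
      exact perf x ((Set.Subset.antisymm (singleton_subset_iff.2 hx) fun y hy => (h y hy).symm) ▸ hD)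
    obtain ⟨y, hy, hxy⟩ := this
    obtain ⟨i, ⟨h1, h2⟩ | ⟨h1, h2⟩⟩ := sep x y hxy
    · exact ⟨i, ⟨x, hx, h1⟩, y, hy, h2⟩
    · exact ⟨i, ⟨y, hy, h1⟩, x, hx, h2⟩
  exact Nat.sInf_mem this

/-- A nonempty compact space without isolated points in which a sequence of clopen sets separates
points is homeomorphic to the Cantor space. Always cutting by the first clopen set that does cut
ensures that, along each sequence of halvings, every one of the clopen sets gets decided. -/
theorem nonempty_homeomorph [TopologicalSpace X] [CompactSpace X] [Nonempty X]
    (hU : ∀ i, IsClopen (U i))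
    (sep : ∀ x y, x ≠ y → ∃ i, x ∈ U i ∧ y ∉ U i ∨ y ∈ U i ∧ x ∉ U i)
    (perf : ∀ x : X, ¬ IsOpen {x}) : Nonempty (X ≃ₜ (ℕ → Bool)) := by
  have hcl : ∀ b n, IsClopen (cyl U b n) := by
    intro b n
    induction n with
    | zero => exact isClopen_univ
    | succ n ih =>
      rw [cyl, half]
      split_ifs
      exacts [ih.inter (hU _), ih.diff (hU _)]
  have hne : ∀ b n, (cyl U b n).Nonempty := by
    intro b n
    induction n with
    | zero => exact univ_nonempty
    | succ n ih =>
      have := exists_split U sep perf (hcl b n).isOpen ih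
      rw [cyl, half]
      split_ifs
      exacts [this.1, this.2]
  have hcont : Continuous (itinerary U) := by
    refine continuous_pi fun n => continuous_discrete_rng.2 fun v => ?_
    rw [isOpen_iff_mem_nhds]
    intro x hx
    filter_upwards [(hcl (itinerary U x) (n + 1)).isOpen.mem_nhds
      ((mem_cyl_iff U).2 fun _ _ => rfl)] with y hy
    rw [mem_preimage, (mem_cyl_iff U).1 hy n n.lt_succ_self]
    exact hx
  have hsurj : Function.Surjective (itinerary U) := by
    intro b
    obtain ⟨x, hx⟩ := IsCompact.nonempty_iInter_of_sequence_nonempty_isCompact_isClosed (cyl U b)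
      (cyl_succ_subset U b) (hne b) (hcl b 0).isClosed.isCompact fun n => (hcl b n).isClosed
    refine ⟨x, funext fun n => ?_⟩
    exact (mem_cyl_iff U).1 (mem_iInter.1 hx (n + 1)) n n.lt_succ_self
  have hinj : Function.Injective (itinerary U) := by
    intro x y hxy
    by_contra hne'
    obtain ⟨i, hi⟩ := sep x y hne'
    set b := itinerary U x with hb
    have hx : ∀ n, x ∈ cyl U b n := fun n => (mem_cyl_iff U).2 fun _ _ => rfl
    have hy : ∀ n, y ∈ cyl U b n := fun n => (mem_cyl_iff U).2 fun m _ => by rw [← hxy]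
    -- Neither half of a cut by `U j` is cut by `U j` again, so the indices of the cuts are distinct;
    -- they cannot all be at most `i`.
    have hle : ∀ n, splitIndex U (cyl U b n) ≤ i := by
      intro n
      apply Nat.sInf_le
      rcases hi with ⟨h1, h2⟩ | ⟨h1, h2⟩
      · exact ⟨⟨x, hx n, h1⟩, y, hy n, h2⟩
      · exact ⟨⟨y, hy n, h1⟩, x, hx n, h2⟩
    have hanti : Antitone (cyl U b) := antitone_nat_of_succ_le (cyl_succ_subset U b)
    have hdist : ∀ m n, m < n → splitIndex U (cyl U b m) ≠ splitIndex U (cyl U b n) := by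
      intro m n hmn heq
      obtain ⟨⟨z, hz, hz'⟩, w, hw, hw'⟩ := exists_split U sep perf (hcl b n).isOpen (hne b n)
      have h1 := ((mem_half_iff U).1 (hanti hmn hz)).2
      have h2 := ((mem_half_iff U).1 (hanti hmn hw)).2
      rw [heq] at h1 h2
      exact hw' (h2.2 (h1.1 hz'))
    have : Function.Injective fun n => splitIndex U (cyl U b n) := by
      intro m n h
      rcases lt_trichotomy m n with h' | h' | h'
      · exact (hdist m n h' h).elim
      · exact h'
      · exact (hdist n m h' h.symm).elim
    exact Set.infinite_range_of_injective this
      ((Set.finite_Iic i).subset (range_subset_iff.2 hle))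
  exact ⟨Continuous.homeoOfEquivCompactToT2 (f := Equiv.ofBijective _ ⟨hinj, hsurj⟩) hcont⟩

end CantorScheme

/-! ### Branches of a tree -/

/-- The branch at `l` that starts with the edge from `l` to `k`: the component of `k` after
deletion of that edge. -/
def treeBranch {V : Type*} (G : SimpleGraph V) (l k : V) : Set V :=
  {v | (G.deleteEdges {s(k, l)}).Reachable k v}

namespace treeBranch

variable {V : Type*} {G : SimpleGraph V} {l k k' u v : V}

theorem self_mem : k ∈ treeBranch G l k := SimpleGraph.Reachable.refl _

theorem notMem (hG : G.IsTree) (h : G.Adj k l) : l ∉ treeBranch G l k := by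
  have := SimpleGraph.isAcyclic_iff_forall_adj_isBridge.1 hG.isAcyclic h
  rwa [SimpleGraph.isBridge_iff] at this

theorem mem_of_adj (hu : u ∈ treeBranch G l k) (huv : G.Adj u v) (hne : s(u, v) ≠ s(k, l)) :
    v ∈ treeBranch G l k := by
  refine SimpleGraph.Reachable.trans hu (SimpleGraph.Adj.reachable ?_)
  rw [SimpleGraph.deleteEdges_adj]
  exact ⟨huv, hne⟩

theorem exit (hG : G.IsTree) (h : G.Adj k l) (hu : u ∈ treeBranch G l k)
    (hv : v ∉ treeBranch G l k) (huv : G.Adj u v) : u = k ∧ v = l := by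
  by_contra hne
  refine hv (mem_of_adj hu huv fun heq => ?_)
  rcases Sym2.eq_iff.1 heq with h1 | h1
  · exact hne h1
  · exact notMem hG h (h1.1 ▸ hu)

theorem disjoint (hG : G.IsTree) (h : G.Adj k l) (h' : G.Adj k' l) (hne : k ≠ k')
    (hv : v ∈ treeBranch G l k) : v ∉ treeBranch G l k' := by
  obtain ⟨p⟩ := hv
  have key : ∀ {u v : V} (_ : (G.deleteEdges {s(k, l)}).Walk u v), u ∈ treeBranch G l k →
      u ∉ treeBranch G l k' → v ∉ treeBranch G l k' := by
    intro u v p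
    induction p with
    | nil => exact fun _ h => h
    | cons hadj _ ih =>
      intro hu hu'
      have hw := SimpleGraph.Reachable.trans hu hadj.reachable
      refine ih hw fun hw' => ?_
      have := (exit hG h' hw' hu' ((SimpleGraph.deleteEdges_adj.1 hadj).1.symm)).2
      exact notMem hG h (this ▸ hu)
  refine key p self_mem fun hk => ?_
  exact hne (exit hG h' hk (notMem hG h') h).1

theorem eq_of_mem (hG : G.IsTree) (h : G.Adj k l) (h' : G.Adj k' l)
    (hv : v ∈ treeBranch G l k) (hv' : v ∈ treeBranch G l k') : k = k' := by
  by_contra hne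
  exact disjoint hG h h' hne hv hv'

theorem exists_mem (hG : G.IsTree) (hv : v ≠ l) : ∃ k, G.Adj k l ∧ v ∈ treeBranch G l k := by
  obtain ⟨p⟩ := hG.connected.preconnected v l
  induction p with
  | nil => exact (hv rfl).elim
  | @cons v w l hadj p ih =>
    by_cases hw : w = l
    · subst hw; exact ⟨v, hadj, self_mem⟩
    · obtain ⟨k, hk, hwk⟩ := ih hw
      refine ⟨k, hk, ?_⟩
      by_contra hvk
      exact hv (exit hG hk hwk hvk hadj.symm).2

/-- The two branches of an edge are disjoint. -/
theorem notMem_swap (hG : G.IsTree) (h : G.Adj k l) (hv : v ∈ treeBranch G k l) :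
    v ∉ treeBranch G l k := by
  intro hv'
  refine notMem hG h (SimpleGraph.Reachable.trans hv' (SimpleGraph.Reachable.symm ?_))
  rw [Sym2.eq_swap]; exact hv

/-- The first step from `k` towards `v`. -/
theorem exists_notMem (hG : G.IsTree) (hv : v ≠ k) : ∃ l, G.Adj k l ∧ v ∉ treeBranch G l k := by
  obtain ⟨l, hl, hvl⟩ := exists_mem hG hv
  exact ⟨l, hl.symm, notMem_swap hG hl.symm hvl⟩

theorem dist_eq (hG : G.IsTree) (h : G.Adj k l) (hv : v ∈ treeBranch G l k)
    (hu : u ∉ treeBranch G l k) : G.dist v u = G.dist v k + 1 + G.dist l u := by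
  apply le_antisymm
  · have h1 := hG.connected.dist_triangle (u := v) (v := k) (w := u)
    have h2 := hG.connected.dist_triangle (u := k) (v := l) (w := u)
    rw [SimpleGraph.dist_eq_one_iff_adj.2 h] at h2
    omega
  · obtain ⟨p, hp⟩ := hG.connected.exists_walk_length_eq_dist v u
    rw [← hp]
    clear hp
    induction p with
    | nil => exact (hu hv).elim
    | @cons v w u hadj p ih =>
      rw [SimpleGraph.Walk.length_cons]
      by_cases hw : w ∈ treeBranch G l k
      · have h1 := ih hw hu
        have h2 := hG.connected.dist_triangle (u := v) (v := w) (w := k)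
        rw [SimpleGraph.dist_eq_one_iff_adj.2 hadj] at h2
        omega
      · obtain ⟨rfl, rfl⟩ := exit hG h hv hw hadj
        have := SimpleGraph.dist_le p
        rw [SimpleGraph.dist_self]
        omega

end treeBranch

/-! ### The geometric realization -/

namespace GraphRealization

variable {V : Type*} {G : SimpleGraph V}

theorem edgePoint_apply (u v w : V) (t : ℝ) [DecidableEq V] :
    edgePoint u v t w = (1 - t) * (if w = u then 1 else 0) + t * (if w = v then 1 else 0) := by
  simp [edgePoint, Pi.single_apply]

theorem nonneg (f : GraphRealization G) (w : V) : 0 ≤ f.1 w := by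
  classical
  obtain ⟨f, u, v, -, t, ht, rfl⟩ := f
  change 0 ≤ edgePoint u v t w
  rw [edgePoint_apply]
  have := ht.1
  have : 0 ≤ 1 - t := sub_nonneg.2 ht.2
  positivity

theorem adj_of_pos (f : GraphRealization G) {a b : V} (hab : a ≠ b) (ha : 0 < f.1 a)
    (hb : 0 < f.1 b) : G.Adj a b := by
  classical
  obtain ⟨f, u, v, huv, t, ht, rfl⟩ := f
  change 0 < edgePoint u v t a at ha
  change 0 < edgePoint u v t b at hb
  rw [edgePoint_apply] at ha hb
  have h1 : a = u ∨ a = v := by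
    by_contra! h
    rw [if_neg h.1, if_neg h.2] at ha; simp at ha
  have h2 : b = u ∨ b = v := by
    by_contra! h
    rw [if_neg h.1, if_neg h.2] at hb; simp at hb
  rcases h1 with rfl | rfl <;> rcases h2 with rfl | rfl
  · exact (hab rfl).elim
  · exact huv.resolve_left hab
  · exact (huv.resolve_left hab.symm).symm
  · exact (hab rfl).elim

theorem exists_pos (f : GraphRealization G) : ∃ w, 0 < f.1 w := by
  classical
  obtain ⟨f, u, v, huv, t, ht, rfl⟩ := f
  rcases eq_or_lt_of_le ht.1 with h | h
  · refine ⟨u, ?_⟩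
    change 0 < edgePoint u v t u
    rw [edgePoint_apply, ← h]; simp
  · refine ⟨v, ?_⟩
    change 0 < edgePoint u v t v
    rw [edgePoint_apply, if_pos rfl]
    have : 0 ≤ 1 - t := sub_nonneg.2 ht.2
    positivity

theorem vertex_apply [DecidableEq V] (v w : V) :
    (vertex G v).1 w = if w = v then 1 else 0 := by
  simp [vertex, edgePoint_apply]

/-- A point all of whose coordinates but one vanish is a vertex. -/
theorem eq_vertex (f : GraphRealization G) {l : V} (h : ∀ w, w ≠ l → f.1 w = 0) :
    f = vertex G l := by
  classical
  obtain ⟨f, u, v, huv, t, ht, rfl⟩ := f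
  apply Subtype.ext
  funext w
  rw [vertex_apply]
  change edgePoint u v t w = _
  have key : edgePoint u v t l = 1 := by
    by_cases hu : u = l
    · by_cases hv : v = l
      · rw [edgePoint_apply, hu, hv]; simp
      · have := h v hv
        change edgePoint u v t v = 0 at this
        rw [edgePoint_apply, if_neg (by rintro rfl; exact hv hu)] at this
        simp at this
        rw [edgePoint_apply, this, hu]; simp
    · have := h u hu
      change edgePoint u v t u = 0 at this
      by_cases hv : u = v
      · rw [edgePoint_apply, hv] at this; simp at this
      · rw [edgePoint_apply, if_neg hv] at this
        simp at this
        have ht1 : t = 1 := by linarith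
        have hvl : v = l := by
          by_contra hvl
          have := h v hvl
          change edgePoint u v t v = 0 at this
          rw [edgePoint_apply, ht1] at this; simp at this
        rw [edgePoint_apply, ht1, hvl]; simp
  split_ifs with hw
  · rw [hw, key]
  · exact h w hw

theorem mem_star_of_pos {f : GraphRealization G} {k : V} (h : 0 < f.1 k) : f ∈ star G k := by
  classical
  obtain ⟨f, u, v, huv, t, ht, rfl⟩ := f
  change 0 < edgePoint u v t k at h
  have h1 : k = u ∨ k = v := by
    by_contra! h'
    rw [edgePoint_apply, if_neg h'.1, if_neg h'.2] at h; simp at h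
  rcases h1 with rfl | rfl
  · exact ⟨v, huv, t, ht, rfl⟩
  · refine ⟨u, huv.imp Eq.symm SimpleGraph.Adj.symm, 1 - t, ⟨by linarith [ht.2], by linarith [ht.1]⟩, ?_⟩
    change edgePoint u k t = _
    unfold edgePoint
    rw [sub_sub_cancel, add_comm]

theorem vertex_mem_star {l k : V} (h : G.Adj k l) : vertex G l ∈ star G k := by
  refine ⟨l, Or.inr h, 1, ⟨zero_le_one, le_rfl⟩, ?_⟩
  simp [vertex, edgePoint]

theorem eq_or_adj_of_mem_star {f : GraphRealization G} {k w : V} (hf : f ∈ star G k)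
    (hw : 0 < f.1 w) : w = k ∨ G.Adj k w := by
  classical
  obtain ⟨v, hv, t, ht, hf⟩ := hf
  rw [hf, edgePoint_apply] at hw
  by_cases h1 : w = k
  · exact Or.inl h1
  · rw [if_neg h1] at hw
    by_cases h2 : w = v
    · subst h2; exact Or.inr (hv.resolve_left (Ne.symm h1))
    · rw [if_neg h2] at hw; simp at hw

/-- A point of the star of `k` whose `k`-coordinate vanishes is a neighbour of `k`. -/
theorem exists_eq_vertex_of_mem_star {f : GraphRealization G} {k : V} (hf : f ∈ star G k)
    (hk : f.1 k = 0) : ∃ l, G.Adj k l ∧ f = vertex G l := by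
  classical
  obtain ⟨v, hv, t, ht, hf⟩ := hf
  rw [hf, edgePoint_apply, if_pos rfl] at hk
  by_cases h : k = v
  · rw [if_pos h] at hk; simp at hk
  · rw [if_neg h] at hk
    have ht1 : t = 1 := by linarith
    refine ⟨v, hv.resolve_left h, Subtype.ext ?_⟩
    rw [hf, ht1]
    simp [vertex, edgePoint]

theorem continuous_apply (w : V) : Continuous fun f : GraphRealization G => f.1 w :=
  (_root_.continuous_apply w).comp continuous_subtype_val

end GraphRealization

/-! ### The gluing metric -/

namespace PreAug

variable {Z : Type*} [MetricSpace Z] {K : Type*} {N : K → Set Z}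

theorem dist_le {p q : PreAug N} {r : ℝ} (h : ChainJoined N p q r) : dist p q ≤ r :=
  csInf_le (ChainJoined.bddBelow p q) h

theorem le_dist {p q : PreAug N} {c : ℝ} (h : ∀ r, ChainJoined N p q r → c ≤ r) : c ≤ dist p q :=
  le_csInf (ChainJoined.exists p q) h

theorem exists_chainJoined_lt {p q : PreAug N} {c : ℝ} (h : dist p q < c) :
    ∃ r, ChainJoined N p q r ∧ r < c :=
  exists_lt_of_csInf_lt (ChainJoined.exists p q) h

theorem dist_base_le (z z' : Z) : dist (base z : PreAug N) (base z') ≤ dist z z' :=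
  dist_le (.base z z')

theorem dist_ray_le (k : K) (x : N k) (h h' : ℝ≥0) :
    dist (ray k x h : PreAug N) (ray k x h') ≤ |(h : ℝ) - h'| :=
  dist_le (.ray k x h h')

theorem dist_foot (k : K) (x : N k) : dist (ray k x 0 : PreAug N) (base x) = 0 :=
  le_antisymm (dist_le (.foot k x)) dist_nonneg

theorem dist_corner (k : K) (l : ℕ) (x y : N k) (hl : 1 ≤ l) (hpos : 0 < dist (x : Z) y)
    (hle : dist (x : Z) y ≤ 2 ^ l) :
    dist (edge k l x y hl hpos hle 0 : PreAug N) (ray k x l) = 0 :=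
  le_antisymm (dist_le (.corner k l x y hl hpos hle)) dist_nonneg

theorem dist_edge_ray_le (k : K) (l : ℕ) (x y : N k) (hl : 1 ≤ l) (hpos : 0 < dist (x : Z) y)
    (hle : dist (x : Z) y ≤ 2 ^ l) (t : unitInterval) :
    dist (edge k l x y hl hpos hle t : PreAug N) (ray k x l) ≤ 1 := by
  have h1 := dist_triangle (edge k l x y hl hpos hle t : PreAug N) (edge k l x y hl hpos hle 0)
    (ray k x l)
  rw [dist_corner] at h1
  have h2 := dist_le (ChainJoined.edge (N := N) k l x y hl hpos hle t 0)
  have h3 : dist t 0 ≤ 1 := by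
    rw [Subtype.dist_eq, Real.dist_eq]
    simpa [abs_of_nonneg t.2.1] using t.2.2
  linarith

theorem dist_horizontal_le (k : K) (l : ℕ) (x y : N k) (hl : 1 ≤ l)
    (hle : dist (x : Z) y ≤ 2 ^ l) : dist (ray k x l : PreAug N) (ray k y l) ≤ 1 := by
  rcases eq_or_ne x y with rfl | hne
  · rw [dist_self]; exact zero_le_one
  · have hpos : 0 < dist (x : Z) y := dist_pos.2 fun h => hne (Subtype.ext h)
    have hpos' : 0 < dist (y : Z) x := by rwa [dist_comm]
    have hle' : dist (y : Z) x ≤ 2 ^ l := by rwa [dist_comm]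
    have h1 := ChainJoined.flip (N := N) k l x y hl hpos hle hpos' hle' 1
    rw [unitInterval.symm_one] at h1
    have h2 := (ChainJoined.corner (N := N) k l x y hl hpos hle).symm.trans
      (((ChainJoined.edge k l x y hl hpos hle 0 1).trans h1).trans (.corner k l y x hl hpos' hle'))
    refine (dist_le h2).trans ?_
    simp [Subtype.dist_eq]

/-- A function on the pieces, given on `Z` and on the vertical rays and interpolated linearly on
the horizontal edges. -/
def interpolate (f : Z → ℝ) (g : ∀ k, N k → ℝ → ℝ) : PreAug N → ℝ
  | base z => f z
  | ray k x h => g k x h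
  | edge k l x y _ _ _ t => (1 - (t : ℝ)) * g k x l + t * g k y l

/-- A function on the pieces that is compatible with the gluing and `1`-Lipschitz on each piece is
`1`-Lipschitz for the gluing metric. -/
theorem abs_interpolate_sub_le_dist {f : Z → ℝ} {g : ∀ k, N k → ℝ → ℝ}
    (hf : ∀ z z', |f z - f z'| ≤ dist z z')
    (hg : ∀ k x (h h' : ℝ), 0 ≤ h → 0 ≤ h' → |g k x h - g k x h'| ≤ |h - h'|)
    (h0 : ∀ k (x : N k), g k x 0 = f x)
    (he : ∀ k (l : ℕ) (x y : N k), 1 ≤ l → dist (x : Z) y ≤ 2 ^ l → |g k x l - g k y l| ≤ 1)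
    (p q : PreAug N) : |interpolate f g p - interpolate f g q| ≤ dist p q := by
  refine le_dist fun r hr => ?_
  induction hr with
  | base z z' => exact hf z z'
  | ray k x h h' => exact hg k x h h' h.2 h'.2
  | edge k l x y hl hpos hle t t' =>
    have : interpolate f g (edge k l x y hl hpos hle t) - interpolate f g (edge k l x y hl hpos hle t')
        = (t' - t) * (g k x l - g k y l) := by simp only [interpolate]; ring
    rw [this, abs_mul, Subtype.dist_eq, Real.dist_eq, abs_sub_comm]
    exact mul_le_of_le_one_right (abs_nonneg _) (he k l x y hl hle)
  | foot k x => simp [interpolate, h0]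
  | corner => simp [interpolate]
  | flip k l x y hl hpos hle hpos' hle' t =>
    refine le_of_eq ?_
    simp only [interpolate, unitInterval.coe_symm_eq]
    rw [abs_eq_zero]; ring
  | symm _ ih => rwa [abs_sub_comm]
  | trans _ _ ih ih' => exact (abs_sub_le _ _ _).trans (add_le_add ih ih')

end PreAug

/-! ### Distances in combinatorial horoballs -/

theorem logb_two_le_add {S S' c : ℝ} (hS : 0 < S) (hS' : 0 < S') (h : S' ≤ 2 ^ c * S) :
    Real.logb 2 S' ≤ Real.logb 2 S + c := by
  have h1 := Real.logb_le_logb_of_le one_lt_two hS' h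
  rwa [Real.logb_mul (by positivity) hS.ne', Real.logb_rpow two_pos (by norm_num), add_comm] at h1

/-- The quantity whose logarithm measures distances in a horoball: for points at heights `a` and
`b` over feet at distance `D`. -/
noncomputable def horoSize (D a b : ℝ) : ℝ := D + 4 * 2 ^ a + 4 * 2 ^ b

theorem horoSize_pos {D : ℝ} (hD : 0 ≤ D) (a b : ℝ) : 0 < horoSize D a b := by
  unfold horoSize; positivity

theorem horoSize_comm (D a b : ℝ) : horoSize D a b = horoSize D b a := by
  unfold horoSize; ring

theorem one_le_two_rpow {a : ℝ} (ha : 0 ≤ a) : (1 : ℝ) ≤ 2 ^ a :=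
  Real.one_le_rpow one_le_two ha

namespace PreAug

variable {Z : Type*} [MetricSpace Z] {K : Type*} {N : K → Set Z}

/-- A `1`-Lipschitz function that measures, up to a constant, the distance from height `a` over
`o`. -/
noncomputable def logHeight (N : K → Set Z) (o : Z) (a : ℝ) : PreAug N → ℝ :=
  interpolate (fun z => 2 * Real.logb 2 (horoSize (dist o z) a 0))
    fun _ x h => 2 * Real.logb 2 (horoSize (dist o x) a h) - h

/-- The `1`-Lipschitz property of `logHeight` is the source of all lower bounds for distances in
horoballs. -/
theorem abs_logHeight_sub_le_dist (o : Z) {a : ℝ} (ha : 0 ≤ a) (p q : PreAug N) :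
    |logHeight N o a p - logHeight N o a q| ≤ dist p q := by
  have pos : ∀ z h, 0 < horoSize (dist o z) a h := fun z h => horoSize_pos dist_nonneg a h
  refine abs_interpolate_sub_le_dist ?_ ?_ ?_ ?_ p q
  · have key : ∀ z z', Real.logb 2 (horoSize (dist o z) a 0) ≤
        Real.logb 2 (horoSize (dist o z') a 0) + dist z z' / 2 := by
      intro z z'
      refine logb_two_le_add (pos _ _) (pos _ _) ?_
      have h1 : (1 : ℝ) + dist z z' / 2 * (1 / 2) ≤ 2 ^ (dist z z' / 2) := by
        rw [Real.rpow_def_of_pos two_pos]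
        have h2 := Real.add_one_le_exp (Real.log 2 * (dist z z' / 2))
        have h3 := Real.log_two_gt_d9
        have h4 : (1 / 2) * (dist z z' / 2) ≤ Real.log 2 * (dist z z' / 2) :=
          mul_le_mul_of_nonneg_right (by linarith) (by positivity)
        linarith
      have h5 := mul_le_mul_of_nonneg_right h1 (pos z' 0).le
      refine le_trans ?_ h5
      have h6 := dist_triangle o z' z
      rw [dist_comm z' z] at h6
      have h7 : 8 ≤ horoSize (dist o z') a 0 := by
        have := one_le_two_rpow ha
        have : 0 ≤ dist o z' := dist_nonneg
        unfold horoSize; rw [Real.rpow_zero]; linarith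
      have h8 : horoSize (dist o z) a 0 ≤ horoSize (dist o z') a 0 + dist z z' := by
        unfold horoSize; linarith
      nlinarith [dist_nonneg (x := z) (y := z')]
    intro z z'
    rw [abs_le]
    have h1 := key z z'
    have h2 := key z' z
    rw [dist_comm z' z] at h2
    constructor <;> linarith
  · have key : ∀ (x : Z) (h h' : ℝ), h ≤ h' →
        Real.logb 2 (horoSize (dist o x) a h) ≤ Real.logb 2 (horoSize (dist o x) a h') ∧
        Real.logb 2 (horoSize (dist o x) a h') ≤ Real.logb 2 (horoSize (dist o x) a h) + (h' - h) := by
      intro x h h' hh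
      have h1 : (2 : ℝ) ^ h ≤ 2 ^ h' := Real.rpow_le_rpow_of_exponent_le one_le_two hh
      have h2 := one_le_two_rpow (sub_nonneg.2 hh)
      constructor
      · exact Real.logb_le_logb_of_le one_lt_two (pos _ _) (by unfold horoSize; linarith)
      · refine logb_two_le_add (pos _ _) (pos _ _) ?_
        have h3 : (2 : ℝ) ^ (h' - h) * 2 ^ h = 2 ^ h' := by
          rw [← Real.rpow_add two_pos]; congr 1; ring
        have h4 : 0 ≤ dist o x + 4 * 2 ^ a := by positivity
        unfold horoSize
        nlinarith [mul_le_mul_of_nonneg_right h2 h4]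
    intro k x h h' _ _
    rcases le_total h h' with hh | hh
    · obtain ⟨h1, h2⟩ := key x h h' hh
      rw [abs_le, abs_sub_comm h h', abs_of_nonneg (sub_nonneg.2 hh)]
      constructor <;> linarith
    · obtain ⟨h1, h2⟩ := key x h' h hh
      rw [abs_le, abs_of_nonneg (sub_nonneg.2 hh)]
      constructor <;> linarith
  · intro k x; simp
  · have key : ∀ (x y : Z) (l : ℕ), dist x y ≤ 2 ^ l →
        Real.logb 2 (horoSize (dist o x) a l) ≤ Real.logb 2 (horoSize (dist o y) a l) + 1 / 2 := by
      intro x y l hxy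
      refine logb_two_le_add (pos _ _) (pos _ _) ?_
      have h1 : (5 / 4 : ℝ) ≤ 2 ^ (1 / 2 : ℝ) := by
        rw [← Real.sqrt_eq_rpow]
        exact Real.le_sqrt_of_sq_le (by norm_num)
      have h2 := dist_triangle o y x
      rw [dist_comm y x] at h2
      have h3 : (0 : ℝ) < 2 ^ a := by positivity
      have h4 : 0 ≤ dist o y := dist_nonneg
      refine le_trans ?_ (mul_le_mul_of_nonneg_right h1 (pos y l).le)
      unfold horoSize
      rw [Real.rpow_natCast]
      linarith
    intro k l x y _ hxy
    have h1 := key x y l hxy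
    have h2 := key y x l (by rwa [dist_comm])
    rw [abs_le]
    constructor <;> linarith

theorem le_dist_base_base (o z : Z) :
    2 * Real.logb 2 (horoSize (dist o z) 0 0) - 6 ≤ dist (base o : PreAug N) (base z) := by
  have h1 := (abs_le.1 (abs_logHeight_sub_le_dist o le_rfl (base o : PreAug N) (base z))).1
  simp only [logHeight, interpolate, dist_self] at h1
  have h2 : Real.logb 2 (horoSize 0 0 0) = 3 := by
    rw [show horoSize 0 0 0 = 2 ^ (3 : ℝ) by norm_num [horoSize], Real.logb_rpow two_pos (by norm_num)]
  linarith

/-- The distance in `Z` is bounded in terms of the gluing metric. -/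
theorem dist_le_rpow (o z : Z) {r : ℝ} (h : dist (base o : PreAug N) (base z) ≤ r) :
    dist o z ≤ 2 ^ ((r + 6) / 2) := by
  have h1 := (le_dist_base_base (N := N) o z).trans h
  have h2 : Real.logb 2 (horoSize (dist o z) 0 0) ≤ (r + 6) / 2 := by linarith
  rw [Real.logb_le_iff_le_rpow one_lt_two (horoSize_pos dist_nonneg _ _)] at h2
  unfold horoSize at h2
  rw [Real.rpow_zero] at h2
  linarith

theorem le_dist_base_ray (o : Z) (k : K) (x : N k) (h : ℝ≥0) :
    2 * Real.logb 2 (horoSize (dist o x) 0 h) - h - 6 ≤ dist (base o : PreAug N) (ray k x h) := by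
  have h1 := (abs_le.1 (abs_logHeight_sub_le_dist o le_rfl (base o : PreAug N) (ray k x h))).1
  simp only [logHeight, interpolate, dist_self] at h1
  have h2 : Real.logb 2 (horoSize 0 0 0) = 3 := by
    rw [show horoSize 0 0 0 = 2 ^ (3 : ℝ) by norm_num [horoSize], Real.logb_rpow two_pos (by norm_num)]
  linarith

theorem bounds_of_dist_base_ray_le (o : Z) (k : K) (x : N k) (h : ℝ≥0) {r : ℝ}
    (hr : dist (base o : PreAug N) (ray k x h) ≤ r) :
    dist o x ≤ 2 ^ (r + 6) ∧ (h : ℝ) ≤ r + 6 := by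
  have h1 := (le_dist_base_ray o k x h).trans hr
  have hpos := horoSize_pos (dist_nonneg (x := o) (y := (x : Z))) 0 h
  have h2 : (h : ℝ) ≤ Real.logb 2 (horoSize (dist o x) 0 h) := by
    rw [Real.le_logb_iff_rpow_le one_lt_two hpos]
    have : (0 : ℝ) < 2 ^ (h : ℝ) := by positivity
    have : 0 ≤ dist o (x : Z) := dist_nonneg
    unfold horoSize; rw [Real.rpow_zero]; linarith
  have h3 : Real.logb 2 (horoSize (dist o x) 0 h) ≤ r + 6 := by linarith
  refine ⟨?_, by linarith⟩
  rw [Real.logb_le_iff_le_rpow one_lt_two hpos] at h3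
  have : (0 : ℝ) < 2 ^ (h : ℝ) := by positivity
  unfold horoSize at h3
  rw [Real.rpow_zero] at h3
  linarith

theorem le_dist_ray_ray (k j : K) (x : N k) (y : N j) (a b : ℝ≥0) :
    2 * Real.logb 2 (horoSize (dist (x : Z) y) a b) - a - b - 6 ≤
      dist (ray k x a : PreAug N) (ray j y b) := by
  have h1 := (abs_le.1 (abs_logHeight_sub_le_dist (x : Z) a.2 (ray k x a : PreAug N) (ray j y b))).1
  simp only [logHeight, interpolate, dist_self, NNReal.val_eq_coe] at h1
  have h2 : Real.logb 2 (horoSize 0 a a) = 3 + a := by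
    rw [show horoSize 0 a a = 2 ^ (3 + (a : ℝ)) by
      rw [Real.rpow_add two_pos]; unfold horoSize; norm_num; ring,
      Real.logb_rpow two_pos (by norm_num)]
  linarith

/-- The upper bound is the length of the path that climbs to the first level `L` at which the two rays
are joined by an edge, crosses, and descends. -/
theorem dist_ray_ray_le (k : K) (x y : N k) (a b : ℝ≥0) :
    dist (ray k x a : PreAug N) (ray k y b) ≤
      2 * Real.logb 2 (horoSize (dist (x : Z) y) a b) - a - b + 3 := by
  set S := horoSize (dist (x : Z) y) a b with hS
  have hpos : 0 < S := horoSize_pos dist_nonneg _ _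
  have ha := one_le_two_rpow a.2
  have hb := one_le_two_rpow b.2
  simp only [NNReal.val_eq_coe] at ha hb
  have hd : 0 ≤ dist (x : Z) y := dist_nonneg
  have hSe : S = dist (x : Z) y + 4 * 2 ^ (a : ℝ) + 4 * 2 ^ (b : ℝ) := rfl
  have h1 : 1 ≤ Real.logb 2 S := by
    rw [Real.le_logb_iff_rpow_le one_lt_two hpos, Real.rpow_one]; linarith
  have hla : (a : ℝ) ≤ Real.logb 2 S := by
    rw [Real.le_logb_iff_rpow_le one_lt_two hpos]; linarith
  have hlb : (b : ℝ) ≤ Real.logb 2 S := by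
    rw [Real.le_logb_iff_rpow_le one_lt_two hpos]; linarith
  set L := ⌈Real.logb 2 S⌉₊
  have hL : Real.logb 2 S ≤ L := Nat.le_ceil _
  have hL' : (L : ℝ) < Real.logb 2 S + 1 := Nat.ceil_lt_add_one (by linarith)
  have hL1 : 1 ≤ L := by exact_mod_cast h1.trans hL
  have hSL : S ≤ 2 ^ L := by
    rw [← Real.rpow_natCast, ← Real.logb_le_iff_le_rpow one_lt_two hpos]; exact hL
  have e1 := dist_triangle4 (ray k x a : PreAug N) (ray k x L) (ray k y L) (ray k y b)
  have e2 := dist_ray_le k x a (L : ℝ≥0)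
  have e3 := dist_ray_le k y (L : ℝ≥0) b
  have e4 := dist_horizontal_le k L x y hL1 (by linarith)
  simp only [NNReal.coe_natCast] at e2 e3
  rw [abs_sub_comm, abs_of_nonneg (by linarith)] at e2
  rw [abs_of_nonneg (by linarith)] at e3
  linarith

theorem horoSize_mul_le {d₁₂ d₃₄ d₁₃ d₂₄ d₁₄ d₂₃ : ℝ} (h₃₄ : 0 ≤ d₃₄)
    (h₁₃ : 0 ≤ d₁₃) (h₂₄ : 0 ≤ d₂₄) (h₁₄ : 0 ≤ d₁₄) (h₂₃ : 0 ≤ d₂₃)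
    (t1 : d₁₂ ≤ d₁₃ + d₂₃) (t2 : d₁₂ ≤ d₁₄ + d₂₄) (t3 : d₃₄ ≤ d₁₃ + d₁₄)
    (t4 : d₃₄ ≤ d₂₃ + d₂₄) : d₁₂ * d₃₄ ≤ 4 * max (d₁₃ * d₂₄) (d₁₄ * d₂₃) := by
  have key : d₁₂ * d₃₄ ≤ 4 * (d₁₃ * d₂₄) ∨ d₁₂ * d₃₄ ≤ 4 * (d₁₄ * d₂₃) := by
    rcases le_total d₁₃ d₂₃ with a | a <;> rcases le_total d₁₃ d₁₄ with b | b <;>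
    rcases le_total d₁₄ d₂₄ with c | c <;> rcases le_total d₂₃ d₂₄ with d | d
    all_goals first
      | exact Or.inr ((mul_le_mul (by linarith : d₁₂ ≤ 2 * d₂₃) (by linarith : d₃₄ ≤ 2 * d₁₄) h₃₄
          (by positivity)).trans_eq (by ring))
      | exact Or.inr ((mul_le_mul (by linarith : d₁₂ ≤ 2 * d₁₄) (by linarith : d₃₄ ≤ 2 * d₂₃) h₃₄
          (by positivity)).trans_eq (by ring))
      | exact Or.inl ((mul_le_mul (by linarith : d₁₂ ≤ 2 * d₁₃) (by linarith : d₃₄ ≤ 2 * d₂₄) h₃₄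
          (by positivity)).trans_eq (by ring))
      | exact Or.inl ((mul_le_mul (by linarith : d₁₂ ≤ 2 * d₂₄) (by linarith : d₃₄ ≤ 2 * d₁₃) h₃₄
          (by positivity)).trans_eq (by ring))
  rcases key with h | h
  · exact h.trans (mul_le_mul_of_nonneg_left (le_max_left _ _) (by norm_num))
  · exact h.trans (mul_le_mul_of_nonneg_left (le_max_right _ _) (by norm_num))

theorem horoSize_triangle (x y z : Z) (a b c : ℝ) :
    horoSize (dist x y) a b ≤ horoSize (dist x z) a c + horoSize (dist y z) b c := by
  have := dist_triangle_right x y z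
  have : (0 : ℝ) < 2 ^ c := by positivity
  unfold horoSize; linarith

/-- The four-point condition in a horoball. The logarithm of a metric satisfies the four-point
condition, since the product of the lengths of two opposite sides is at most four times the larger
of the two other such products. -/
theorem four_point_ray (k : K) (x : Fin 4 → N k) (a : Fin 4 → ℝ≥0) :
    dist (ray k (x 0) (a 0) : PreAug N) (ray k (x 1) (a 1)) +
        dist (ray k (x 2) (a 2) : PreAug N) (ray k (x 3) (a 3)) ≤
      max (dist (ray k (x 0) (a 0) : PreAug N) (ray k (x 2) (a 2)) +
          dist (ray k (x 1) (a 1) : PreAug N) (ray k (x 3) (a 3)))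
        (dist (ray k (x 0) (a 0) : PreAug N) (ray k (x 3) (a 3)) +
          dist (ray k (x 1) (a 1) : PreAug N) (ray k (x 2) (a 2))) + 22 := by
  set S : Fin 4 → Fin 4 → ℝ := fun i j => horoSize (dist (x i : Z) (x j)) (a i) (a j) with hSdef
  have pos : ∀ i j, 0 < S i j := fun i j => horoSize_pos dist_nonneg _ _
  have comm : ∀ i j, S i j = S j i := fun i j => by
    simp only [hSdef]; rw [dist_comm, horoSize_comm]
  have tri : ∀ i j m, S i j ≤ S i m + S j m := fun i j m => horoSize_triangle _ _ _ _ _ _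
  have up : ∀ i j, dist (ray k (x i) (a i) : PreAug N) (ray k (x j) (a j)) ≤
      2 * Real.logb 2 (S i j) - a i - a j + 3 := fun i j => dist_ray_ray_le _ _ _ _ _
  have lo : ∀ i j, 2 * Real.logb 2 (S i j) - a i - a j - 6 ≤
      dist (ray k (x i) (a i) : PreAug N) (ray k (x j) (a j)) := fun i j => le_dist_ray_ray _ _ _ _ _ _
  have hmul := horoSize_mul_le (pos 2 3).le (pos 0 2).le (pos 1 3).le (pos 0 3).le
    (pos 1 2).le (tri 0 1 2) (tri 0 1 3)
    (by have := tri 2 3 0; rwa [comm 2 0, comm 3 0] at this)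
    (by have := tri 2 3 1; rwa [comm 2 1, comm 3 1] at this)
  have h4 : Real.logb 2 4 = 2 := by
    rw [show (4 : ℝ) = 2 ^ (2 : ℝ) by norm_num, Real.logb_rpow two_pos (by norm_num)]
  have hlog : ∀ {A B : ℝ}, 0 < A → 0 < B → S 0 1 * S 2 3 ≤ 4 * (A * B) →
      Real.logb 2 (S 0 1) + Real.logb 2 (S 2 3) ≤ 2 + Real.logb 2 A + Real.logb 2 B := by
    intro A B hA hB h
    have := Real.logb_le_logb_of_le one_lt_two (mul_pos (pos 0 1) (pos 2 3)) h
    rw [Real.logb_mul (pos 0 1).ne' (pos 2 3).ne', Real.logb_mul (by norm_num) (by positivity),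
      Real.logb_mul hA.ne' hB.ne', h4] at this
    linarith
  have u1 := up 0 1
  have u2 := up 2 3
  rcases max_choice (S 0 2 * S 1 3) (S 0 3 * S 1 2) with h | h <;> rw [h] at hmul
  · have h1 := hlog (pos 0 2) (pos 1 3) hmul
    have l1 := lo 0 2
    have l2 := lo 1 3
    refine le_trans ?_ (add_le_add_left (le_max_left _ _) _)
    linarith
  · have h1 := hlog (pos 0 3) (pos 1 2) hmul
    have l1 := lo 0 3
    have l2 := lo 1 2
    refine le_trans ?_ (add_le_add_left (le_max_right _ _) _)
    linarith

/-- A vertical ray of a horoball eventually has Gromov product with a point of the horoball at least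
half of the distance of that point: all points of a horoball converge to its center. -/
theorem eventually_le_gromovProd_ray (k : K) (x y w : N k) (a : ℝ≥0) :
    ∀ᶠ j : ℕ in atTop, dist (ray k x 0 : PreAug N) (ray k y a) / 2 - 10 ≤
      gromovProd (ray k x 0 : PreAug N) (ray k y a) (ray k w j) := by
  have hlim : Tendsto (fun j : ℕ => (2 : ℝ) ^ j) atTop atTop :=
    tendsto_pow_atTop_atTop_of_one_lt one_lt_two
  filter_upwards [hlim.eventually_ge_atTop (dist (y : Z) w + 4 * 2 ^ (a : ℝ))] with j hj
  have h1 := le_dist_ray_ray k k x y 0 a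
  have h2 := dist_ray_ray_le k x y 0 a
  have h3 := le_dist_ray_ray k k x w 0 (j : ℝ≥0)
  have h4 := dist_ray_ray_le k y w a (j : ℝ≥0)
  simp only [NNReal.coe_zero, NNReal.coe_natCast] at h1 h2 h3 h4
  have h5 : (j : ℝ) + 2 ≤ Real.logb 2 (horoSize (dist (x : Z) w) 0 j) := by
    rw [Real.le_logb_iff_rpow_le one_lt_two (horoSize_pos dist_nonneg _ _),
      Real.rpow_add two_pos, Real.rpow_natCast]
    have : 0 ≤ dist (x : Z) w := dist_nonneg
    unfold horoSize
    rw [Real.rpow_zero, Real.rpow_natCast]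
    norm_num
    linarith
  have h6 : Real.logb 2 (horoSize (dist (y : Z) w) a j) ≤ (j : ℝ) + 3 := by
    rw [Real.logb_le_iff_le_rpow one_lt_two (horoSize_pos dist_nonneg _ _),
      Real.rpow_add two_pos, Real.rpow_natCast]
    unfold horoSize
    rw [Real.rpow_natCast]
    have : (0 : ℝ) < 2 ^ j := by positivity
    norm_num
    linarith
  have ha : (0 : ℝ) ≤ a := a.2
  unfold gromovProd
  linarith

/-- A point at height `h` is at distance at least `h` from every other horoball: the height function
of its horoball, extended by zero, is `1`-Lipschitz. -/
theorem le_dist_of_ne {A : Set Z} {k j : K} (hjk : j ≠ k) (x : N j) (h : ℝ≥0) {q : PreAug N}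
    (hq : InHoroball A k q) : (h : ℝ) ≤ dist (ray j x h) q := by
  classical
  have h1 := abs_interpolate_sub_le_dist (N := N) (f := fun _ => 0)
    (g := fun i _ h => if i = j then h else 0) (by simp)
    (by intro i _ h h' _ _; split_ifs <;> simp)
    (by intro i x; simp) (by intro i l x y _ _; simp) (ray j x h) q
  refine le_trans ?_ h1
  have h2 : interpolate (fun _ => 0) (fun i _ h => if i = j then h else 0) q = 0 := by
    cases q with
    | base z => rfl
    | ray i y h' => have hq : i = k := hq; subst hq; simp [interpolate, hjk.symm]
    | edge i l y y' _ _ _ t => have hq : i = k := hq; subst hq; simp [interpolate, hjk.symm]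
  rw [h2]
  simp [interpolate]

/-- A horizontal edge is at distance at least one from every other horoball; the reason is the same as
in `le_dist_of_ne`. -/
theorem one_le_dist_edge {A : Set Z} {k j : K} (hjk : j ≠ k) {l : ℕ} {x y : N j} {hl : 1 ≤ l}
    {hpos : 0 < dist (x : Z) y} {hle : dist (x : Z) y ≤ 2 ^ l} {t : unitInterval} {q : PreAug N}
    (hq : InHoroball A k q) : 1 ≤ dist (edge j l x y hl hpos hle t) q := by
  classical
  have h1 := abs_interpolate_sub_le_dist (N := N) (f := fun _ => 0)
    (g := fun i _ h => if i = j then h else 0) (by simp)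
    (by intro i _ h h' _ _; split_ifs <;> simp)
    (by intro i x; simp) (by intro i l x y _ _; simp) (edge j l x y hl hpos hle t) q
  refine le_trans ?_ h1
  have h2 : interpolate (fun _ => 0) (fun i _ h => if i = j then h else 0) q = 0 := by
    cases q with
    | base z => rfl
    | ray i y h' => have hq : i = k := hq; subst hq; simp [interpolate, hjk.symm]
    | edge i l y y' _ _ _ t => have hq : i = k := hq; subst hq; simp [interpolate, hjk.symm]
  have h3 : interpolate (fun _ => 0) (fun i _ h => if i = j then h else 0)
      (edge j l x y hl hpos hle t) = l := by simp [interpolate]; ring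
  rw [h2, h3]
  simpa using hl

/-- A point of `Z` far from `A` is far from the horoball over a subset of `A`. The test function is a
bump at `z`, continued along the vertical rays so that it fades out at height one and vanishes on
all horizontal edges. -/
theorem min_one_infDist_le_dist {A : Set Z} {k : K} (hNA : N k ⊆ A) (z : Z) {q : PreAug N}
    (hq : InHoroball A k q) : min 1 (Metric.infDist z A) ≤ dist (base z) q := by
  set f : Z → ℝ := fun z' => max (1 - dist z z') 0
  have hf0 : ∀ z', 0 ≤ f z' := fun _ => le_max_right _ _
  have hf1 : ∀ z', f z' ≤ 1 := fun z' =>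
    max_le (by linarith [dist_nonneg (x := z) (y := z')]) zero_le_one
  have hfL : ∀ z' z'', |f z' - f z''| ≤ dist z' z'' := fun z' z'' => by
    refine (abs_max_sub_max_le_abs _ _ _).trans ?_
    rw [sub_sub_sub_cancel_left]
    rw [abs_sub_comm]
    exact dist_dist_dist_le_right z z' z''
  have hfA : ∀ z' ∈ A, f z' ≤ 1 - min 1 (Metric.infDist z A) := fun z' hz' => by
    refine max_le ?_ (by linarith [min_le_left 1 (Metric.infDist z A)])
    linarith [min_le_right 1 (Metric.infDist z A), Metric.infDist_le_dist_of_mem hz' (x := z)]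
  have h1 := abs_interpolate_sub_le_dist (N := N) (f := f) (g := fun i x h => max (1 - h) 0 * f x) hfL
    (by
      intro i x h h' _ _
      rw [← sub_mul, abs_mul, abs_of_nonneg (hf0 _)]
      refine (mul_le_of_le_one_right (abs_nonneg _) (hf1 _)).trans ?_
      refine (abs_max_sub_max_le_abs _ _ _).trans ?_
      rw [sub_sub_sub_cancel_left, abs_sub_comm])
    (by intro i x; simp)
    (by
      intro i l x y hl _
      have : (1 : ℝ) ≤ l := by exact_mod_cast hl
      rw [max_eq_right (by linarith)]; simp) (base z) q
  refine le_trans ?_ ((le_abs_self _).trans h1)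
  have h2 : interpolate f (fun i x h => max (1 - h) 0 * f x) (base z : PreAug N) = 1 := by
    simp [interpolate, f]
  rw [h2, le_sub_comm]
  cases q with
  | base z' => exact hfA z' hq
  | ray i y h' =>
    have hq : i = k := hq
    subst hq
    simp only [interpolate]
    refine le_trans ?_ (hfA y (hNA y.2))
    exact mul_le_of_le_one_left (hf0 _) (max_le (by linarith [h'.coe_nonneg]) zero_le_one)
  | edge i l y y' hl _ _ t =>
    have : (1 : ℝ) ≤ l := by exact_mod_cast hl
    simp only [interpolate]
    rw [max_eq_right (by linarith)]
    simp

theorem exists_ray_near {A : Set Z} {k : K} (hA : IsLatticeOf A (N k)) {p : PreAug N}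
    (hp : InHoroball A k p) : ∃ (x : N k) (h : ℝ≥0), dist p (ray k x h) ≤ 2 := by
  cases p with
  | base z =>
    obtain ⟨y, hy, hzy⟩ := hA.dense z hp
    refine ⟨⟨y, hy⟩, 0, ?_⟩
    have h1 := dist_triangle_right (base z : PreAug N) (ray k ⟨y, hy⟩ 0) (base y)
    rw [dist_foot k ⟨y, hy⟩] at h1
    have h2 := dist_base_le (N := N) z y
    linarith
  | ray j x h =>
    have hp : j = k := hp
    subst hp
    exact ⟨x, h, by simp⟩
  | edge j l x y hl hpos hle t =>
    have hp : j = k := hp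
    subst hp
    exact ⟨x, l, (dist_edge_ray_le _ _ _ _ _ _ _ _).trans one_le_two⟩

theorem exists_ray_near_base {A : Set Z} {k : K} (hA : IsLatticeOf A (N k)) {z : Z}
    (hz : z ∈ A) : ∃ x : N k, dist (base z : PreAug N) (ray k x 0) ≤ 2 := by
  obtain ⟨y, hy, hzy⟩ := hA.dense z hz
  refine ⟨⟨y, hy⟩, ?_⟩
  have h1 := dist_triangle_right (base z : PreAug N) (ray k ⟨y, hy⟩ 0) (base y)
  rw [dist_foot k ⟨y, hy⟩] at h1
  have h2 := dist_base_le (N := N) z y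
  linarith

/-- The four-point condition in a metric horoball. -/
theorem four_point_horoball {A : Set Z} {k : K} (hA : IsLatticeOf A (N k)) {p : Fin 4 → PreAug N}
    (hp : ∀ i, InHoroball A k (p i)) :
    dist (p 0) (p 1) + dist (p 2) (p 3) ≤
      max (dist (p 0) (p 2) + dist (p 1) (p 3)) (dist (p 0) (p 3) + dist (p 1) (p 2)) + 40 := by
  choose x h hd using fun i => exists_ray_near hA (hp i)
  have h1 := four_point_ray k x h
  set r : Fin 4 → PreAug N := fun i => ray k (x i) (h i)
  have key : ∀ i j, |dist (p i) (p j) - dist (r i) (r j)| ≤ 4 := fun i j => by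
    have := dist_dist_dist_le (p i) (p j) (r i) (r j)
    rw [Real.dist_eq] at this
    linarith [hd i, hd j]
  have k01 := abs_le.1 (key 0 1)
  have k23 := abs_le.1 (key 2 3)
  have k02 := abs_le.1 (key 0 2)
  have k13 := abs_le.1 (key 1 3)
  have k03 := abs_le.1 (key 0 3)
  have k12 := abs_le.1 (key 1 2)
  have h2 : dist (r 0) (r 1) + dist (r 2) (r 3) ≤
      max (dist (r 0) (r 2) + dist (r 1) (r 3)) (dist (r 0) (r 3) + dist (r 1) (r 2)) + 22 := h1
  have m1 := le_max_left (dist (p 0) (p 2) + dist (p 1) (p 3)) (dist (p 0) (p 3) + dist (p 1) (p 2))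
  have m2 := le_max_right (dist (p 0) (p 2) + dist (p 1) (p 3)) (dist (p 0) (p 3) + dist (p 1) (p 2))
  rcases max_choice (dist (r 0) (r 2) + dist (r 1) (r 3)) (dist (r 0) (r 3) + dist (r 1) (r 2))
    with h3 | h3 <;> rw [h3] at h2 <;> linarith

theorem eventually_le_gromovProd_horoball {A : Set Z} {k : K} (hA : IsLatticeOf A (N k)) {z : Z}
    (hz : z ∈ A) {p : PreAug N} (hp : InHoroball A k p) (w : N k) :
    ∀ᶠ j : ℕ in atTop, dist (base z) p / 2 - 16 ≤ gromovProd (base z) p (ray k w j) := by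
  obtain ⟨x, hx⟩ := exists_ray_near_base hA hz
  obtain ⟨y, a, hy⟩ := exists_ray_near hA hp
  filter_upwards [eventually_le_gromovProd_ray k x y w a] with j hj
  have h1 := abs_le.1 (abs_gromovProd_sub_le (base z) (ray k x 0) p (ray k w j))
  have h2 : |gromovProd (ray k x 0) p (ray k w j) -
      gromovProd (ray k x 0 : PreAug N) (ray k y a) (ray k w j)| ≤ 2 := by
    have e1 := abs_le.1 ((abs_dist_sub_le p (ray k y a : PreAug N) (ray k x 0)).trans hy)
    have e2 := abs_le.1 ((abs_dist_sub_le p (ray k y a : PreAug N) (ray k w j)).trans hy)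
    unfold gromovProd
    rw [dist_comm (ray k x 0 : PreAug N) p, dist_comm (ray k x 0 : PreAug N) (ray k y a), abs_le]
    constructor <;> linarith
  have h2 := abs_le.1 h2
  have h3 := dist_triangle4 (base z) (ray k x 0) (ray k y a) p
  rw [dist_comm (ray k y a) p] at h3
  linarith

end PreAug

/-- The point of the augmented space given by a point of a piece. -/
noncomputable def AugSpace.mk {Z : Type*} [MetricSpace Z] {K : Type*} {N : K → Set Z} (p : PreAug N) :
    AugSpace N := SeparationQuotient.mk p

namespace AugSpace

variable {Z : Type*} [MetricSpace Z] {K : Type*} {N : K → Set Z}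

theorem mk_surjective : Function.Surjective (mk : PreAug N → AugSpace N) :=
  SeparationQuotient.surjective_mk

theorem dist_mk (p q : PreAug N) : dist (mk p) (mk q) = dist p q := rfl

theorem mk_eq_mk {p q : PreAug N} : mk p = mk q ↔ dist p q = 0 := by
  rw [← dist_mk, dist_eq_zero]

end AugSpace

theorem isClosed_horoball {Z : Type*} [MetricSpace Z] {K : Type*} {N : K → Set Z} {A : Set Z}
    {k : K} (hA : IsClosed A) (hAN : IsLatticeOf A (N k)) : IsClosed (horoball N A k) := by
  rw [← isOpen_compl_iff, Metric.isOpen_iff]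
  intro p hp
  obtain ⟨p, rfl⟩ := AugSpace.mk_surjective p
  suffices H : ∃ ε > 0, ∀ q : PreAug N, q.InHoroball A k → ε ≤ dist p q by
    obtain ⟨ε, hε, H⟩ := H
    refine ⟨ε, hε, ?_⟩
    rintro _ hq ⟨q, hqA, rfl⟩
    have h1 := H q hqA
    change dist (AugSpace.mk q) (AugSpace.mk p) < ε at hq
    rw [dist_comm, AugSpace.dist_mk] at hq
    exact absurd hq (not_lt.2 h1)
  have hbase : ∀ z : Z, z ∉ A → ∃ ε > 0, ∀ q : PreAug N, q.InHoroball A k →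
      ε ≤ dist (.base z) q := by
    intro z hz
    by_cases hne : A.Nonempty
    · refine ⟨min 1 (Metric.infDist z A), lt_min one_pos
        ((hA.notMem_iff_infDist_pos hne).1 hz), fun q hq => ?_⟩
      exact PreAug.min_one_infDist_le_dist hAN.subset z hq
    · refine ⟨1, one_pos, fun q hq => absurd ?_ hne⟩
      cases q with
      | base z => exact ⟨z, hq⟩
      | ray j x h =>
        have hq : j = k := hq
        subst hq
        exact ⟨x, hAN.subset x.2⟩
      | edge j l x y hl hpos hle t =>
        have hq : j = k := hq
        subst hq
        exact ⟨x, hAN.subset x.2⟩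
  cases p with
  | base z => exact hbase z fun hz => hp ⟨_, hz, rfl⟩
  | ray j x h =>
    have hjk : j ≠ k := fun hjk => hp ⟨_, hjk, rfl⟩
    rcases eq_or_lt_of_le (zero_le : 0 ≤ h) with rfl | hh
    · have hx : (x : Z) ∉ A := fun hx => hp ⟨.base x, hx,
        AugSpace.mk_eq_mk.2 (by rw [dist_comm, PreAug.dist_foot])⟩
      obtain ⟨ε, hε, H⟩ := hbase x hx
      refine ⟨ε, hε, fun q hq => (H q hq).trans ?_⟩
      have := dist_triangle_left (.base x) q (.ray j x 0)
      rw [PreAug.dist_foot] at this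
      linarith
    · exact ⟨h, hh, fun q hq => PreAug.le_dist_of_ne hjk x h hq⟩
  | edge j l x y hl hpos hle t =>
    have hjk : j ≠ k := fun hjk => hp ⟨_, hjk, rfl⟩
    exact ⟨1, one_pos, fun q hq => PreAug.one_le_dist_edge hjk hq⟩

/-! ### Cut points of a tree of spaces -/

theorem eq_or_adj_of_mem_component {Z K L : Type*} {G : SimpleGraph (K ⊕ L)}
    {ξ : Z → GraphRealization G} {k : K} {z : Z} (hz : z ∈ component ξ k) {w : K ⊕ L}
    (hw : 0 < (ξ z).1 w) : w = Sum.inl k ∨ G.Adj (Sum.inl k) w :=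
  GraphRealization.eq_or_adj_of_mem_star hz hw

namespace IsTreeOfSpaces

variable {Z : Type*} [MetricSpace Z] {K L : Type*} {G : SimpleGraph (K ⊕ L)}
  {ξ : Z → GraphRealization G}

/-- The point of `Z` over the vertex `l`. -/
noncomputable def cut (hT : IsTreeOfSpaces ξ) (l : L) : Z := (hT.fiber l).choose

theorem eq_vertex_iff (hT : IsTreeOfSpaces ξ) {l : L} {z : Z} :
    ξ z = GraphRealization.vertex G (Sum.inr l) ↔ z = hT.cut l := by
  have := (hT.fiber l).choose_spec
  exact (Set.ext_iff.1 this z)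

theorem eq_cut (hT : IsTreeOfSpaces ξ) {l : L} {z : Z} (h : ∀ w, w ≠ Sum.inr l → (ξ z).1 w = 0) :
    z = hT.cut l :=
  hT.eq_vertex_iff.1 (GraphRealization.eq_vertex _ h)

/-- The part of `Z` that lies over the vertices in `C`. -/
def partOver (ξ : Z → GraphRealization G) (C : Set (K ⊕ L)) : Set Z :=
  {z | ∃ v ∈ C, 0 < (ξ z).1 v}

theorem isOpen_partOver (hT : IsTreeOfSpaces ξ) (C : Set (K ⊕ L)) : IsOpen (partOver ξ C) := by
  have : partOver ξ C = ⋃ v ∈ C, {z | 0 < (ξ z).1 v} := by ext z; simp [partOver]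
  rw [this]
  exact isOpen_biUnion fun v _ =>
    isOpen_lt continuous_const ((GraphRealization.continuous_apply v).comp hT.continuous)

/-- The point over `l` separates the branches of the tree at `l`: a geodesic is connected, and its
image in the tree cannot pass from a branch to the others without meeting `l`. -/
theorem dist_eq_of_mem_partOver (hT : IsTreeOfSpaces ξ) {l : L} {k : K}
    (h : G.Adj (Sum.inl k) (Sum.inr l)) {z z' : Z}
    (hz : z ∈ partOver ξ (treeBranch G (Sum.inr l) (Sum.inl k)))
    (hz' : z' ∉ partOver ξ (treeBranch G (Sum.inr l) (Sum.inl k))) :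
    dist z z' = dist z (hT.cut l) + dist (hT.cut l) z' := by
  set C := treeBranch G (Sum.inr l) (Sum.inl k)
  obtain ⟨g, hg0, hg1, hg⟩ := hT.geodesic z z'
  suffices H : ∃ t ∈ Icc (0 : ℝ) 1, g t = hT.cut l by
    obtain ⟨t, ht, hgt⟩ := H
    have h1 := hg 0 (by simp) t ht
    have h2 := hg t ht 1 (by simp)
    rw [hg0, hgt, zero_sub, abs_neg, abs_of_nonneg ht.1] at h1
    rw [hg1, hgt, abs_sub_comm, abs_of_nonneg (sub_nonneg.2 ht.2)] at h2
    rw [h1, h2]; ring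
  -- Otherwise the image of the geodesic is covered by two disjoint open parts of `Z`.
  by_contra! H
  have hcont : ContinuousOn g (Icc 0 1) := by
    refine (LipschitzOnWith.of_dist_le_mul (K := ⟨dist z z', dist_nonneg⟩) ?_).continuousOn
    intro s hs t ht
    rw [hg s hs t ht, Real.dist_eq, mul_comm]
    exact le_rfl
  have hcover : g '' Icc 0 1 ⊆ partOver ξ C ∪ partOver ξ {v | v ∉ C ∧ v ≠ Sum.inr l} := by
    rintro _ ⟨t, ht, rfl⟩
    by_contra hn
    rw [mem_union, not_or] at hn
    refine H t ht (hT.eq_cut fun w hw => ?_)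
    by_contra hne
    have hpos := lt_of_le_of_ne (GraphRealization.nonneg (ξ (g t)) w) (Ne.symm hne)
    by_cases hwC : w ∈ C
    · exact hn.1 ⟨w, hwC, hpos⟩
    · exact hn.2 ⟨w, ⟨hwC, hw⟩, hpos⟩
  have hconn : IsPreconnected (g '' Icc 0 1) := isPreconnected_Icc.image g hcont
  obtain ⟨x, -, ⟨v, hv, hxv⟩, ⟨w, hw, hxw⟩⟩ := hconn _ _ (hT.isOpen_partOver C)
    (hT.isOpen_partOver {v | v ∉ C ∧ v ≠ Sum.inr l}) hcover
    ⟨z, ⟨0, by simp, hg0⟩, hz⟩ ⟨z', ⟨1, by simp, hg1⟩, by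
      have : z' ∈ g '' Icc 0 1 := ⟨1, by simp, hg1⟩
      exact (hcover this).resolve_left hz'⟩
  have hvw : v ≠ w := by rintro rfl; exact hw.1 hv
  exact hw.2 (treeBranch.exit hT.tree h hv hw.1 (GraphRealization.adj_of_pos _ hvw hxv hxw)).2

theorem adj_of_cut_mem_component (hT : IsTreeOfSpaces ξ) {k : K} {l : L}
    (h : hT.cut l ∈ component ξ k) : G.Adj (Sum.inl k) (Sum.inr l) := by
  classical
  refine (eq_or_adj_of_mem_component h (w := Sum.inr l) ?_).resolve_left (by simp)
  rw [hT.eq_vertex_iff.2 rfl, GraphRealization.vertex_apply]; simp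

theorem cut_mem_component (hT : IsTreeOfSpaces ξ) {k : K} {l : L}
    (h : G.Adj (Sum.inl k) (Sum.inr l)) : hT.cut l ∈ component ξ k := by
  change ξ (hT.cut l) ∈ GraphRealization.star G (Sum.inl k)
  rw [hT.eq_vertex_iff.2 rfl]
  exact GraphRealization.vertex_mem_star h

theorem exists_adj_inl (hT : IsTreeOfSpaces ξ) [Nonempty K] (l : L) :
    ∃ k, G.Adj (Sum.inl k) (Sum.inr l) := by
  obtain ⟨k⟩ := ‹Nonempty K›
  obtain ⟨w, hw, -⟩ := treeBranch.exists_mem (v := Sum.inl k) (l := Sum.inr l) hT.tree (by simp)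
  cases w with
  | inl k => exact ⟨k, hw⟩
  | inr l' => exact (hT.bipartite_right _ _ hw).elim

theorem exists_mem_component (hT : IsTreeOfSpaces ξ) [Nonempty K] (z : Z) :
    ∃ k, z ∈ component ξ k := by
  obtain ⟨w, hw⟩ := GraphRealization.exists_pos (ξ z)
  by_cases h : ∃ k, 0 < (ξ z).1 (Sum.inl k)
  · obtain ⟨k, hk⟩ := h
    exact ⟨k, GraphRealization.mem_star_of_pos hk⟩
  · cases w with
    | inl k => exact (h ⟨k, hw⟩).elim
    | inr l =>
      obtain ⟨k, hk⟩ := hT.exists_adj_inl l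
      refine ⟨k, ?_⟩
      have : z = hT.cut l := hT.eq_cut fun w' hw' => by
        by_contra hne
        have hpos := lt_of_le_of_ne (GraphRealization.nonneg (ξ z) w') (Ne.symm hne)
        cases w' with
        | inl k => exact h ⟨k, hpos⟩
        | inr l' => exact hT.bipartite_right _ _ (GraphRealization.adj_of_pos _ hw' hpos hw)
      rw [this]
      exact hT.cut_mem_component hk

theorem isClosed_component (hT : IsTreeOfSpaces ξ) (k : K) : IsClosed (component ξ k) := by
  have : component ξ k = (partOver ξ {w | w ≠ Sum.inl k ∧ ¬ G.Adj (Sum.inl k) w})ᶜ := by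
    ext z
    constructor
    · rintro hz ⟨w, ⟨h1, h2⟩, hw⟩
      exact (eq_or_adj_of_mem_component hz hw).elim h1 h2
    · intro hz
      by_cases hk : 0 < (ξ z).1 (Sum.inl k)
      · exact GraphRealization.mem_star_of_pos hk
      · have hmem : ∀ w, 0 < (ξ z).1 w → G.Adj (Sum.inl k) w := by
          intro w hw
          by_contra h
          exact hz ⟨w, ⟨by rintro rfl; exact hk hw, h⟩, hw⟩
        obtain ⟨w, hw⟩ := GraphRealization.exists_pos (ξ z)
        have hadj := hmem w hw
        cases w with
        | inl k' => exact (hT.bipartite_left _ _ hadj).elim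
        | inr l =>
          have : z = hT.cut l := hT.eq_cut fun w' hw' => by
            by_contra hne
            have hpos := lt_of_le_of_ne (GraphRealization.nonneg (ξ z) w') (Ne.symm hne)
            cases w' with
            | inl k' => exact hT.bipartite_left _ _ (hmem _ hpos)
            | inr l' => exact hT.bipartite_right _ _ (GraphRealization.adj_of_pos _ hw' hpos hw)
          rw [this]
          exact hT.cut_mem_component hadj
  rw [this]
  exact (hT.isOpen_partOver _).isClosed_compl

theorem mem_partOver_or_eq_cut (hT : IsTreeOfSpaces ξ) {l : L} {j k : K}
    (h : G.Adj (Sum.inl k) (Sum.inr l)) (hj : Sum.inl j ∈ treeBranch G (Sum.inr l) (Sum.inl k))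
    {z : Z} (hz : z ∈ component ξ j) :
    z ∈ partOver ξ (treeBranch G (Sum.inr l) (Sum.inl k)) ∨ z = hT.cut l := by
  by_cases hpos : 0 < (ξ z).1 (Sum.inl j)
  · exact Or.inl ⟨_, hj, hpos⟩
  · obtain ⟨w, hw, hzw⟩ := GraphRealization.exists_eq_vertex_of_mem_star hz
      (le_antisymm (not_lt.1 hpos) (GraphRealization.nonneg _ _))
    by_cases hwC : w ∈ treeBranch G (Sum.inr l) (Sum.inl k)
    · classical
      refine Or.inl ⟨w, hwC, ?_⟩
      rw [hzw, GraphRealization.vertex_apply]; simp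
    · obtain ⟨-, rfl⟩ := treeBranch.exit hT.tree h hj hwC hw
      exact Or.inr (hT.eq_vertex_iff.1 hzw)

theorem notMem_partOver (hT : IsTreeOfSpaces ξ) {l : L} {j k : K}
    (h : G.Adj (Sum.inl k) (Sum.inr l)) (hj : Sum.inl j ∉ treeBranch G (Sum.inr l) (Sum.inl k))
    {z : Z} (hz : z ∈ component ξ j) : z ∉ partOver ξ (treeBranch G (Sum.inr l) (Sum.inl k)) := by
  rintro ⟨v, hv, hpos⟩
  rcases eq_or_adj_of_mem_component hz hpos with rfl | hadj
  · exact hj hv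
  · exact absurd (treeBranch.exit hT.tree h hv hj hadj.symm).2 (by simp)

section Aug

variable {N : K → Set Z}

/-- The pieces of the augmented space that lie over the vertices in `C`. -/
def PieceOver (ξ : Z → GraphRealization G) (C : Set (K ⊕ L)) : PreAug N → Prop
  | .base z => z ∈ partOver ξ C
  | .ray j _ _ => Sum.inl j ∈ C
  | .edge j _ _ _ _ _ _ _ => Sum.inl j ∈ C

/-- The points over `l` are cut points of the augmented space as well: the distance to the cut
point, taken with different signs on the two sides, is a `1`-Lipschitz function. -/
theorem dist_eq_of_inHoroball (hT : IsTreeOfSpaces ξ) (hN : ∀ k, IsLatticeOf (component ξ k) (N k))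
    {l : L} {k i j : K} (h : G.Adj (Sum.inl k) (Sum.inr l)) {p q : PreAug N}
    (hp : p.InHoroball (component ξ i) i) (hi : Sum.inl i ∈ treeBranch G (Sum.inr l) (Sum.inl k))
    (hq : q.InHoroball (component ξ j) j) (hj : Sum.inl j ∉ treeBranch G (Sum.inr l) (Sum.inl k)) :
    dist p q = dist p (.base (hT.cut l)) + dist (.base (hT.cut l)) q := by
  classical
  set C := treeBranch G (Sum.inr l) (Sum.inl k) with hC
  set c : PreAug N := .base (hT.cut l) with hc
  have hpC : PieceOver ξ C p ∨ dist p c = 0 := by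
    cases p with
    | base z =>
      refine (hT.mem_partOver_or_eq_cut h hi hp).imp id fun hz => ?_
      rw [hz, hc, dist_self]
    | ray i' x a => have hp : i' = i := hp; subst hp; exact Or.inl hi
    | edge i' l x y _ _ _ t => have hp : i' = i := hp; subst hp; exact Or.inl hi
  have hqC : ¬ PieceOver ξ C q := by
    cases q with
    | base z => exact hT.notMem_partOver h hj hq
    | ray i' x a => have hq : i' = j := hq; subst hq; exact hj
    | edge i' l x y _ _ _ t => have hq : i' = j := hq; subst hq; exact hj
  -- The signed distance to the cut point; only the pieces inside `Z` can change the sign.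
  set F : PreAug N → ℝ := fun p => if PieceOver ξ C p then dist p c else -dist p c with hF
  have same : ∀ {p q : PreAug N} {r : ℝ}, ChainJoined N p q r →
      (PieceOver ξ C p ↔ PieceOver ξ C q) → |F p - F q| ≤ r := by
    intro p q r hr hpq
    refine le_trans ?_ (PreAug.dist_le hr)
    by_cases hq : PieceOver ξ C q
    · simp only [hF, if_pos hq, if_pos (hpq.2 hq)]
      exact abs_dist_sub_le p q c
    · simp only [hF, if_neg hq, if_neg fun h => hq (hpq.1 h)]
      rw [← neg_sub', abs_neg]
      exact abs_dist_sub_le p q c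
  have opp : ∀ z z', z ∈ partOver ξ C → z' ∉ partOver ξ C → |F (.base z) - F (.base z')| ≤ dist z z' := by
    intro z z' hz hz'
    have e1 : F (.base z) = dist (.base z) c := if_pos hz
    have e2 : F (.base z') = -dist (.base z') c := if_neg hz'
    rw [e1, e2, sub_neg_eq_add, abs_of_nonneg (add_nonneg dist_nonneg dist_nonneg),
      hT.dist_eq_of_mem_partOver h hz hz', dist_comm (hT.cut l) z']
    exact add_le_add (PreAug.dist_base_le _ _) (PreAug.dist_base_le _ _)
  have key : ∀ {p q : PreAug N} {r : ℝ}, ChainJoined N p q r → |F p - F q| ≤ r := by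
    intro p q r hr
    induction hr with
    | base z z' =>
      by_cases hz : z ∈ partOver ξ C <;> by_cases hz' : z' ∈ partOver ξ C
      · exact same (.base z z') (iff_of_true hz hz')
      · exact opp z z' hz hz'
      · rw [abs_sub_comm, dist_comm]; exact opp z' z hz' hz
      · exact same (.base z z') (iff_of_false hz hz')
    | ray k x a b => exact same (.ray k x a b) Iff.rfl
    | edge k l x y hl hpos hle t t' => exact same (.edge k l x y hl hpos hle t t') Iff.rfl
    | foot k' x =>
      by_cases hk : Sum.inl k' ∈ C
      · rcases hT.mem_partOver_or_eq_cut h hk ((hN k').subset x.2) with hx | hx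
        · exact same (.foot k' x) (iff_of_true hk hx)
        · have h0 := PreAug.dist_foot (N := N) k' x
          have e1 : F (.ray k' x 0) = 0 := by
            have : F (.ray k' x 0) = dist (.ray k' x 0) c := if_pos hk
            rw [this, hc, ← hx, h0]
          have e2 : F (.base x) = 0 := by
            have : dist (.base (x : Z)) c = 0 := by rw [hx, hc, dist_self]
            simp only [hF, this, neg_zero, ite_self]
          rw [e1, e2]; simp
      · exact same (.foot k' x) (iff_of_false hk (hT.notMem_partOver h hk ((hN k').subset x.2)))
    | corner k l x y hl hpos hle => exact same (.corner k l x y hl hpos hle) Iff.rfl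
    | flip k l x y hl hpos hle hpos' hle' t =>
      exact same (.flip k l x y hl hpos hle hpos' hle' t) Iff.rfl
    | symm _ ih => rwa [abs_sub_comm]
    | trans _ _ ih ih' => exact (abs_sub_le _ _ _).trans (add_le_add ih ih')
  refine le_antisymm (dist_triangle _ _ _) ?_
  rcases hpC with hpC | h0
  · refine PreAug.le_dist fun r hr => (le_abs_self _).trans' ?_ |>.trans (key hr)
    simp only [hF, if_pos hpC, if_neg hqC]
    rw [dist_comm c q]; linarith
  · rw [h0, zero_add]
    have := dist_triangle_left c q p
    linarith

theorem exists_inHoroball (hT : IsTreeOfSpaces ξ) [Nonempty K] (p : PreAug N) :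
    ∃ k, p.InHoroball (component ξ k) k := by
  cases p with
  | base z => exact hT.exists_mem_component z
  | ray j x h => exact ⟨j, rfl⟩
  | edge j l x y _ _ _ t => exact ⟨j, rfl⟩

end Aug

/-- A bounded subset of `Z` meets finitely many components of diameter at least one. A limit of points
of infinitely many components has vanishing coordinates at all vertices in `K`, so it lies over a
vertex in `L` that is adjacent to almost all of the components. Two such limits would coincide,
since distinct vertices of a tree have at most one common neighbour; but one can take two sequences
of points of the same components at distance `1 / 2` from each other. -/
theorem finite_components (hT : IsTreeOfSpaces ξ) [ProperSpace Z] (o : Z) (R : ℝ) :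
    {k | (∃ z ∈ component ξ k, dist o z ≤ R) ∧
      ∃ x ∈ component ξ k, ∃ y ∈ component ξ k, 1 ≤ dist x y}.Finite := by
  by_contra hinf
  set S := {k | (∃ z ∈ component ξ k, dist o z ≤ R) ∧
      ∃ x ∈ component ξ k, ∃ y ∈ component ξ k, 1 ≤ dist x y}
  have hpq : ∀ k ∈ S, ∃ p ∈ component ξ k, ∃ q ∈ component ξ k, dist o p ≤ R ∧
      dist p q = 1 / 2 := by
    rintro k ⟨⟨p, hp, hpR⟩, x, hx, y, hy, hxy⟩
    have : ∃ w ∈ component ξ k, 1 / 2 ≤ dist p w := by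
      by_contra! h
      have := dist_triangle_left x y p
      linarith [h x hx, h y hy]
    obtain ⟨w, hw, hpw⟩ := this
    obtain ⟨g, hg0, hg1, hg⟩ := hT.component_geodesic k ⟨p, hp⟩ ⟨w, hw⟩
    have hpos : 0 < dist p w := by linarith
    refine ⟨p, hp, g (1 / 2 / dist p w), (g _).2, hpR, ?_⟩
    have h1 := hg 0 (by simp) (1 / 2 / dist p w)
      ⟨by positivity, div_le_one_of_le₀ hpw dist_nonneg⟩
    rw [hg0, Subtype.dist_eq, Subtype.dist_eq, zero_sub, abs_neg, abs_of_nonneg (by positivity),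
      div_mul_cancel₀ _ hpos.ne'] at h1
    exact h1
  set u := Set.Infinite.natEmbedding S hinf
  have : Nonempty Z := ⟨o⟩
  choose! p hp q hq hpR hpq using hpq
  set P : ℕ → Z × Z := fun n => (p (u n), q (u n))
  have hcomp : IsCompact (Metric.closedBall o R ×ˢ Metric.closedBall o (R + 1)) :=
    (isCompact_closedBall _ _).prod (isCompact_closedBall _ _)
  obtain ⟨⟨a, b⟩, -, φ, hφ, hlim⟩ := hcomp.tendsto_subseq (x := P) fun n => by
    refine ⟨?_, ?_⟩
    · rw [Metric.mem_closedBall, dist_comm]; exact hpR _ (u n).2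
    · rw [Metric.mem_closedBall, dist_comm]
      have := dist_triangle o (p (u n)) (q (u n))
      rw [hpq _ (u n).2] at this
      change dist o (q (u n)) ≤ _
      linarith [hpR _ (u n).2]
  have hlima : Tendsto (fun n => p (u (φ n))) atTop (𝓝 a) :=
    (continuous_fst.tendsto _).comp hlim
  have hlimb : Tendsto (fun n => q (u (φ n))) atTop (𝓝 b) :=
    (continuous_snd.tendsto _).comp hlim
  -- The limits lie over vertices in `L` that are adjacent to almost all of the components.
  have key : ∀ {f : ℕ → Z} {c : Z}, (∀ n, f n ∈ component ξ (u (φ n))) → Tendsto f atTop (𝓝 c) →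
      ∃ l, c = hT.cut l ∧ ∀ᶠ n in atTop, G.Adj (Sum.inl (u (φ n) : K)) (Sum.inr l) := by
    intro f c hf hfc
    have hcoord : ∀ w, Tendsto (fun n => (ξ (f n)).1 w) atTop (𝓝 ((ξ c).1 w)) := fun w =>
      (((GraphRealization.continuous_apply w).comp hT.continuous).tendsto c).comp hfc
    have hzero : ∀ k, (ξ c).1 (Sum.inl k) = 0 := by
      intro k
      refine tendsto_nhds_unique_of_eventuallyEq (hcoord _) tendsto_const_nhds ?_
      have hfin : ∀ᶠ n in atTop, (u (φ n) : K) ≠ k := by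
        have hinj : Function.Injective fun n => (u (φ n) : K) :=
          Subtype.val_injective.comp (u.injective.comp hφ.injective)
        rw [← Nat.cofinite_eq_atTop]
        have hsub : {n | ¬ (u (φ n) : K) ≠ k}.Subsingleton := fun n hn m hm =>
          hinj ((not_not.1 hn).trans (not_not.1 hm).symm)
        exact hsub.finite
      filter_upwards [hfin] with n hn
      by_contra hne
      have hpos := lt_of_le_of_ne (GraphRealization.nonneg (ξ (f n)) (Sum.inl k)) (Ne.symm hne)
      rcases eq_or_adj_of_mem_component (hf n) hpos with h | h
      · exact hn (Sum.inl_injective h).symm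
      · exact hT.bipartite_left _ _ h
    obtain ⟨w, hw⟩ := GraphRealization.exists_pos (ξ c)
    cases w with
    | inl k => rw [hzero k] at hw; exact (lt_irrefl _ hw).elim
    | inr l =>
      refine ⟨l, hT.eq_cut fun w' hw' => ?_, ?_⟩
      · by_contra hne
        have hpos := lt_of_le_of_ne (GraphRealization.nonneg (ξ c) w') (Ne.symm hne)
        cases w' with
        | inl k => exact hne (hzero k)
        | inr l' => exact hT.bipartite_right _ _ (GraphRealization.adj_of_pos _ hw' hpos hw)
      · filter_upwards [(hcoord (Sum.inr l)).eventually (lt_mem_nhds hw)] with n hn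
        exact (eq_or_adj_of_mem_component (hf n) hn).resolve_left (by simp)
  obtain ⟨l, ha, hl⟩ := key (fun n => hp _ (u (φ n)).2) hlima
  obtain ⟨l', hb, hl'⟩ := key (fun n => hq _ (u (φ n)).2) hlimb
  have hab : dist a b = 1 / 2 := by
    refine tendsto_nhds_unique (hlima.dist hlimb) ?_
    simp only [hpq _ (u (φ _)).2]
    exact tendsto_const_nhds
  have hne : l ≠ l' := by
    rintro rfl
    rw [ha, hb, dist_self] at hab
    norm_num at hab
  obtain ⟨n, hn⟩ := eventually_atTop.1 (hl.and hl')
  have hadj : ∀ m ≥ n, (Sum.inr l' : K ⊕ L) ∈ treeBranch G (Sum.inr l) (Sum.inl (u (φ m) : K)) := by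
    intro m hm
    refine treeBranch.mem_of_adj treeBranch.self_mem (hn m hm).2 fun h => ?_
    rcases Sym2.eq_iff.1 h with h1 | h1
    · exact hne (Sum.inr_injective h1.2).symm
    · exact absurd h1.1 (by simp)
  have := treeBranch.eq_of_mem hT.tree (hn n le_rfl).1 (hn (n + 1) (by omega)).1 (hadj n le_rfl)
    (hadj (n + 1) (by omega))
  have := hφ.injective (u.injective (Subtype.val_injective (Sum.inl_injective this)))
  omega

end IsTreeOfSpaces

/-! ### Hyperbolicity of the augmented space -/

namespace IsTreeOfSpaces

variable {Z : Type*} [MetricSpace Z] {K L : Type*} {G : SimpleGraph (K ⊕ L)}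
  {ξ : Z → GraphRealization G} {N : K → Set Z}

/-- For four vertices in `K` there is a vertex `κ` in `K` such that at each neighbour `l` of `κ`
either the four vertices can be split into two pairs that are opposite at `l`, or all of them but
one lie on the side of `κ`: a vertex with minimal sum of distances. -/
theorem exists_median (hT : IsTreeOfSpaces ξ) [Nonempty K] (k : Fin 4 → K) :
    ∃ κ : K, ∀ l, G.Adj (Sum.inl κ) (Sum.inr l) →
      (∃ s : Fin 4 → K, (∀ i, G.Adj (Sum.inl (s i)) (Sum.inr l) ∧
          (Sum.inl (k i) : K ⊕ L) ∈ treeBranch G (Sum.inr l) (Sum.inl (s i))) ∧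
        (s 0 ≠ s 2 ∧ s 1 ≠ s 3 ∨ s 0 ≠ s 3 ∧ s 1 ≠ s 2)) ∨
      ∃ i₀, ∀ i, i ≠ i₀ → (Sum.inl (k i) : K ⊕ L) ∈ treeBranch G (Sum.inr l) (Sum.inl κ) := by
  set f : K → ℕ := fun κ => ∑ i, G.dist (Sum.inl (k i)) (Sum.inl κ) with hf
  refine ⟨Function.argmin f, fun l hl => ?_⟩
  set κ := Function.argmin f
  have hside : ∀ i, ∃ s : K, G.Adj (Sum.inl s) (Sum.inr l) ∧
      (Sum.inl (k i) : K ⊕ L) ∈ treeBranch G (Sum.inr l) (Sum.inl s) := by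
    intro i
    obtain ⟨w, hw, hw'⟩ := treeBranch.exists_mem (v := Sum.inl (k i)) (l := Sum.inr l) hT.tree
      (by simp)
    cases w with
    | inl s => exact ⟨s, hw, hw'⟩
    | inr l' => exact (hT.bipartite_right _ _ hw).elim
  choose s hs hs' using hside
  by_cases hopp : s 0 ≠ s 2 ∧ s 1 ≠ s 3 ∨ s 0 ≠ s 3 ∧ s 1 ≠ s 2
  · exact Or.inl ⟨s, fun i => ⟨hs i, hs' i⟩, hopp⟩
  · right
    have hmaj : ∃ i₀ σ, G.Adj (Sum.inl σ) (Sum.inr l) ∧ ∀ i, i ≠ i₀ → s i = σ := by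
      have : ∃ i₀ j, ∀ i, i ≠ i₀ → s i = s j := by
        by_cases h1 : s 0 = s 2 <;> by_cases h2 : s 0 = s 3
        · exact ⟨1, 0, by intro i hi; fin_cases i <;> simp_all⟩
        · exact ⟨3, 0, by intro i hi; fin_cases i <;> simp_all⟩
        · exact ⟨2, 0, by intro i hi; fin_cases i <;> simp_all⟩
        · have hopp : s 1 = s 3 ∧ s 1 = s 2 := by tauto
          exact ⟨0, 1, by
            intro i hi
            fin_cases i
            exacts [(hi rfl).elim, rfl, hopp.2.symm, hopp.1.symm]⟩
      obtain ⟨i₀, j, h⟩ := this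
      exact ⟨i₀, s j, hs j, h⟩
    obtain ⟨i₀, σ, hσ, hmaj⟩ := hmaj
    by_cases hσκ : σ = κ
    · subst hσκ
      exact ⟨i₀, fun i hi => hmaj i hi ▸ hs' i⟩
    · exfalso
      have hκ : (Sum.inl κ : K ⊕ L) ∉ treeBranch G (Sum.inr l) (Sum.inl σ) :=
        treeBranch.disjoint hT.tree hl hσ (fun h => hσκ (Sum.inl_injective h).symm)
          treeBranch.self_mem
      -- Moving from `κ` to `σ` brings three of the four vertices closer by two.
      have h1 : ∀ i, i ≠ i₀ →
          G.dist (Sum.inl (k i)) (Sum.inl κ) = G.dist (Sum.inl (k i)) (Sum.inl σ) + 2 := by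
        intro i hi
        have hmem := hs' i
        rw [hmaj i hi] at hmem
        rw [treeBranch.dist_eq hT.tree hσ hmem hκ, SimpleGraph.dist_eq_one_iff_adj.2 hl.symm]
      have h2 : ∀ i, G.dist (Sum.inl (k i)) (Sum.inl σ) ≤ G.dist (Sum.inl (k i)) (Sum.inl κ) + 2 := by
        intro i
        have e1 := hT.tree.connected.dist_triangle (u := Sum.inl (k i)) (v := Sum.inl κ)
          (w := Sum.inl σ)
        have e2 := hT.tree.connected.dist_triangle (u := Sum.inl κ) (v := Sum.inr l)
          (w := Sum.inl σ)
        rw [SimpleGraph.dist_eq_one_iff_adj.2 hl, SimpleGraph.dist_eq_one_iff_adj.2 hσ.symm] at e2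
        omega
      have h3 : f κ ≤ f σ := Function.argmin_le f σ
      simp only [hf, Fin.sum_univ_four] at h3
      have a0 := h1 0
      have a1 := h1 1
      have a2 := h1 2
      have a3 := h1 3
      have b := h2 i₀
      fin_cases i₀ <;> simp at a0 a1 a2 a3 b <;> omega

/-- The augmented space is hyperbolic. Four points are either separated in pairs by a cut point, and
then the four-point condition holds without error, or they can be replaced by their projections to
one metric horoball. -/
theorem four_point_preAug (hT : IsTreeOfSpaces ξ) [Nonempty K]
    (hN : ∀ k, IsLatticeOf (component ξ k) (N k)) (p : Fin 4 → PreAug N) :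
    dist (p 0) (p 1) + dist (p 2) (p 3) ≤
      max (dist (p 0) (p 2) + dist (p 1) (p 3)) (dist (p 0) (p 3) + dist (p 1) (p 2)) + 40 := by
  choose k hk using fun i => hT.exists_inHoroball (p i)
  obtain ⟨κ, hκ⟩ := hT.exists_median k
  by_cases hopp : ∃ l, G.Adj (Sum.inl κ) (Sum.inr l) ∧
      ∃ s : Fin 4 → K, (∀ i, G.Adj (Sum.inl (s i)) (Sum.inr l) ∧
          (Sum.inl (k i) : K ⊕ L) ∈ treeBranch G (Sum.inr l) (Sum.inl (s i))) ∧
        (s 0 ≠ s 2 ∧ s 1 ≠ s 3 ∨ s 0 ≠ s 3 ∧ s 1 ≠ s 2)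
  · obtain ⟨l, -, s, hs, hopp⟩ := hopp
    set c : PreAug N := .base (hT.cut l)
    have hsep : ∀ i j, s i ≠ s j → dist (p i) (p j) = dist (p i) c + dist c (p j) := by
      intro i j hij
      refine hT.dist_eq_of_inHoroball hN (hs i).1 (hk i) (hs i).2 (hk j) ?_
      exact treeBranch.disjoint hT.tree (hs j).1 (hs i).1 (fun h => hij (Sum.inl_injective h).symm)
        (hs j).2
    have t01 := dist_triangle (p 0) c (p 1)
    have t23 := dist_triangle (p 2) c (p 3)
    rw [dist_comm c] at t01 t23
    rcases hopp with ⟨h1, h2⟩ | ⟨h1, h2⟩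
    · have e1 := hsep _ _ h1
      have e2 := hsep _ _ h2
      rw [dist_comm c] at e1 e2
      have := le_max_left (dist (p 0) (p 2) + dist (p 1) (p 3)) (dist (p 0) (p 3) + dist (p 1) (p 2))
      linarith
    · have e1 := hsep _ _ h1
      have e2 := hsep _ _ h2
      rw [dist_comm c] at e1 e2
      have := le_max_right (dist (p 0) (p 2) + dist (p 1) (p 3)) (dist (p 0) (p 3) + dist (p 1) (p 2))
      linarith
  · have hmaj : ∀ l, G.Adj (Sum.inl κ) (Sum.inr l) → ∃ i₀, ∀ i, i ≠ i₀ →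
        (Sum.inl (k i) : K ⊕ L) ∈ treeBranch G (Sum.inr l) (Sum.inl κ) := fun l hl =>
      (hκ l hl).resolve_left fun h => hopp ⟨l, hl, h⟩
    -- The projection `g` of `p i` to the horoball at `κ`: geodesics from `p i` to the horoball and to
    -- the other three points pass through `g`.
    have hgate : ∀ i, ∃ g : PreAug N, g.InHoroball (component ξ κ) κ ∧
        (∀ q : PreAug N, q.InHoroball (component ξ κ) κ →
          dist (p i) q = dist (p i) g + dist g q) ∧
        ∀ j, j ≠ i → dist (p i) (p j) = dist (p i) g + dist g (p j) := by
      intro i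
      by_cases hi : k i = κ
      · exact ⟨p i, hi ▸ hk i, fun q _ => by simp, fun j _ => by simp⟩
      · obtain ⟨w, hw, hiw⟩ := treeBranch.exists_notMem (v := Sum.inl (k i)) (k := Sum.inl κ) hT.tree
          (fun h => hi (Sum.inl_injective h))
        cases w with
        | inl k' => exact (hT.bipartite_left _ _ hw).elim
        | inr l =>
          obtain ⟨i₀, hi₀⟩ := hmaj l hw
          have hii : i = i₀ := by
            by_contra h
            exact hiw (hi₀ i h)
          subst hii
          refine ⟨.base (hT.cut l), hT.cut_mem_component hw, fun q hq => ?_, fun j hj => ?_⟩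
          · have := hT.dist_eq_of_inHoroball hN hw hq treeBranch.self_mem (hk i) hiw
            rw [dist_comm, this, add_comm, dist_comm q, dist_comm (p i)]
          · have := hT.dist_eq_of_inHoroball hN hw (hk j) (hi₀ j hj) (hk i) hiw
            rw [dist_comm, this, add_comm, dist_comm (p j), dist_comm (p i)]
    choose g hg hgq hgp using hgate
    have hd : ∀ i j, i ≠ j →
        dist (p i) (p j) = dist (p i) (g i) + dist (p j) (g j) + dist (g i) (g j) := by
      intro i j hij
      rw [hgp i j hij.symm, dist_comm (g i) (p j), hgq j (g i) (hg i), dist_comm (g j) (g i)]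
      ring
    have h4 := PreAug.four_point_horoball (hN κ) hg
    rw [hd 0 1 (by decide), hd 2 3 (by decide), hd 0 2 (by decide), hd 1 3 (by decide),
      hd 0 3 (by decide), hd 1 2 (by decide)]
    rcases max_choice (dist (g 0) (g 2) + dist (g 1) (g 3)) (dist (g 0) (g 3) + dist (g 1) (g 2))
      with h | h <;> rw [h] at h4
    · refine le_trans ?_ (add_le_add_left (le_max_left _ _) _)
      linarith
    · refine le_trans ?_ (add_le_add_left (le_max_right _ _) _)
      linarith

theorem fourPoint_augSpace (hT : IsTreeOfSpaces ξ) [Nonempty K]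
    (hN : ∀ k, IsLatticeOf (component ξ k) (N k)) : FourPoint (AugSpace N) 40 := by
  intro a b c d
  obtain ⟨a, rfl⟩ := AugSpace.mk_surjective a
  obtain ⟨b, rfl⟩ := AugSpace.mk_surjective b
  obtain ⟨c, rfl⟩ := AugSpace.mk_surjective c
  obtain ⟨d, rfl⟩ := AugSpace.mk_surjective d
  exact hT.four_point_preAug hN ![a, b, c, d]

end IsTreeOfSpaces

/-! ### Geodesics -/

/-- There is a `1`-Lipschitz path from `p` to `q` that takes time `r`. -/
def ShortPath {X : Type*} [MetricSpace X] (p q : X) (r : ℝ) : Prop :=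
  ∃ f : ℝ → X, LipschitzWith 1 f ∧ (∀ t ≤ 0, f t = p) ∧ ∀ t ≥ r, f t = q

namespace ShortPath

variable {X : Type*} [MetricSpace X] {p q m : X} {r s : ℝ}

theorem refl (p : X) : ShortPath p p 0 :=
  ⟨fun _ => p, LipschitzWith.const' p, fun _ _ => rfl, fun _ _ => rfl⟩

theorem symm (h : ShortPath p q r) : ShortPath q p r := by
  obtain ⟨f, hf, h0, h1⟩ := h
  refine ⟨fun t => f (r - t), LipschitzWith.of_dist_le_mul fun s t => ?_,
    fun t ht => h1 _ (by linarith), fun t ht => h0 _ (by linarith)⟩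
  refine (hf.dist_le_mul _ _).trans ?_
  rw [dist_sub_left]

theorem trans (hr : 0 ≤ r) (h : ShortPath p q r) (h' : ShortPath q m s) (hs : 0 ≤ s) :
    ShortPath p m (r + s) := by
  obtain ⟨f, hf, f0, f1⟩ := h
  obtain ⟨g, hg, g0, g1⟩ := h'
  refine ⟨fun t => if t ≤ r then f t else g (t - r), ?_, fun t ht => ?_, fun t ht => ?_⟩
  · have key : ∀ a b : ℝ, a ≤ b → dist (if a ≤ r then f a else g (a - r))
        (if b ≤ r then f b else g (b - r)) ≤ dist a b := by
      intro a b hab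
      by_cases hb : b ≤ r
      · rw [if_pos hb, if_pos (hab.trans hb)]
        simpa using hf.dist_le_mul a b
      · by_cases ha : a ≤ r
        · rw [if_pos ha, if_neg hb]
          have e1 := hf.dist_le_mul a r
          have e2 := hg.dist_le_mul 0 (b - r)
          rw [f1 r le_rfl, NNReal.coe_one, one_mul, Real.dist_eq, abs_sub_comm,
            abs_of_nonneg (by linarith)] at e1
          rw [g0 0 le_rfl, NNReal.coe_one, one_mul, Real.dist_eq, abs_sub_comm,
            abs_of_nonneg (by linarith)] at e2
          have e3 := dist_triangle (f a) q (g (b - r))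
          rw [Real.dist_eq, abs_sub_comm, abs_of_nonneg (by linarith)]
          linarith
        · rw [if_neg ha, if_neg hb]
          simpa using hg.dist_le_mul (a - r) (b - r)
    refine LipschitzWith.of_dist_le_mul fun a b => ?_
    rw [NNReal.coe_one, one_mul]
    rcases le_total a b with h | h
    · exact key a b h
    · rw [dist_comm, dist_comm a b]; exact key b a h
  · dsimp only
    rw [if_pos (ht.trans hr)]; exact f0 t ht
  · dsimp only
    split_ifs with h
    · have : s = 0 := by linarith
      rw [f1 t (by linarith), ← g1 0 this.le, g0 0 le_rfl]
    · exact g1 _ (by linarith)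

/-- A `1`-Lipschitz curve joins its points by short paths. -/
theorem of_lipschitz {c : ℝ → X} (hc : LipschitzWith 1 c) (a b : ℝ) :
    ShortPath (c a) (c b) |a - b| := by
  have key : ∀ a b : ℝ, a ≤ b → ShortPath (c a) (c b) |a - b| := by
    intro a b hab
    refine ⟨fun t => c (projIcc a b hab (a + t)), ?_, fun t ht => ?_, fun t ht => ?_⟩
    · refine LipschitzWith.of_dist_le_mul fun s t => ?_
      have h1 := hc.dist_le_mul (projIcc a b hab (a + s)) (projIcc a b hab (a + t))
      have h2 := (LipschitzWith.projIcc hab).dist_le_mul (a + s) (a + t)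
      rw [dist_add_left] at h2
      refine h1.trans ?_
      rw [NNReal.coe_one, one_mul]
      exact h2
    · dsimp only
      rw [projIcc_of_le_left _ (by linarith)]
    · rw [abs_sub_comm, abs_of_nonneg (by linarith)] at ht
      dsimp only
      rw [projIcc_of_right_le _ (by linarith)]
  rcases le_total a b with h | h
  · exact key a b h
  · rw [abs_sub_comm]; exact (key b a h).symm

/-- Short paths of lengths close to the distance, inside a compact set, subconverge to a
geodesic. -/
theorem exists_geodesic {W : Set X} (hW : IsCompact W)
    (h : ∀ n : ℕ, ∃ f : ℝ → X, LipschitzWith 1 f ∧ (∀ t, f t ∈ W) ∧ (∀ t ≤ 0, f t = p) ∧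
      ∀ t ≥ dist p q + 1 / ((n : ℝ) + 1), f t = q) :
    ∃ g : ℝ → X, g 0 = p ∧ g 1 = q ∧
      ∀ s ∈ Icc (0 : ℝ) 1, ∀ t ∈ Icc (0 : ℝ) 1, dist (g s) (g t) = |s - t| * dist p q := by
  -- A decreasing sequence of compact sets, in the topology of pointwise convergence.
  set A : ℕ → Set (ℝ → X) := fun n => {f | (∀ t, f t ∈ W) ∧ (∀ s t, dist (f s) (f t) ≤ dist s t) ∧
    f 0 = p ∧ ∀ t ≥ dist p q + 1 / ((n : ℝ) + 1), f t = q} with hA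
  have hcl : ∀ n, IsClosed (A n) := by
    intro n
    simp only [hA, ofPred_and, ofPred_forall]
    refine IsClosed.inter ?_ (IsClosed.inter ?_ (IsClosed.inter ?_ ?_))
    · exact isClosed_iInter fun t => hW.isClosed.preimage (continuous_apply t)
    · exact isClosed_iInter fun s => isClosed_iInter fun t =>
        isClosed_le ((continuous_apply s).dist (continuous_apply t)) continuous_const
    · exact isClosed_eq (continuous_apply 0) continuous_const
    · exact isClosed_iInter fun t => isClosed_iInter fun _ =>
        isClosed_eq (continuous_apply t) continuous_const
  have hcomp : IsCompact (A 0) :=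
    (isCompact_univ_pi fun _ : ℝ => hW).of_isClosed_subset (hcl 0) fun f hf t _ => hf.1 t
  have hanti : ∀ n, A (n + 1) ⊆ A n := by
    rintro n f ⟨h1, h2, h3, h4⟩
    refine ⟨h1, h2, h3, fun t ht => h4 t (ge_trans ht ?_)⟩
    have : 1 / (((n + 1 : ℕ) : ℝ) + 1) ≤ 1 / ((n : ℝ) + 1) :=
      one_div_le_one_div_of_le (by positivity) (by push_cast; linarith)
    simpa using this
  obtain ⟨f, hf⟩ := IsCompact.nonempty_iInter_of_sequence_nonempty_isCompact_isClosed A hanti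
    (fun n => by
      obtain ⟨f, h1, h2, h3, h4⟩ := h n
      exact ⟨f, h2, fun s t => by simpa using h1.dist_le_mul s t, h3 0 le_rfl, h4⟩) hcomp hcl
  rw [mem_iInter] at hf
  obtain ⟨-, hL, h0, -⟩ := hf 0
  set D := dist p q
  have hD : f D = q := by
    rw [← dist_le_zero]
    refine le_of_forall_pos_le_add fun ε hε => ?_
    obtain ⟨n, hn⟩ := exists_nat_one_div_lt hε
    have h1 := hL D (D + 1 / ((n : ℝ) + 1))
    rw [(hf n).2.2.2 _ le_rfl, dist_self_add_right, Real.norm_of_nonneg (by positivity)] at h1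
    linarith
  refine ⟨fun s => f (s * D), by simpa using h0, by simpa using hD, ?_⟩
  have key : ∀ s ∈ Icc (0 : ℝ) 1, ∀ t ∈ Icc (0 : ℝ) 1, s ≤ t →
      dist (f (s * D)) (f (t * D)) = |s - t| * D := by
    intro s hs t ht hst
    have hD0 : 0 ≤ D := dist_nonneg
    have a1 := mul_nonneg hs.1 hD0
    have a2 := mul_le_of_le_one_left hD0 ht.2
    have a3 := mul_le_mul_of_nonneg_right hst hD0
    have e1 := hL 0 (s * D)
    have e2 := hL (s * D) (t * D)
    have e3 := hL (t * D) D
    rw [Real.dist_eq, abs_sub_comm, abs_of_nonneg (by linarith)] at e1 e2 e3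
    have e4 := dist_triangle4 (f 0) (f (s * D)) (f (t * D)) (f D)
    rw [h0, hD] at e4
    rw [h0] at e1
    rw [hD] at e3
    change D ≤ _ at e4
    rw [abs_sub_comm, abs_of_nonneg (by linarith)]
    refine le_antisymm ?_ ?_ <;> linarith
  intro s hs t ht
  rcases le_total s t with h | h
  · exact key s hs t ht h
  · rw [dist_comm, abs_sub_comm]; exact key t ht s hs h

end ShortPath

namespace PreAug

variable {Z : Type*} [MetricSpace Z] {K : Type*} {N : K → Set Z}

/-- The geodesics of `Z` and the segments of the pieces realize each chain by a path of the same
length. -/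
theorem shortPath (hZ : IsGeodesicSpace Z) {p q : PreAug N} {r : ℝ} (h : ChainJoined N p q r) :
    ShortPath (AugSpace.mk p) (AugSpace.mk q) r := by
  induction h with
  | base z z' =>
    obtain ⟨g, g0, g1, hg⟩ := hZ z z'
    set D := dist z z'
    have hc : LipschitzWith 1 fun s : ℝ =>
        (AugSpace.mk (.base (g (projIcc 0 1 zero_le_one (s / D)))) : AugSpace N) := by
      refine LipschitzWith.of_dist_le_mul fun s t => ?_
      rw [AugSpace.dist_mk, NNReal.coe_one, one_mul]
      refine (dist_base_le _ _).trans ?_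
      rw [hg _ (projIcc _ _ _ _).2 _ (projIcc _ _ _ _).2]
      have h1 := (LipschitzWith.projIcc (zero_le_one (α := ℝ))).dist_le_mul (s / D) (t / D)
      rw [NNReal.coe_one, one_mul, Subtype.dist_eq, Real.dist_eq, Real.dist_eq] at h1
      refine (mul_le_mul_of_nonneg_right h1 dist_nonneg).trans ?_
      rw [← sub_div, abs_div, Real.dist_eq, abs_of_nonneg (dist_nonneg (x := z) (y := z'))]
      rcases eq_or_ne (dist z z') 0 with h0 | h0
      · rw [h0, mul_zero]; exact abs_nonneg _
      · exact (div_mul_cancel₀ _ h0).le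
    have h1 := ShortPath.of_lipschitz hc 0 D
    rw [zero_div, projIcc_left, zero_sub, abs_neg, abs_of_nonneg dist_nonneg, g0] at h1
    rcases eq_or_ne D 0 with h0 | h0
    · rw [h0, div_zero, projIcc_left, g0] at h1
      have : z = z' := dist_eq_zero.1 h0
      subst this
      exact h1
    · rw [div_self h0, projIcc_right, g1] at h1
      exact h1
  | ray k x h h' =>
    have hc : LipschitzWith 1 fun s : ℝ => (AugSpace.mk (.ray k x s.toNNReal) : AugSpace N) := by
      refine LipschitzWith.of_dist_le_mul fun s t => ?_
      rw [AugSpace.dist_mk, NNReal.coe_one, one_mul]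
      refine (dist_ray_le _ _ _ _).trans ?_
      rw [Real.coe_toNNReal', Real.coe_toNNReal', Real.dist_eq]
      exact abs_max_sub_max_le_abs _ _ _
    have := ShortPath.of_lipschitz hc h h'
    rw [Real.toNNReal_coe, Real.toNNReal_coe] at this
    exact this
  | edge k l x y hl hpos hle t t' =>
    have hc : LipschitzWith 1 fun s : ℝ =>
        (AugSpace.mk (.edge k l x y hl hpos hle (projIcc 0 1 zero_le_one s)) : AugSpace N) := by
      refine LipschitzWith.of_dist_le_mul fun s t => ?_
      rw [AugSpace.dist_mk]
      exact (dist_le (.edge k l x y hl hpos hle _ _)).trans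
        ((LipschitzWith.projIcc (zero_le_one (α := ℝ))).dist_le_mul s t)
    have := ShortPath.of_lipschitz hc t t'
    rw [projIcc_val, projIcc_val] at this
    exact this
  | foot k x =>
    rw [AugSpace.mk_eq_mk.2 (dist_foot k x)]; exact ShortPath.refl _
  | corner k l x y hl hpos hle =>
    rw [AugSpace.mk_eq_mk.2 (dist_corner k l x y hl hpos hle)]; exact ShortPath.refl _
  | flip k l x y hl hpos hle hpos' hle' t =>
    rw [AugSpace.mk_eq_mk.2 (le_antisymm (dist_le (.flip k l x y hl hpos hle hpos' hle' t))
      dist_nonneg)]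
    exact ShortPath.refl _
  | symm _ ih => exact ih.symm
  | trans h h' ih ih' => exact ih.trans h.nonneg ih' h'.nonneg

open Classical in
/-- The map that collapses the rays over the indices outside of `S` to their feet. -/
noncomputable def collapse (S : Set K) : PreAug N → PreAug N
  | ray k x h => if k ∈ S then ray k x h else base x
  | p => p

/-- The collapse of single rays is well defined on chains and does not increase distances. -/
theorem dist_collapse_le {S : Set K} (hS : ∀ k ∉ S, (N k).Subsingleton) (p q : PreAug N) :
    dist (collapse S p) (collapse S q) ≤ dist p q := by
  refine le_dist fun r hr => ?_
  induction hr with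
  | base z z' => exact dist_le (.base z z')
  | ray k x h h' =>
    by_cases hk : k ∈ S
    · simp only [collapse, if_pos hk]
      exact dist_le (.ray k x h h')
    · simp only [collapse, if_neg hk]
      rw [dist_self]; exact dist_nonneg
  | edge k l x y hl hpos hle t t' => exact dist_le (.edge k l x y hl hpos hle t t')
  | foot k x =>
    by_cases hk : k ∈ S
    · simp only [collapse, if_pos hk]
      exact dist_le (.foot k x)
    · simp only [collapse, if_neg hk]
      rw [dist_self]
  | corner k l x y hl hpos hle =>
    have hk : k ∈ S := by
      by_contra hk
      exact hpos.ne' (dist_eq_zero.2 (hS k hk x.2 y.2))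
    simp only [collapse, if_pos hk]
    exact dist_le (.corner k l x y hl hpos hle)
  | flip k l x y hl hpos hle hpos' hle' t => exact dist_le (.flip k l x y hl hpos hle hpos' hle' t)
  | symm _ ih => rwa [dist_comm]
  | trans _ _ ih ih' => exact (dist_triangle _ _ _).trans (add_le_add ih ih')

/-- The pieces that belong to `Z` or to the horoballs over the indices in `S`. -/
def InPart (S : Set K) : PreAug N → Prop
  | base _ => True
  | ray k _ _ => k ∈ S
  | edge k _ _ _ _ _ _ _ => k ∈ S

theorem inPart_collapse {S : Set K} (hS : ∀ k ∉ S, (N k).Subsingleton) (p : PreAug N) :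
    InPart S (collapse S p) := by
  cases p with
  | base z => trivial
  | ray k x h =>
    by_cases hk : k ∈ S
    · simp only [collapse, if_pos hk]; exact hk
    · simp only [collapse, if_neg hk]; trivial
  | edge k l x y hl hpos hle t =>
    by_contra hk
    exact hpos.ne' (dist_eq_zero.2 (hS k hk x.2 y.2))

theorem collapse_eq {S : Set K} {p : PreAug N} (hp : InPart S p) : collapse S p = p := by
  cases p with
  | base z => rfl
  | ray k x h => exact if_pos hp
  | edge k l x y hl hpos hle t => rfl

theorem finite_lattice_inter [ProperSpace Z] {A M : Set Z} (hM : IsLatticeOf A M) (o : Z) (R : ℝ) :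
    {x | x ∈ M ∧ dist o x ≤ R}.Finite := by
  by_contra hinf
  set u := Set.Infinite.natEmbedding _ hinf
  obtain ⟨a, -, φ, hφ, hlim⟩ := (isCompact_closedBall o R).tendsto_subseq
    (x := fun n => (u n : Z)) fun n => by
      rw [Metric.mem_closedBall, dist_comm]; exact (u n).2.2
  obtain ⟨n, hn⟩ := Metric.cauchySeq_iff.1 hlim.cauchySeq 1 one_pos
  have h1 := hn (n + 1) (by omega) n le_rfl
  refine absurd h1 (not_lt.2 (hM.discrete _ (u _).2.1 _ (u _).2.1 fun h => ?_))
  have := hφ.injective (u.injective (Subtype.val_injective h))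
  omega

/-- Bounded parts of the union of `Z` with a locally finite collection of horoballs are relatively
compact. -/
theorem exists_isCompact [ProperSpace Z] {A : K → Set Z} (hN : ∀ k, IsLatticeOf (A k) (N k))
    {S : Set K} (hS : ∀ o R, {k | k ∈ S ∧ ∃ x ∈ N k, dist o x ≤ R}.Finite) (e : AugSpace N)
    (R : ℝ) : ∃ W : Set (AugSpace N), IsCompact W ∧
      ∀ p : PreAug N, InPart S p → dist e (AugSpace.mk p) ≤ R → AugSpace.mk p ∈ W := by
  obtain ⟨e, rfl⟩ := AugSpace.mk_surjective e
  obtain ⟨o, -⟩ := ChainJoined.exists_base e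
  set R₂ := |R| + dist (base o) e
  have hR₂ : 0 ≤ R₂ := add_nonneg (abs_nonneg _) dist_nonneg
  -- Ends of horizontal edges are up to `2` farther away, and `bounds_of_dist_base_ray_le` loses `6`.
  set R₁ : ℝ := 2 ^ (R₂ + 8) with hR₁
  set F := {k | k ∈ S ∧ ∃ x ∈ N k, dist o x ≤ R₁}
  have hF : F.Finite := hS o R₁
  have hM : ∀ k, {x : N k | dist o (x : Z) ≤ R₁}.Finite := fun k =>
    ((finite_lattice_inter (hN k) o R₁).preimage Subtype.val_injective.injOn).subset
      fun x hx => ⟨x.2, hx⟩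
  have hcont_base : Continuous fun z : Z => (AugSpace.mk (.base z) : AugSpace N) :=
    (LipschitzWith.of_dist_le_mul (K := 1) fun z z' => by
      rw [AugSpace.dist_mk, NNReal.coe_one, one_mul]; exact dist_base_le z z').continuous
  have hcont_ray : ∀ k (x : N k), Continuous fun h : ℝ≥0 => (AugSpace.mk (.ray k x h) : AugSpace N) :=
    fun k x => (LipschitzWith.of_dist_le_mul (K := 1) fun h h' => by
      rw [AugSpace.dist_mk, NNReal.coe_one, one_mul]; exact dist_ray_le k x h h').continuous
  have hcont_edge : ∀ k l (x y : N k) hl hpos hle, Continuous fun t : unitInterval =>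
      (AugSpace.mk (.edge k l x y hl hpos hle t) : AugSpace N) := fun k l x y hl hpos hle =>
    (LipschitzWith.of_dist_le_mul (K := 1) fun t t' => by
      rw [AugSpace.dist_mk, NNReal.coe_one, one_mul]
      exact dist_le (.edge k l x y hl hpos hle t t')).continuous
  obtain ⟨n, hn⟩ := exists_nat_ge (R₂ + 8)
  set W : Set (AugSpace N) := (fun z : Z => AugSpace.mk (.base z)) '' Metric.closedBall o R₁ ∪
    ((⋃ k ∈ F, ⋃ x ∈ {x : N k | dist o (x : Z) ≤ R₁},
      (fun h : ℝ≥0 => AugSpace.mk (.ray k x h)) '' Icc 0 n) ∪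
    ⋃ k ∈ F, ⋃ x ∈ {x : N k | dist o (x : Z) ≤ R₁}, ⋃ y ∈ {x : N k | dist o (x : Z) ≤ R₁},
      ⋃ l ∈ Iic n, ⋃ (hl : 1 ≤ l) (hpos : 0 < dist (x : Z) y) (hle : dist (x : Z) y ≤ 2 ^ l),
        range fun t : unitInterval => AugSpace.mk (.edge k l x y hl hpos hle t)) with hW
  refine ⟨W, ?_, fun p hp hd => ?_⟩
  · refine ((isCompact_closedBall o R₁).image hcont_base).union (IsCompact.union ?_ ?_)
    · exact hF.isCompact_biUnion fun k _ => (hM k).isCompact_biUnion fun x _ =>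
        isCompact_Icc.image (hcont_ray k x)
    · exact hF.isCompact_biUnion fun k _ => (hM k).isCompact_biUnion fun x _ =>
        (hM k).isCompact_biUnion fun y _ => (finite_Iic n).isCompact_biUnion fun l _ =>
          isCompact_iUnion fun hl => isCompact_iUnion fun hpos => isCompact_iUnion fun hle =>
            isCompact_range (hcont_edge k l x y hl hpos hle)
  · have hd' : dist (base o) p ≤ R₂ := by
      have := dist_triangle (base o) e p
      have h2 := le_abs_self R
      rw [AugSpace.dist_mk] at hd
      linarith
    have hmono : ∀ a : ℝ, a ≤ R₂ + 8 → (2 : ℝ) ^ a ≤ R₁ := fun a ha =>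
      Real.rpow_le_rpow_of_exponent_le one_le_two ha
    have hray : ∀ k (x : N k) (h : ℝ≥0), dist (base o) (ray k x h) ≤ R₂ + 2 →
        dist o (x : Z) ≤ R₁ ∧ (h : ℝ) ≤ n := fun k x h hx => by
      obtain ⟨h1, h2⟩ := bounds_of_dist_base_ray_le o k x h hx
      exact ⟨h1.trans (hmono _ (by linarith)), by linarith⟩
    cases p with
    | base z =>
      refine Or.inl ⟨z, ?_, rfl⟩
      rw [Metric.mem_closedBall, dist_comm]
      exact (dist_le_rpow o z hd').trans (hmono _ (by linarith))
    | ray k x h =>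
      obtain ⟨h1, h2⟩ := hray k x h (by linarith)
      refine Or.inr (Or.inl ?_)
      refine mem_biUnion (x := k) ⟨hp, x, x.2, h1⟩ (mem_biUnion (x := x) h1 ⟨h, ⟨zero_le, ?_⟩, rfl⟩)
      exact_mod_cast h2
    | edge k l x y hl hpos hle t =>
      have e1 := dist_edge_ray_le k l x y hl hpos hle t
      have e2 := dist_horizontal_le k l x y hl hle
      have e3 := dist_triangle (base o) (edge k l x y hl hpos hle t) (ray k x l)
      have e4 := dist_triangle (base o) (ray k x l) (ray k y l)
      obtain ⟨h1, h2⟩ := hray k x l (by linarith)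
      obtain ⟨h3, -⟩ := hray k y l (by linarith)
      refine Or.inr (Or.inr ?_)
      refine mem_biUnion (x := k) ⟨hp, x, x.2, h1⟩ (mem_biUnion (x := x) h1
        (mem_biUnion (x := y) h3 (mem_biUnion (x := l) ?_ ?_)))
      · exact_mod_cast h2
      · simp only [mem_iUnion]
        exact ⟨hl, hpos, hle, t, rfl⟩

end PreAug

namespace IsTreeOfSpaces

variable {Z : Type*} [MetricSpace Z] {K L : Type*} {G : SimpleGraph (K ⊕ L)}
  {ξ : Z → GraphRealization G} {N : K → Set Z}

/-- Only finitely many lattices with more than one point meet a given ball. -/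
theorem finite_lattice_index (hT : IsTreeOfSpaces ξ) [ProperSpace Z]
    (hN : ∀ k, IsLatticeOf (component ξ k) (N k)) (o : Z) (R : ℝ) :
    {k | ¬ (N k).Subsingleton ∧ ∃ x ∈ N k, dist o x ≤ R}.Finite := by
  refine (hT.finite_components o R).subset ?_
  rintro k ⟨hk, x, hx, hxR⟩
  rw [Set.not_subsingleton_iff] at hk
  obtain ⟨y, hy, y', hy', hne⟩ := hk
  exact ⟨⟨x, (hN k).subset hx, hxR⟩, y, (hN k).subset hy, y', (hN k).subset hy',
    (hN k).discrete _ hy _ hy' hne⟩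

/-- The augmented space is geodesic. A path of almost minimal length need not enter any horoball
that consists of a single ray, except at its ends, and the other horoballs are locally finite in
number. -/
theorem isGeodesicSpace_augSpace (hT : IsTreeOfSpaces ξ) [ProperSpace Z] [Nonempty K]
    (hN : ∀ k, IsLatticeOf (component ξ k) (N k)) : IsGeodesicSpace (AugSpace N) := by
  intro x y
  obtain ⟨p, rfl⟩ := AugSpace.mk_surjective x
  obtain ⟨q, rfl⟩ := AugSpace.mk_surjective y
  obtain ⟨i, hi⟩ := hT.exists_inHoroball p
  obtain ⟨j, hj⟩ := hT.exists_inHoroball q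
  -- The horoballs that are kept: those with more than one ray, and those that contain `p` or `q`.
  set S : Set K := {k | ¬ (N k).Subsingleton} ∪ {i, j} with hS
  have hsub : ∀ k ∉ S, (N k).Subsingleton := fun k hk => not_not.1 fun h => hk (Or.inl h)
  have hpart : ∀ {k : K} {p : PreAug N}, k ∈ S → p.InHoroball (component ξ k) k →
      p.InPart S := by
    intro k p hk hp
    cases p with
    | base z => trivial
    | ray k' x h => have hp : k' = k := hp; subst hp; exact hk
    | edge k' l x y hl hpos hle t => have hp : k' = k := hp; subst hp; exact hk
  have hfin : ∀ o R, {k | k ∈ S ∧ ∃ x ∈ N k, dist o x ≤ R}.Finite := by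
    intro o R
    refine ((hT.finite_lattice_index hN o R).union (Set.toFinite {i, j})).subset ?_
    rintro k ⟨hk | hk, hx⟩
    · exact Or.inl ⟨hk, hx⟩
    · exact Or.inr hk
  obtain ⟨W, hW, hWmem⟩ := PreAug.exists_isCompact hN hfin (AugSpace.mk p)
    (dist (AugSpace.mk p) (AugSpace.mk q) + 1)
  -- The collapse, as a map of the augmented space.
  set c : AugSpace N → AugSpace N := fun x =>
    AugSpace.mk (PreAug.collapse S (Function.surjInv AugSpace.mk_surjective x))
  have hc : LipschitzWith 1 c := by
    refine LipschitzWith.of_dist_le_mul fun x y => ?_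
    rw [AugSpace.dist_mk, NNReal.coe_one, one_mul]
    refine (PreAug.dist_collapse_le hsub _ _).trans_eq ?_
    rw [← AugSpace.dist_mk, Function.surjInv_eq AugSpace.mk_surjective x,
      Function.surjInv_eq AugSpace.mk_surjective y]
  have hcp : ∀ {p : PreAug N}, p.InPart S → c (AugSpace.mk p) = AugSpace.mk p := by
    intro p hp
    refine AugSpace.mk_eq_mk.2 (le_antisymm ?_ dist_nonneg)
    have h1 := PreAug.dist_collapse_le hsub
      (Function.surjInv AugSpace.mk_surjective (AugSpace.mk p)) p
    rw [PreAug.collapse_eq hp] at h1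
    refine h1.trans_eq ?_
    rw [← AugSpace.dist_mk, Function.surjInv_eq AugSpace.mk_surjective (AugSpace.mk p), dist_self]
  have hp := hcp (hpart (Or.inr (Or.inl rfl)) hi)
  have hq := hcp (hpart (Or.inr (Or.inr rfl)) hj)
  refine ShortPath.exists_geodesic hW fun n => ?_
  have hpos : 0 < 1 / ((n : ℝ) + 1) := by positivity
  have hle : 1 / ((n : ℝ) + 1) ≤ 1 := by
    rw [div_le_one (by positivity)]; linarith [(Nat.cast_nonneg n : (0 : ℝ) ≤ n)]
  obtain ⟨r, hr, hrlt⟩ := PreAug.exists_chainJoined_lt (lt_add_of_pos_right (dist p q) hpos)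
  obtain ⟨f, hf, f0, f1⟩ := PreAug.shortPath hT.geodesic hr
  refine ⟨c ∘ f, by simpa using hc.comp hf, fun t => ?_, fun t ht => ?_, fun t ht => ?_⟩
  · refine hWmem _ (PreAug.inPart_collapse hsub _) ?_
    change dist (AugSpace.mk p) (c (f t)) ≤ _
    have h1 : dist (AugSpace.mk p) (c (f t)) ≤ dist (AugSpace.mk p) (f t) := by
      conv_lhs => rw [← hp]
      simpa using hc.dist_le_mul (AugSpace.mk p) (f t)
    refine h1.trans ?_
    rcases le_total r t with ht | ht
    · rw [f1 t ht]; linarith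
    · rcases le_total t 0 with ht0 | ht0
      · rw [f0 t ht0, dist_self]; positivity
      · have h2 := hf.dist_le_mul 0 t
        rw [f0 0 le_rfl, NNReal.coe_one, one_mul, dist_comm 0 t, Real.dist_0_eq_abs,
          abs_of_nonneg ht0] at h2
        rw [AugSpace.dist_mk p q]
        linarith
  · rw [Function.comp_apply, f0 t ht, hp]
  · rw [Function.comp_apply, f1 t (by rw [AugSpace.dist_mk] at ht; linarith), hq]

/-- The augmented space has a geodesic coarsely convex bicombing. -/
theorem exists_isGCCBicombing_augSpace (hT : IsTreeOfSpaces ξ) [ProperSpace Z] [Nonempty K]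
    (hN : ∀ k, IsLatticeOf (component ξ k) (N k)) :
    ∃ (E C : ℝ) (γ : AugSpace N → AugSpace N → ℝ → AugSpace N), IsGCCBicombing E C γ := by
  choose γ h0 h1 h using hT.isGeodesicSpace_augSpace hN
  have hγ : IsGeodesicBicombing γ := ⟨h0, h1, fun x y t ht s hs => h x y t ht s hs⟩
  exact ⟨1, 4 * 40, γ, hγ.isGCC (hT.fourPoint_augSpace hN) (by norm_num)⟩

end IsTreeOfSpaces

/-! ### Centers of horoballs -/

namespace IsTreeOfSpaces

open IdealBoundary

variable {Z : Type*} [MetricSpace Z] {K L : Type*} {G : SimpleGraph (K ⊕ L)}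
  {ξ : Z → GraphRealization G} {N : K → Set Z}

/-- The point over `l`, in the augmented space. -/
noncomputable def cutPoint (hT : IsTreeOfSpaces ξ) (N : K → Set Z) (l : L) : AugSpace N :=
  AugSpace.mk (.base (hT.cut l))

theorem dist_eq_of_mem_horoball (hT : IsTreeOfSpaces ξ)
    (hN : ∀ k, IsLatticeOf (component ξ k) (N k)) {l : L} {k i j : K}
    (h : G.Adj (Sum.inl k) (Sum.inr l)) {x y : AugSpace N}
    (hx : x ∈ horoball N (component ξ i) i)
    (hi : Sum.inl i ∈ treeBranch G (Sum.inr l) (Sum.inl k))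
    (hy : y ∈ horoball N (component ξ j) j)
    (hj : Sum.inl j ∉ treeBranch G (Sum.inr l) (Sum.inl k)) :
    dist x y = dist x (hT.cutPoint N l) + dist (hT.cutPoint N l) y := by
  obtain ⟨p, hp, rfl⟩ := hx
  obtain ⟨q, hq, rfl⟩ := hy
  exact hT.dist_eq_of_inHoroball hN h hp hi hq hj

theorem exists_mem_horoball (hT : IsTreeOfSpaces ξ) [Nonempty K] (x : AugSpace N) :
    ∃ k, x ∈ horoball N (component ξ k) k := by
  obtain ⟨p, rfl⟩ := AugSpace.mk_surjective x
  obtain ⟨k, hk⟩ := hT.exists_inHoroball p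
  exact ⟨k, p, hk, rfl⟩

theorem cutPoint_mem_horoball (hT : IsTreeOfSpaces ξ) {l : L} {k : K}
    (h : G.Adj (Sum.inl k) (Sum.inr l)) : hT.cutPoint N l ∈ horoball N (component ξ k) k :=
  ⟨_, hT.cut_mem_component h, rfl⟩

/-- The first vertex `l` on the way from `k` to `j`, and the next vertex `k'`. -/
theorem exists_toward (hT : IsTreeOfSpaces ξ) {k j : K} (hkj : j ≠ k) :
    ∃ l k', G.Adj (Sum.inl k) (Sum.inr l) ∧ G.Adj (Sum.inl k') (Sum.inr l) ∧ k' ≠ k ∧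
      (Sum.inl j : K ⊕ L) ∉ treeBranch G (Sum.inr l) (Sum.inl k) ∧
      (Sum.inl j : K ⊕ L) ∈ treeBranch G (Sum.inr l) (Sum.inl k') := by
  obtain ⟨w, hw, hjw⟩ := treeBranch.exists_notMem (v := Sum.inl j) (k := Sum.inl k) hT.tree
    fun h => hkj (Sum.inl_injective h)
  cases w with
  | inl k' => exact (hT.bipartite_left _ _ hw).elim
  | inr l =>
    obtain ⟨w, hw', hjw'⟩ := treeBranch.exists_mem (v := Sum.inl j) (l := Sum.inr l) hT.tree (by simp)
    cases w with
    | inr l' => exact (hT.bipartite_right _ _ hw').elim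
    | inl k' => exact ⟨l, k', hw, hw', by rintro rfl; exact hjw hjw', hjw, hjw'⟩

theorem notMem_treeBranch (hT : IsTreeOfSpaces ξ) {l : L} {k k' : K} {v : K ⊕ L}
    (h : G.Adj (Sum.inl k) (Sum.inr l)) (h' : G.Adj (Sum.inl k') (Sum.inr l)) (hne : k ≠ k')
    (hv : v ∈ treeBranch G (Sum.inr l) (Sum.inl k)) :
    v ∉ treeBranch G (Sum.inr l) (Sum.inl k') :=
  treeBranch.disjoint hT.tree h h' (fun h => hne (Sum.inl_injective h)) hv

theorem lattice_nonempty (hT : IsTreeOfSpaces ξ) [Nonempty K]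
    (hN : ∀ k, IsLatticeOf (component ξ k) (N k)) (z : Z) (k : K) : (N k).Nonempty := by
  have : (component ξ k).Nonempty := by
    obtain ⟨j, hj⟩ := hT.exists_mem_component z
    by_cases hjk : j = k
    · exact ⟨z, hjk ▸ hj⟩
    · obtain ⟨l, k', hl, -⟩ := hT.exists_toward hjk
      exact ⟨_, hT.cut_mem_component hl⟩
  obtain ⟨x, hx⟩ := this
  obtain ⟨y, hy, -⟩ := (hN k).dense x hx
  exact ⟨y, hy⟩

/-- Uniformly over all horoballs, a vertical ray eventually has Gromov product with a point of the
horoball at least half of the distance of that point, up to a constant. -/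
theorem exists_le_gromovProd_ray (hT : IsTreeOfSpaces ξ) [Nonempty K]
    (hN : ∀ k, IsLatticeOf (component ξ k) (N k)) (w : ∀ k, N k) (e : AugSpace N) :
    ∃ c : ℝ, ∀ k, ∀ x ∈ horoball N (component ξ k) k, ∀ᶠ j : ℕ in atTop,
      dist e x / 2 - c ≤ gromovProd e x (AugSpace.mk (.ray k (w k) j)) := by
  obtain ⟨e, rfl⟩ := AugSpace.mk_surjective e
  obtain ⟨o, -⟩ := ChainJoined.exists_base e
  obtain ⟨i, hi⟩ := hT.exists_mem_component o
  refine ⟨16 + 2 * dist e (.base o), ?_⟩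
  rintro k _ ⟨p, hp, rfl⟩
  have hp : p.InHoroball (component ξ k) k := hp
  have key : ∀ᶠ j : ℕ in atTop, dist (.base o) p / 2 - 16 ≤
      gromovProd (.base o) p (.ray k (w k) j) := by
    by_cases hik : i = k
    · subst hik
      exact PreAug.eventually_le_gromovProd_horoball (hN i) hi hp (w i)
    · -- The cut point on the way from `o` to the horoball plays the part of `o`.
      obtain ⟨l, k', hl, -, -, hil, -⟩ := hT.exists_toward hik
      filter_upwards [PreAug.eventually_le_gromovProd_horoball (hN k) (hT.cut_mem_component hl) hp
        (w k)] with j hj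
      have h1 := hT.dist_eq_of_inHoroball hN hl (q := .base o) hp treeBranch.self_mem hi hil
      have h2 := hT.dist_eq_of_inHoroball hN hl (p := .ray k (w k) j) (i := k) (q := .base o) rfl
        treeBranch.self_mem hi hil
      have h3 : 0 ≤ dist (.base (hT.cut l) : PreAug N) (.base o) := dist_nonneg
      unfold gromovProd at *
      rw [dist_comm (PreAug.base o) p, dist_comm (PreAug.base o) (PreAug.ray k (w k) j), h1, h2,
        dist_comm p (PreAug.base (hT.cut l)),
        dist_comm (PreAug.ray k (w k) (j : ℕ)) (PreAug.base (hT.cut l))]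
      linarith
  filter_upwards [key] with j hj
  have h1 := abs_le.1 (abs_gromovProd_sub_le e (.base o) p (.ray k (w k) j))
  have h2 := dist_triangle e (.base o) p
  change dist e p / 2 - _ ≤ gromovProd e p _
  have h3 : 0 ≤ dist e (.base o) := dist_nonneg
  linarith

variable {E C : ℝ} {γ : AugSpace N → AugSpace N → ℝ → AugSpace N} {e : AugSpace N}

theorem asymptotic_ray (k : K) (w : N k) (e : AugSpace N) :
    Asymptotic e (fun j : ℕ => AugSpace.mk (.ray k w j)) fun j : ℕ => AugSpace.mk (.ray k w j) := by
  obtain ⟨e, rfl⟩ := AugSpace.mk_surjective e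
  refine asymptotic_iff.2 fun R => ?_
  obtain ⟨n, hn⟩ := exists_nat_ge (R + 2 + dist e (.ray k w 0))
  refine ⟨n, fun i hi j hj => ?_⟩
  have h1 := abs_le.1 (abs_gromovProd_sub_le e (.ray k w 0) (.ray k w i) (.ray k w j : PreAug N))
  have lo : ∀ i : ℕ, (i : ℝ) - 2 ≤ dist (.ray k w 0 : PreAug N) (.ray k w i) := by
    intro i
    have h2 := PreAug.le_dist_ray_ray k k w w 0 (i : ℝ≥0)
    simp only [dist_self, NNReal.coe_zero, NNReal.coe_natCast] at h2
    have h3 : (i : ℝ) + 2 ≤ Real.logb 2 (horoSize 0 0 i) := by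
      rw [Real.le_logb_iff_rpow_le one_lt_two (horoSize_pos le_rfl _ _),
        Real.rpow_add two_pos, Real.rpow_natCast]
      unfold horoSize
      rw [Real.rpow_natCast]
      norm_num
      linarith
    linarith
  have hij := PreAug.dist_ray_le k w (i : ℝ≥0) (j : ℝ≥0)
  simp only [NNReal.coe_natCast] at hij
  have hi' : (n : ℝ) ≤ i := by exact_mod_cast hi
  have hj' : (n : ℝ) ≤ j := by exact_mod_cast hj
  have h4 : (n : ℝ) - 2 ≤ gromovProd (.ray k w 0) (.ray k w i) (.ray k w j : PreAug N) := by
    have := lo i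
    have := lo j
    unfold gromovProd
    rcases abs_cases ((i : ℝ) - j) with ⟨h, _⟩ | ⟨h, _⟩ <;> rw [h] at hij <;> linarith
  change R ≤ gromovProd e (.ray k w i) (.ray k w j)
  linarith

theorem mem_horoball_ray (k : K) (w : N k) (j : ℕ) :
    AugSpace.mk (.ray k w j) ∈ horoball N (component ξ k) k :=
  ⟨_, rfl, rfl⟩

/-- The boundary point `c k` is represented by a vertical ray of the horoball of index `k`. -/
def IsCenter (w : ∀ k, N k) (c : K → IdealBoundary E C γ e) : Prop :=
  ∀ k, Rep (fun j : ℕ => (AugSpace.mk (.ray k (w k) j) : AugSpace N)) (c k)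

theorem exists_isCenter (hT : IsTreeOfSpaces ξ) [Nonempty K]
    (hN : ∀ k, IsLatticeOf (component ξ k) (N k)) (hγ : IsGCCBicombing E C γ) (w : ∀ k, N k) :
    ∃ c : K → IdealBoundary E C γ e, IsCenter w c := by
  choose c hc using fun k => Rep.exists_of_asymptotic (e := e) (hT.fourPoint_augSpace hN) hγ
    (asymptotic_ray k (w k) e)
  exact ⟨c, hc⟩

variable {w : ∀ k, N k} {c : K → IdealBoundary E C γ e}

/-- A boundary point near a point of a horoball is near the center of that horoball. -/
theorem exists_near_center (hT : IsTreeOfSpaces ξ) [Nonempty K]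
    (hN : ∀ k, IsLatticeOf (component ξ k) (N k)) (hc : IsCenter w c) :
    ∀ R : ℝ, ∃ R', ∀ k, ∀ x ∈ horoball N (component ξ k) k, ∀ ζ : IdealBoundary E C γ e,
      NearPoint R' ζ x → Near R ζ (c k) := by
  obtain ⟨a, ha⟩ := hT.exists_le_gromovProd_ray hN w e
  intro R
  refine ⟨max (R + 20) (2 * (R + 20 + a)), ?_⟩
  rintro k x hx ζ ⟨s, hs, n, hn⟩
  obtain ⟨m, hm⟩ := eventually_atTop.1 (ha k x hx)
  refine ⟨s, _, hs, hc k, max n m, fun i hi j hj => ?_⟩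
  have h1 := hn i (le_of_max_le_left hi)
  have h2 := hm j (le_of_max_le_right hj)
  have h3 := gromovProd_le_right e (s i) x
  have h4 := le_max_left (R + 20) (2 * (R + 20 + a))
  have h5 := le_max_right (R + 20) (2 * (R + 20 + a))
  exact le_gromovProd (hT.fourPoint_augSpace hN) (r := R + 20) (y := x) (by linarith) (by linarith)
    (by ring)

/-- A boundary point is the center of every horoball that its sequences visit infinitely often. -/
theorem eq_center_of_frequently (hT : IsTreeOfSpaces ξ) [Nonempty K]
    (hN : ∀ k, IsLatticeOf (component ξ k) (N k)) (hγ : IsGCCBicombing E C γ) (hc : IsCenter w c)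
    {s : ℕ → AugSpace N} {ζ : IdealBoundary E C γ e} (hs : Rep s ζ) {k : K}
    (H : ∀ n, ∃ j ≥ n, s j ∈ horoball N (component ξ k) k) : ζ = c k := by
  have h4 := hT.fourPoint_augSpace hN
  refine eq_of_forall_near h4 hγ fun R => ?_
  obtain ⟨R', hR'⟩ := hT.exists_near_center hN hc R
  obtain ⟨n, hn⟩ := asymptotic_iff.1 (hs.self h4 hγ) R'
  obtain ⟨j, hj, hjk⟩ := H n
  exact hR' k _ hjk ζ ⟨s, hs, n, fun i hi => hn i hi j hj⟩

/-- The centers of the horoballs are dense in the ideal boundary. -/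
theorem exists_center_near (hT : IsTreeOfSpaces ξ) [Nonempty K]
    (hN : ∀ k, IsLatticeOf (component ξ k) (N k)) (hγ : IsGCCBicombing E C γ) (hc : IsCenter w c)
    (ζ : IdealBoundary E C γ e) (R : ℝ) : ∃ k, Near R ζ (c k) := by
  obtain ⟨R', hR'⟩ := hT.exists_near_center hN hc R
  obtain ⟨s, hs⟩ := exists_rep ζ
  obtain ⟨n, hn⟩ := asymptotic_iff.1 (hs.self (hT.fourPoint_augSpace hN) hγ) R'
  obtain ⟨k, hk⟩ := hT.exists_mem_horoball (s n)
  exact ⟨k, hR' k _ hk ζ ⟨s, hs, n, fun i hi => hn i hi n le_rfl⟩⟩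

theorem exists_not_nearPoint (hT : IsTreeOfSpaces ξ) [Nonempty K]
    (hN : ∀ k, IsLatticeOf (component ξ k) (N k)) (hγ : IsGCCBicombing E C γ) (hc : IsCenter w c)
    {ζ : IdealBoundary E C γ e} {k : K} (hζ : ζ ≠ c k) :
    ∃ R, ∀ x ∈ horoball N (component ξ k) k, ¬ NearPoint R ζ x := by
  obtain ⟨R, hR⟩ := not_forall.1 fun H => hζ (eq_of_forall_near (hT.fourPoint_augSpace hN) hγ H)
  obtain ⟨R', hR'⟩ := hT.exists_near_center hN hc R
  exact ⟨R', fun x hx h => hR (hR' k x hx ζ h)⟩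

/-- In the bordification the closure of a metric horoball adds exactly its center. -/
theorem closure_horoball_diff (hT : IsTreeOfSpaces ξ) [Nonempty K]
    (hN : ∀ k, IsLatticeOf (component ξ k) (N k)) (hγ : IsGCCBicombing E C γ) (hc : IsCenter w c)
    (k : K) : closure ((Bordification.pt : AugSpace N → Bordification E C γ e) ''
        horoball N (component ξ k) k) \
      ((Bordification.pt : AugSpace N → Bordification E C γ e) '' horoball N (component ξ k) k) =
      {Bordification.bd (c k)} := by
  refine closure_diff_eq_singleton (hT.fourPoint_augSpace hN) hγ
    (isClosed_horoball (hT.isClosed_component k) (hN k)) (c k) (fun R => ?_)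
    fun ζ hζ => hT.exists_not_nearPoint hN hγ hc hζ
  obtain ⟨n, hn⟩ := asymptotic_iff.1 (asymptotic_ray k (w k) e) R
  exact ⟨_, mem_horoball_ray k (w k) n, _, hc k, n, fun i hi => hn i hi n le_rfl⟩

theorem center_injective (hT : IsTreeOfSpaces ξ) [Nonempty K]
    (hN : ∀ k, IsLatticeOf (component ξ k) (N k)) (hγ : IsGCCBicombing E C γ) (hc : IsCenter w c) :
    Function.Injective c := by
  intro k k' hkk
  by_contra hne
  obtain ⟨l, -, hl, -, -, hk', -⟩ := hT.exists_toward (Ne.symm hne)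
  obtain ⟨n, hn⟩ := asymptotic_iff.1
    ((Rep.eq_iff (hT.fourPoint_augSpace hN) hγ (hc k) (hc k')).1 hkk)
    (dist e (hT.cutPoint N l) + 1)
  have h1 := hn n le_rfl n le_rfl
  have h2 := gromovProd_le_of_cut (e := e) (hT.dist_eq_of_mem_horoball hN hl
    (mem_horoball_ray k (w k) n) treeBranch.self_mem (mem_horoball_ray k' (w k') n) hk')
  linarith

/-! ### Isolated points of the ideal boundary -/

/-- If the branch points in a component are bounded, then the center of its horoball is isolated:
geodesics to other boundary points leave the horoball through one of the branch points. -/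
theorem isOpen_singleton_center (hT : IsTreeOfSpaces ξ) [Nonempty K]
    (hN : ∀ k, IsLatticeOf (component ξ k) (N k)) (hγ : IsGCCBicombing E C γ) (hc : IsCenter w c)
    {k : K} (hb : Bornology.IsBounded (component ξ k ∩ branchPoints ξ)) :
    IsOpen ({c k} : Set (IdealBoundary E C γ e)) := by
  have h4 := hT.fourPoint_augSpace hN
  refine (isOpen_singleton_iff h4 hγ).2 ?_
  obtain ⟨e', he'⟩ := AugSpace.mk_surjective e
  obtain ⟨o, -⟩ := ChainJoined.exists_base e'
  obtain ⟨B, hB⟩ := hb.subset_closedBall o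
  refine ⟨dist e (AugSpace.mk (.base o)) + B + 41, fun η hη => ?_⟩
  obtain ⟨s, hs⟩ := exists_rep η
  obtain ⟨n, hn⟩ := hη.eventually_le h4 hγ (hc k) hs
  refine hT.eq_center_of_frequently hN hγ hc hs fun m => ⟨max n m, le_max_right _ _, ?_⟩
  obtain ⟨j, hj⟩ := hT.exists_mem_horoball (s (max n m))
  by_cases hjk : j = k
  · exact hjk ▸ hj
  · exfalso
    obtain ⟨l, k', hl, hk'l, hk', hjl, -⟩ := hT.exists_toward hjk
    have h1 := hn n le_rfl _ (le_max_left n m)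
    have h2 := gromovProd_le_of_cut (e := e) (hT.dist_eq_of_mem_horoball hN hl
      (mem_horoball_ray k (w k) n) treeBranch.self_mem hj hjl)
    have h3 : hT.cut l ∈ component ξ k ∩ branchPoints ξ :=
      ⟨hT.cut_mem_component hl, l, ⟨k, k', hk'.symm, hl, hk'l⟩, hT.eq_vertex_iff.2 rfl⟩
    have h5 := hB h3
    rw [Metric.mem_closedBall, dist_comm] at h5
    have h6 := (PreAug.dist_base_le (N := N) o (hT.cut l)).trans h5
    rw [← AugSpace.dist_mk] at h6
    have h7 := dist_triangle e (AugSpace.mk (.base o)) (hT.cutPoint N l)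
    change dist _ (hT.cutPoint N l) ≤ B at h6
    linarith

/-- If the branch points in a component are unbounded, then the center of its horoball is a limit
of the centers of the horoballs attached at these branch points. -/
theorem isBounded_of_isOpen_singleton_center (hT : IsTreeOfSpaces ξ) [Nonempty K]
    (hN : ∀ k, IsLatticeOf (component ξ k) (N k)) (hγ : IsGCCBicombing E C γ) (hc : IsCenter w c)
    {k : K} (ho : IsOpen ({c k} : Set (IdealBoundary E C γ e))) :
    Bornology.IsBounded (component ξ k ∩ branchPoints ξ) := by
  by_contra hunb
  obtain ⟨R, hR⟩ := (isOpen_singleton_iff (hT.fourPoint_augSpace hN) hγ).1 ho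
  obtain ⟨R', hR'⟩ := hT.exists_near_center hN hc R
  set b : AugSpace N := AugSpace.mk (.ray k (w k) 0) with hb
  set r := R' + dist e b
  obtain ⟨z, ⟨hzk, l, ⟨k₁, k₂, hne, h₁, h₂⟩, hz⟩, hzr⟩ :
      ∃ z ∈ component ξ k ∩ branchPoints ξ, 2 ^ ((r + 6) / 2) < dist (w k : Z) z := by
    by_contra! H
    refine hunb ((Metric.isBounded_closedBall (x := (w k : Z)) (r := 2 ^ ((r + 6) / 2))).subset
      fun z hz => ?_)
    rw [Metric.mem_closedBall, dist_comm]
    exact H z hz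
  rw [hT.eq_vertex_iff] at hz
  subst hz
  have hl := hT.adj_of_cut_mem_component hzk
  obtain ⟨k', hk'k, hk'⟩ : ∃ k', k' ≠ k ∧ G.Adj (Sum.inl k') (Sum.inr l) := by
    by_cases h : k₁ = k
    · exact ⟨k₂, fun h' => hne (h.trans h'.symm), h₂⟩
    · exact ⟨k₁, h, h₁⟩
  have hfar : r < dist b (hT.cutPoint N l) := by
    by_contra! hle
    rw [hb, AugSpace.mk_eq_mk.2 (PreAug.dist_foot k (w k))] at hle
    exact absurd (PreAug.dist_le_rpow (N := N) _ _ hle) (not_le.2 hzr)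
  refine hk'k (hT.center_injective hN hγ hc (hR (c k') (Near.symm (hR' k _
    (hT.cutPoint_mem_horoball hl) (c k') ⟨_, hc k', 0, fun i _ => ?_⟩))))
  have h1 := hT.dist_eq_of_mem_horoball hN hk' (mem_horoball_ray k' (w k') i) treeBranch.self_mem
    (mem_horoball_ray k (w k) 0) (hT.notMem_treeBranch hl hk' hk'k.symm treeBranch.self_mem)
  rw [Nat.cast_zero] at h1
  have h2 := abs_le.1 (abs_gromovProd_sub_le e b (AugSpace.mk (.ray k' (w k') i))
    (hT.cutPoint N l))
  have h3 : gromovProd b (AugSpace.mk (.ray k' (w k') i)) (hT.cutPoint N l) =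
      dist b (hT.cutPoint N l) := by
    unfold gromovProd
    rw [dist_comm b (AugSpace.mk (.ray k' (w k') i)), h1, dist_comm (hT.cutPoint N l) b]
    ring
  linarith

/-! ### The ideal boundary as a Cantor space -/

/-- The part of the augmented space on the side of `k` of the cut point over `l`. -/
def side (ξ : Z → GraphRealization G) (N : K → Set Z) (l : L) (k : K) : Set (AugSpace N) :=
  {x | ∃ j, Sum.inl j ∈ treeBranch G (Sum.inr l) (Sum.inl k) ∧ x ∈ horoball N (component ξ j) j}

/-- The boundary points on the side of `k` of the cut point over `l`. -/
def BoundarySide (ξ : Z → GraphRealization G) (l : L) (k : K) (ζ : IdealBoundary E C γ e) : Prop :=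
  ∀ s, Rep s ζ → ∃ n, ∀ i ≥ n, s i ∈ side ξ N l k

theorem mem_side_of_lt (hT : IsTreeOfSpaces ξ) [Nonempty K]
    (hN : ∀ k, IsLatticeOf (component ξ k) (N k)) {l : L} {k : K}
    (h : G.Adj (Sum.inl k) (Sum.inr l)) {x y : AugSpace N} (hx : x ∈ side ξ N l k)
    (hxy : dist e (hT.cutPoint N l) < gromovProd e x y) : y ∈ side ξ N l k := by
  obtain ⟨i, hi, hxi⟩ := hx
  obtain ⟨j, hj⟩ := hT.exists_mem_horoball y
  refine ⟨j, ?_, hj⟩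
  by_contra hjk
  exact absurd (gromovProd_le_of_cut (hT.dist_eq_of_mem_horoball hN h hxi hi hj hjk)) (not_le.2 hxy)

theorem boundarySide_of_rep (hT : IsTreeOfSpaces ξ) [Nonempty K]
    (hN : ∀ k, IsLatticeOf (component ξ k) (N k)) (hγ : IsGCCBicombing E C γ) {l : L} {k : K}
    (h : G.Adj (Sum.inl k) (Sum.inr l)) {s : ℕ → AugSpace N} {ζ : IdealBoundary E C γ e}
    (hs : Rep s ζ) (H : ∀ n, ∃ i ≥ n, s i ∈ side ξ N l k) : BoundarySide ξ l k ζ := by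
  intro t ht
  obtain ⟨n, hn⟩ := asymptotic_iff.1 ((Rep.eq_iff (hT.fourPoint_augSpace hN) hγ hs ht).1 rfl)
    (dist e (hT.cutPoint N l) + 1)
  obtain ⟨i, hi, his⟩ := H n
  exact ⟨n, fun j hj => hT.mem_side_of_lt hN h his ((lt_add_one _).trans_le (hn i hi j hj))⟩

theorem BoundarySide.of_near (hT : IsTreeOfSpaces ξ) [Nonempty K]
    (hN : ∀ k, IsLatticeOf (component ξ k) (N k)) (hγ : IsGCCBicombing E C γ) {l : L} {k : K}
    (h : G.Adj (Sum.inl k) (Sum.inr l)) {ζ η : IdealBoundary E C γ e} (hζ : BoundarySide ξ l k ζ)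
    (H : Near (dist e (hT.cutPoint N l) + 41) ζ η) : BoundarySide ξ l k η := by
  intro t ht
  obtain ⟨s, hs⟩ := exists_rep ζ
  obtain ⟨n, hn⟩ := H.eventually_le (hT.fourPoint_augSpace hN) hγ hs ht
  obtain ⟨m, hm⟩ := hζ s hs
  refine ⟨n, fun j hj => hT.mem_side_of_lt (e := e) hN h (hm (max n m) (le_max_right _ _)) ?_⟩
  have := hn (max n m) (le_max_left _ _) j hj
  linarith

theorem isClopen_boundarySide (hT : IsTreeOfSpaces ξ) [Nonempty K]
    (hN : ∀ k, IsLatticeOf (component ξ k) (N k)) (hγ : IsGCCBicombing E C γ) {l : L} {k : K}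
    (h : G.Adj (Sum.inl k) (Sum.inr l)) :
    IsClopen {ζ : IdealBoundary E C γ e | BoundarySide ξ l k ζ} := by
  have h4 := hT.fourPoint_augSpace hN
  refine ⟨isOpen_compl_iff.1 ((isOpen_iff h4 hγ).2 fun ζ hζ => ?_),
    (isOpen_iff h4 hγ).2 fun ζ hζ => ?_⟩
  · exact ⟨_, fun η hη hη' => hζ (BoundarySide.of_near hT hN hγ h hη' hη.symm)⟩
  · exact ⟨_, fun η hη => BoundarySide.of_near hT hN hγ h hζ hη⟩

theorem BoundarySide.unique (hT : IsTreeOfSpaces ξ) [Nonempty K]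
    (hN : ∀ k, IsLatticeOf (component ξ k) (N k)) (hγ : IsGCCBicombing E C γ) {l : L} {k k' : K}
    (h : G.Adj (Sum.inl k) (Sum.inr l)) (h' : G.Adj (Sum.inl k') (Sum.inr l))
    {ζ : IdealBoundary E C γ e} (hk : BoundarySide ξ l k ζ) (hk' : BoundarySide ξ l k' ζ) :
    k = k' := by
  by_contra hne
  obtain ⟨s, hs⟩ := exists_rep ζ
  obtain ⟨n, hn⟩ := hk s hs
  obtain ⟨m, hm⟩ := hk' s hs
  obtain ⟨r, hr⟩ := asymptotic_iff.1 (hs.self (hT.fourPoint_augSpace hN) hγ)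
    (dist e (hT.cutPoint N l) + 1)
  set i := max r (max n m)
  have hri : r ≤ i := le_max_left _ _
  have hni : n ≤ i := (le_max_left _ _).trans (le_max_right _ _)
  have hmi : m ≤ i := (le_max_right _ _).trans (le_max_right _ _)
  obtain ⟨j, hj, hij⟩ := hn i hni
  obtain ⟨j', hj', hij'⟩ := hm i hmi
  have h1 := gromovProd_le_of_cut (e := e) (hT.dist_eq_of_mem_horoball hN h hij hj hij'
    (hT.notMem_treeBranch h' h (Ne.symm hne) hj'))
  have h2 := hr i hri i hri
  linarith

theorem boundarySide_center (hT : IsTreeOfSpaces ξ) [Nonempty K]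
    (hN : ∀ k, IsLatticeOf (component ξ k) (N k)) (hγ : IsGCCBicombing E C γ) (hc : IsCenter w c)
    {l : L} {k : K} (h : G.Adj (Sum.inl k) (Sum.inr l)) : BoundarySide ξ l k (c k) :=
  hT.boundarySide_of_rep hN hγ h (hc k) fun n =>
    ⟨n, le_rfl, k, treeBranch.self_mem, mem_horoball_ray k (w k) n⟩

/-- A boundary point that is not the center of the horoball at `κ` lies beyond one of the cut
points in that horoball. -/
theorem exists_boundarySide_of_ne_center (hT : IsTreeOfSpaces ξ) [Nonempty K]
    (hN : ∀ k, IsLatticeOf (component ξ k) (N k)) (hγ : IsGCCBicombing E C γ) (hc : IsCenter w c)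
    {κ : K} {ζ : IdealBoundary E C γ e} (hζ : ζ ≠ c κ) :
    ∃ l k, G.Adj (Sum.inl κ) (Sum.inr l) ∧ G.Adj (Sum.inl k) (Sum.inr l) ∧ k ≠ κ ∧
      BoundarySide ξ l k ζ := by
  have h4 := hT.fourPoint_augSpace hN
  obtain ⟨R, hR⟩ := hT.exists_not_nearPoint hN hγ hc hζ
  set b : AugSpace N := AugSpace.mk (.ray κ (w κ) (0 : ℕ)) with hb
  have hbκ : b ∈ horoball N (component ξ κ) κ := mem_horoball_ray κ (w κ) 0
  have hb0 : 0 ≤ dist e b := dist_nonneg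
  obtain ⟨s, hs⟩ := exists_rep ζ
  obtain ⟨n, hn⟩ := asymptotic_iff.1 (hs.self h4 hγ) (R + 20 + 2 * dist e b)
  obtain ⟨j, hj⟩ := hT.exists_mem_horoball (s n)
  have hjκ : j ≠ κ := by
    rintro rfl
    exact hR _ hj ⟨s, hs, n, fun i hi => by linarith [hn i hi n le_rfl]⟩
  obtain ⟨l, k, hl, hk, hkκ, hjl, hjk⟩ := hT.exists_toward hjκ
  refine ⟨l, k, hl, hk, hkκ, ?_⟩
  set g := hT.cutPoint N l with hg
  -- Otherwise `ζ` would be near the cut point, which belongs to the horoball.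
  have hlt : dist e g < R + 20 + 2 * dist e b := by
    by_contra! hle
    refine hR g (hT.cutPoint_mem_horoball hl) ⟨s, hs, n, fun i hi => ?_⟩
    have h1 := hT.dist_eq_of_mem_horoball hN hl hbκ treeBranch.self_mem hj hjl
    have h2 := abs_le.1 (abs_gromovProd_sub_le e b (s n) g)
    have h3 : gromovProd b (s n) g = dist b g := by
      unfold gromovProd
      rw [h1, dist_comm (s n) g]
      ring
    have h5 := dist_triangle e b g
    exact le_gromovProd h4 (r := R + 20) (y := s n) (by linarith [hn i hi n le_rfl])
      (by linarith) (by ring)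
  refine hT.boundarySide_of_rep hN hγ hk hs fun m => ⟨max n m, le_max_right _ _, ?_⟩
  exact hT.mem_side_of_lt (e := e) hN hk ⟨j, hjk, hj⟩
    (hlt.trans_le (hn n le_rfl _ (le_max_left _ _)))

theorem mem_treeBranch_of_adj (hT : IsTreeOfSpaces ξ) {l l' : L} {κ k k' : K} (hl : l' ≠ l)
    (hκ : G.Adj (Sum.inl κ) (Sum.inr l)) (hk : G.Adj (Sum.inl k) (Sum.inr l))
    (hk' : G.Adj (Sum.inl k') (Sum.inr l'))
    (h : (Sum.inl κ : K ⊕ L) ∈ treeBranch G (Sum.inr l') (Sum.inl k')) :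
    (Sum.inl k : K ⊕ L) ∈ treeBranch G (Sum.inr l') (Sum.inl k') := by
  by_contra hn
  by_cases hm : (Sum.inr l : K ⊕ L) ∈ treeBranch G (Sum.inr l') (Sum.inl k')
  · exact absurd (treeBranch.exit hT.tree hk' hm hn hk.symm).2 (by simp)
  · exact hl (Sum.inr_injective (treeBranch.exit hT.tree hk' h hm hκ).2).symm

/-- Distinct boundary points are separated by a cut point. -/
theorem exists_boundarySide_separating (hT : IsTreeOfSpaces ξ) [Nonempty K]
    (hN : ∀ k, IsLatticeOf (component ξ k) (N k)) (hγ : IsGCCBicombing E C γ) (hc : IsCenter w c)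
    {ζ η : IdealBoundary E C γ e} (hne : ζ ≠ η) :
    ∃ l k, G.Adj (Sum.inl k) (Sum.inr l) ∧ (BoundarySide ξ l k ζ ∧ ¬ BoundarySide ξ l k η ∨
      BoundarySide ξ l k η ∧ ¬ BoundarySide ξ l k ζ) := by
  have h4 := hT.fourPoint_augSpace hN
  by_cases hcenter : ∃ κ, ζ = c κ
  · obtain ⟨κ, rfl⟩ := hcenter
    obtain ⟨l, k, hκ, hk, hkκ, hside⟩ := hT.exists_boundarySide_of_ne_center hN hγ hc hne.symm
    refine ⟨l, k, hk, Or.inr ⟨hside, fun h => hkκ ?_⟩⟩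
    exact BoundarySide.unique hT hN hγ hk hκ h (hT.boundarySide_center hN hγ hc hκ)
  by_contra! hall
  obtain ⟨R, hR⟩ := not_forall.1 fun H => hne (eq_of_forall_near h4 hγ H)
  obtain ⟨s, hs⟩ := exists_rep ζ
  obtain ⟨n, hn⟩ := asymptotic_iff.1 (hs.self h4 hγ) R
  obtain ⟨i, hi⟩ := hT.exists_mem_horoball (s n)
  obtain ⟨o, ho⟩ := hT.exists_mem_horoball e
  -- The vertices `κ` such that `ζ` lies on the side of `κ` of all points that separate `κ` from
  -- the base point; among them, one closest to the vertex of `s n`.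
  set Q : Set K := {κ | ∀ l k₁ k₂, G.Adj (Sum.inl k₁) (Sum.inr l) → G.Adj (Sum.inl k₂) (Sum.inr l) →
    (Sum.inl o : K ⊕ L) ∈ treeBranch G (Sum.inr l) (Sum.inl k₁) →
    (Sum.inl κ : K ⊕ L) ∈ treeBranch G (Sum.inr l) (Sum.inl k₂) → k₁ ≠ k₂ → BoundarySide ξ l k₂ ζ}
    with hQ
  have hoQ : o ∈ Q := fun l k₁ k₂ h₁ h₂ ho₁ ho₂ hne =>
    absurd ho₂ (hT.notMem_treeBranch h₁ h₂ hne ho₁)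
  obtain ⟨κ, hκQ, hmin⟩ := (measure fun κ : K =>
    G.dist (Sum.inl κ : K ⊕ L) (Sum.inl i)).wf.has_min Q ⟨o, hoQ⟩
  obtain ⟨l, k, hκ, hk, hkκ, hside⟩ := hT.exists_boundarySide_of_ne_center hN hγ hc (κ := κ)
    fun h => hcenter ⟨κ, h⟩
  -- `ζ` lies beyond the cut point over `l`, on the side of `k`, but by minimality `s n` does not.
  have hik : (Sum.inl i : K ⊕ L) ∉ treeBranch G (Sum.inr l) (Sum.inl k) := by
    intro hik
    refine hmin k (fun l' k₁ k₂ h₁ h₂ ho₁ hk₂ hne' => ?_) ?_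
    · by_cases hl : l' = l
      · subst hl
        obtain rfl : k₂ = k := by
          by_contra h
          exact hT.notMem_treeBranch h₂ hk h hk₂ treeBranch.self_mem
        exact hside
      · refine hκQ l' k₁ k₂ h₁ h₂ ho₁ ?_ hne'
        exact hT.mem_treeBranch_of_adj hl hk hκ h₂ hk₂
    · change G.dist (Sum.inl k) (Sum.inl i) < G.dist (Sum.inl κ) (Sum.inl i)
      have := treeBranch.dist_eq hT.tree hk hik
        (hT.notMem_treeBranch hκ hk hkκ.symm treeBranch.self_mem)
      rw [SimpleGraph.dist_comm (u := Sum.inl κ), SimpleGraph.dist_comm (u := Sum.inl k)]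
      omega
  have hok : (Sum.inl o : K ⊕ L) ∉ treeBranch G (Sum.inr l) (Sum.inl k) := by
    intro hok
    refine hkκ (BoundarySide.unique hT hN hγ hk hκ hside ?_)
    exact hκQ l k κ hk hκ hok treeBranch.self_mem hkκ
  have hside' : BoundarySide ξ l k η := (hall l k hk).1 hside
  obtain ⟨m, hm⟩ := hside s hs
  obtain ⟨t, ht⟩ := exists_rep η
  obtain ⟨m', hm'⟩ := hside' t ht
  -- So this cut point is far from `e`, and sequences to `ζ` and to `η` both run through it.
  have hfar : R ≤ dist e (hT.cutPoint N l) := by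
    obtain ⟨j, hj, hmj⟩ := hm (max n m) (le_max_right _ _)
    exact (hn _ (le_max_left _ _) n le_rfl).trans
      (gromovProd_le_of_cut (hT.dist_eq_of_mem_horoball hN hk hmj hj hi hik))
  refine hR ⟨s, t, hs, ht, max m m', fun a ha b hb => hfar.trans ?_⟩
  obtain ⟨j, hj, hja⟩ := hm a (le_of_max_le_left ha)
  obtain ⟨j', hj', hjb⟩ := hm' b (le_of_max_le_right hb)
  have e1 := hT.dist_eq_of_mem_horoball hN hk hja hj ho hok
  have e2 := hT.dist_eq_of_mem_horoball hN hk hjb hj' ho hok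
  have e3 := dist_triangle_right (s a) (t b) (hT.cutPoint N l)
  unfold gromovProd
  rw [dist_comm e (s a), dist_comm e (t b), e1, e2, dist_comm (hT.cutPoint N l) e]
  linarith

theorem countable_right (hT : IsTreeOfSpaces ξ) [ProperSpace Z] : Countable L := by
  classical
  refine Pairwise.countable_of_isOpen_disjoint (s := fun l : L => partOver ξ {Sum.inr l}) ?_
    (fun l => hT.isOpen_partOver _) fun l => ⟨hT.cut l, _, rfl, ?_⟩
  · intro l l' hne
    refine Set.disjoint_left.2 ?_
    rintro z ⟨_, rfl, h⟩ ⟨_, rfl, h'⟩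
    exact hT.bipartite_right _ _
      (GraphRealization.adj_of_pos _ (fun h => hne (Sum.inr_injective h)) h h')
  · rw [hT.eq_vertex_iff.2 rfl, GraphRealization.vertex_apply]; simp

theorem countable_left (hT : IsTreeOfSpaces ξ) [ProperSpace Z]
    (hN : ∀ k, IsLatticeOf (component ξ k) (N k)) (hfat : ∀ k, ¬ (N k).Subsingleton) (o : Z) :
    Countable K := by
  rw [← Set.countable_univ_iff]
  have : (univ : Set K) ⊆ ⋃ n : ℕ, {k | ¬ (N k).Subsingleton ∧ ∃ x ∈ N k, dist o x ≤ n} := by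
    intro k _
    obtain ⟨x, hx, -⟩ := Set.not_subsingleton_iff.1 (hfat k)
    obtain ⟨n, hn⟩ := exists_nat_ge (dist o x)
    exact mem_iUnion.2 ⟨n, hfat k, x, hx, hn⟩
  exact (countable_iUnion fun n : ℕ => (hT.finite_lattice_index hN o n).countable).mono this

/-- If no point of the ideal boundary is isolated, then it is a Cantor space: the components are
unbounded, hence locally finite in number, and the boundary is compact; the sides of the cut points
are countably many clopen sets that separate points. -/
theorem nonempty_homeomorph_cantor (hT : IsTreeOfSpaces ξ) [ProperSpace Z] [Nonempty K]
    (hN : ∀ k, IsLatticeOf (component ξ k) (N k)) (hγ : IsGCCBicombing E C γ) (hc : IsCenter w c)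
    (hperf : ∀ x : IdealBoundary E C γ e, ¬ IsOpen {x}) :
    Nonempty (IdealBoundary E C γ e ≃ₜ (ℕ → Bool)) := by
  have h4 := hT.fourPoint_augSpace hN
  have hunb : ∀ k, ¬ Bornology.IsBounded (component ξ k ∩ branchPoints ξ) := fun k hb =>
    hperf _ (hT.isOpen_singleton_center hN hγ hc hb)
  have hfat : ∀ k, ¬ (N k).Subsingleton := by
    intro k hk
    refine hunb k ((Metric.isBounded_closedBall (x := (w k : Z)) (r := 2)).subset fun z hz => ?_)
    obtain ⟨y, hy, hzy⟩ := (hN k).dense z hz.1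
    rw [Metric.mem_closedBall, hk (w k).2 hy]
    exact hzy
  obtain ⟨k₀⟩ := ‹Nonempty K›
  have : Nonempty K := ⟨k₀⟩
  have hcompact : CompactSpace (IdealBoundary E C γ e) := by
    refine compactSpace h4 hγ fun r => ?_
    obtain ⟨W, hW, hWmem⟩ := PreAug.exists_isCompact hN (S := univ)
      (fun o R => (hT.finite_lattice_index hN o R).subset fun k hk => ⟨hfat k, hk.2⟩) e r
    obtain ⟨F, -, hF, hcover⟩ := hW.finite_cover_balls one_pos
    refine ⟨F, hF, fun x hx => ?_⟩
    obtain ⟨p, rfl⟩ := AugSpace.mk_surjective x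
    have hp : p.InPart univ := by cases p <;> trivial
    obtain ⟨f, hf, hpf⟩ := mem_iUnion₂.1 (hcover (hWmem p hp hx))
    exact ⟨f, hf, (Metric.mem_ball.1 hpf).le⟩
  have : Nonempty (IdealBoundary E C γ e) := ⟨c k₀⟩
  have := hT.countable_right
  have := hT.countable_left hN hfat (w k₀ : Z)
  set ι := {p : L × K // G.Adj (Sum.inl p.2) (Sum.inr p.1)}
  have hι : Nonempty ι := by
    obtain ⟨z, -, l, ⟨k, k', -, hk, -⟩, -⟩ : (component ξ k₀ ∩ branchPoints ξ).Nonempty := by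
      by_contra h
      rw [Set.not_nonempty_iff_eq_empty] at h
      exact hunb k₀ (h ▸ Bornology.isBounded_empty)
    exact ⟨⟨(l, k), hk⟩⟩
  obtain ⟨φ, hφ⟩ := exists_surjective_nat ι
  refine CantorScheme.nonempty_homeomorph
    (fun i => {ζ | BoundarySide ξ (φ i).1.1 (φ i).1.2 ζ})
    (fun i => hT.isClopen_boundarySide hN hγ (φ i).2) (fun ζ η hne => ?_) hperf
  obtain ⟨l, k, hk, hsep⟩ := hT.exists_boundarySide_separating hN hγ hc hne
  obtain ⟨i, hi⟩ := hφ ⟨(l, k), hk⟩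
  refine ⟨i, ?_⟩
  rw [hi]
  exact hsep

end IsTreeOfSpaces

theorem mainTheorem10 {Z : Type*} [MetricSpace Z] [ProperSpace Z] {K L : Type*} [Nonempty K]
    (G : SimpleGraph (K ⊕ L)) (ξ : Z → GraphRealization G) (hZ : IsTreeOfGCCSpaces ξ)
    (N : K → Set Z) (hN : ∀ k, IsLatticeOf (component ξ k) (N k)) :
    (∃ (E C : ℝ) (γ : AugSpace N → AugSpace N → ℝ → AugSpace N), IsGCCBicombing E C γ) ∧
    ∀ (E C : ℝ) (γ : AugSpace N → AugSpace N → ℝ → AugSpace N), IsGCCBicombing E C γ →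
      ∀ e : AugSpace N, ∃ c : K → IdealBoundary E C γ e,
        (∀ k, closure ((Bordification.pt : AugSpace N → Bordification E C γ e) ''
              horoball N (component ξ k) k) \
            ((Bordification.pt : AugSpace N → Bordification E C γ e) ''
              horoball N (component ξ k) k) = {Bordification.bd (c k)}) ∧
        {x : IdealBoundary E C γ e | IsOpen {x}} =
          {x | ∃ k, Bornology.IsBounded (component ξ k ∩ branchPoints ξ) ∧ x = c k} ∧
        ((∀ x : IdealBoundary E C γ e, ¬ IsOpen {x}) →
          Nonempty (IdealBoundary E C γ e ≃ₜ (ℕ → Bool))) := by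
  have hT := hZ.1
  refine ⟨hT.exists_isGCCBicombing_augSpace hN, fun E C γ hγ e => ?_⟩
  obtain ⟨p, -⟩ := AugSpace.mk_surjective e
  obtain ⟨z, -⟩ := ChainJoined.exists_base p
  choose w hw using hT.lattice_nonempty hN z
  obtain ⟨c, hc⟩ := hT.exists_isCenter hN hγ (fun k => (⟨w k, hw k⟩ : N k)) (e := e)
  refine ⟨c, hT.closure_horoball_diff hN hγ hc, ?_, hT.nonempty_homeomorph_cantor hN hγ hc⟩
  ext x
  constructor
  · intro hx
    have hx : IsOpen {x} := hx
    obtain ⟨R, hR⟩ := (IdealBoundary.isOpen_singleton_iff (hT.fourPoint_augSpace hN) hγ).1 hx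
    obtain ⟨k, hk⟩ := hT.exists_center_near hN hγ hc x R
    have hkx := hR _ hk
    rw [← hkx] at hx
    exact ⟨k, hT.isBounded_of_isOpen_singleton_center hN hγ hc hx, hkx.symm⟩
  · rintro ⟨k, hk, rfl⟩
    exact hT.isOpen_singleton_center hN hγ hc hk
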